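/- Let $n\ge 2$ and write $\mathbb{Y}^{n+1}=\mathbb{S}^{n-1}\times\mathbb{R}\times\mathbb{R}_{+}$, equipped with the measure $a^{-n}\,d\mathbf{u}\,db\,da$, where $d\mathbf u$ is the surface measure of the unit sphere $\mathbb{S}^{n-1}$ of $\mathbb{R}^n$. Let $\mathcal{S}_0(\mathbb{R}^d)$ be the closed subspace of $\mathcal{S}(\mathbb{R}^d)$ of the Schwartz functions all of whose moments vanish, with dual $\mathcal{S}_0'(\mathbb{R}^d)$, and let $\mathcal{S}(\mathbb{Y}^{n+1})$ be the space of $\Phi\in C^\infty(\mathbb{Y}^{n+1})$ such that $$\sup_{(\mathbf{u},b,a)\in\mathbb{Y}^{n+1}}\Big(a^{s}+\frac1{a^{s}}\Big)(1+b^2)^{r/2}\left|\partial_a^l\,\partial_b^m\,\triangle_{\mathbf{u}}^k\Phi(\mathbf{u},b,a)\right|<\infty\qquad\text{for all } s,r,l,m,k\in\mathbb{N}_0,$$ where $\triangle_{\mathbf u}$ is the Laplace–Beltrami operator of $\mathbb{S}^{n-1}$; it is topologized by these seminorms and its dual is $\mathcal{S}'(\mathbb{Y}^{n+1})$. For $\psi\in\mathcal{S}(\mathbb{R})$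 put $$\psi_{\mathbf{u},b,a}(\mathbf{x})=\frac1a\,\psi\Big(\frac{\mathbf{x}\cdot\mathbf{u}-b}{a}\Big),\qquad \mathcal{R}^t_{\psi}\Phi(\mathbf{x})=\int_{\mathbb{Y}^{n+1}}\Phi(\mathbf{u},b,a)\,\psi_{\mathbf{u},b,a}(\mathbf{x})\,\frac{d\mathbf{u}\,db\,da}{a^n}.$$ For $\psi\in\mathcal{S}_0(\mathbb{R})$ and $f\in\mathcal{S}_0'(\mathbb{R}^n)$, the ridgelet transform $\mathcal{R}_\psi f\in\mathcal{S}'(\mathbb{Y}^{n+1})$ is defined by duality, $$\langle\mathcal{R}_\psi f,\Phi\rangle=\langle f,\mathcal{R}^t_{\overline\psi}\Phi\rangle,\qquad \Phi\in\mathcal{S}(\mathbb{Y}^{n+1}),$$ where $\mathcal{R}^t_{\overline\psi}\Phi\in\mathcal{S}_0(\mathbb{R}^n)$. **Theorem.** Let $n\ge2$, $\psi\in\mathcal{S}_0(\mathbb{R})$ and $f\in\mathcal{D}'_{L^1}(\mathbb{R}^n)$ (the space of Schwartz integrable distributions, i.e. the tempered distributions continuous for the seminorms $\sup_{\mathbf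 x}|\partial^\alpha\varphi(\mathbf x)|$, $\alpha\in\mathbb{N}_0^n$). Then 1. for every $(\mathbf{u},b,a)\in\mathbb{Y}^{n+1}$ the number $F(\mathbf{u},b,a)=\langle f,\overline{\psi}_{\mathbf{u},b,a}\rangle$ is well defined, as the value at $\overline{\psi}_{\mathbf{u},b,a}\in\mathcal{D}_{L^\infty}(\mathbb{R}^n)$ of the canonical extension of $f$: one has $\langle f,g_j\rangle\to F(\mathbf{u},b,a)$ for every sequence of Schwartz functions $g_j$ which is bounded in $\mathcal{D}_{L^\infty}(\mathbb{R}^n)$ and converges to $\overline{\psi}_{\mathbf{u},b,a}$ uniformly on compact sets together with all derivatives, and such sequences exist; 2. the ridgelet transform $\mathcal{R}_\psi f\in\mathcal{S}'(\mathbb{Y}^{n+1})$, defined by duality for the restriction of $f$ to $\mathcal{S}_0(\mathbb{R}^n)$ (in particular $\mathcal{R}^t_{\overline\psi}\Phi\in\mathcal{S}_0(\mathbb{R}^n)$ for all $\Phi\in\mathcal{S}(\mathbb{Y}^{n+1})$), is the regular distribution given by the function $F$. That is, $F$ is locally integrable, it is of slow growth, meaning that $|F(\mathbf{u},b,a)|\le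 C(1+|b|)^s(a^s+a^{-s})$ on $\mathbb{Y}^{n+1}$ for some $s,C>0$, and $$\langle\mathcal{R}_\psi f,\Phi\rangle=\int_0^\infty\int_{-\infty}^\infty\int_{\mathbb{S}^{n-1}}\langle f,\overline{\psi}_{\mathbf{u},b,a}\rangle\,\Phi(\mathbf{u},b,a)\,\frac{d\mathbf{u}\,db\,da}{a^n},\qquad \Phi\in\mathcal{S}(\mathbb{Y}^{n+1}),$$ where the integral converges absolutely. -/

import Mathlib

open MeasureTheory Filter Topology Set
open scoped SchwartzMap ContDiff ComplexConjugate

namespace Ridgelet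

noncomputable section

/-- The Euclidean space `ℝⁿ`. -/
abbrev Rn (n : ℕ) : Type := EuclideanSpace ℝ (Fin n)

/-- The unit sphere `𝕊ⁿ⁻¹` of `ℝⁿ`. -/
abbrev Sph (n : ℕ) : Type := Metric.sphere (0 : Rn n) 1

/-- `𝕐ⁿ⁺¹ = 𝕊ⁿ⁻¹ × ℝ × ℝ₊`, with points `(u, b, a)`. -/
abbrev Y (n : ℕ) : Type := Sph n × ℝ × Ioi (0 : ℝ)

/-- The standard measure `a⁻ⁿ du db da` on `𝕐ⁿ⁺¹`, with `du` the surface measure of the sphere. -/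
def stdMeasure (n : ℕ) : Measure (Y n) :=
  (volume : Measure (Rn n)).toSphere.prod
    ((volume : Measure ℝ).prod
      (((volume : Measure ℝ).comap ((↑) : Ioi (0 : ℝ) → ℝ)).withDensity fun a => ENNReal.ofReal (((a : ℝ) ^ n)⁻¹)))

/-! ### Lizorkin spaces -/

lemma integrable_monomial_mul {n : ℕ} (m : Fin n → ℕ) (φ : 𝓢(Rn n, ℂ)) :
    Integrable fun x : Rn n => ((∏ i, x i ^ m i : ℝ) : ℂ) * φ x := by
  have hb : ∀ x : Rn n, ‖((∏ i, x i ^ m i : ℝ) : ℂ)‖ ≤ ‖x‖ ^ (∑ i, m i) := by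
    intro x
    rw [Complex.norm_real, norm_prod, ← Finset.prod_pow_eq_pow_sum]
    refine Finset.prod_le_prod (fun _ _ => norm_nonneg _) fun i _ => ?_
    rw [norm_pow]
    exact pow_le_pow_left₀ (norm_nonneg _) (PiLp.norm_apply_le x i) _
  refine (φ.integrable_pow_mul volume (∑ i, m i)).mono' ?_ (Eventually.of_forall fun x => ?_)
  · refine Continuous.aestronglyMeasurable ?_
    have := φ.continuous
    fun_prop
  · rw [norm_mul]
    exact mul_le_mul_of_nonneg_right (hb x) (norm_nonneg _)

lemma integrable_pow_mul_real (m : ℕ) (φ : 𝓢(ℝ, ℂ)) :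
    Integrable fun x : ℝ => ((x ^ m : ℝ) : ℂ) * φ x := by
  refine (φ.integrable_pow_mul volume m).mono' ?_ (Eventually.of_forall fun x => ?_)
  · refine Continuous.aestronglyMeasurable ?_
    have := φ.continuous
    fun_prop
  · rw [norm_mul, Complex.norm_real, norm_pow]

/-- The Lizorkin test function space `𝒮₀(ℝⁿ)`: Schwartz functions all of whose moments vanish,
with the topology induced by `𝒮(ℝⁿ)`. -/
def lizorkin (n : ℕ) : Submodule ℂ 𝓢(Rn n, ℂ) where
  carrier := {φ | ∀ m : Fin n → ℕ, ∫ x : Rn n, ((∏ i, x i ^ m i : ℝ) : ℂ) * φ x = 0}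
  zero_mem' := by intro m; simp
  add_mem' := by
    intro φ χ hφ hχ m
    have h := integral_add (integrable_monomial_mul m φ) (integrable_monomial_mul m χ)
    rw [hφ m, hχ m, add_zero] at h
    rw [← h]
    simp only [add_apply, mul_add]
  smul_mem' := by
    intro c φ hφ m
    have h := integral_const_mul (μ := volume) c fun x : Rn n => ((∏ i, x i ^ m i : ℝ) : ℂ) * φ x
    rw [hφ m, mul_zero] at h
    rw [← h]
    simp only [smul_apply, smul_eq_mul]
    congr 1 with x
    ring

/-- The Lizorkin test function space `𝒮₀(ℝ)` on the real line. -/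
def lizorkinReal : Submodule ℂ 𝓢(ℝ, ℂ) where
  carrier := {ψ | ∀ m : ℕ, ∫ x : ℝ, ((x ^ m : ℝ) : ℂ) * ψ x = 0}
  zero_mem' := by intro m; simp
  add_mem' := by
    intro φ χ hφ hχ m
    have h := integral_add (integrable_pow_mul_real m φ) (integrable_pow_mul_real m χ)
    rw [hφ m, hχ m, add_zero] at h
    rw [← h]
    simp only [add_apply, mul_add]
  smul_mem' := by
    intro c φ hφ m
    have h := integral_const_mul (μ := volume) c fun x : ℝ => ((x ^ m : ℝ) : ℂ) * φ x
    rw [hφ m, mul_zero] at h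
    rw [← h]
    simp only [smul_apply, smul_eq_mul]
    congr 1 with x
    ring

/-- The space `𝒮₀'(ℝⁿ)` of Lizorkin distributions (as a vector space). -/
abbrev LizorkinDual (n : ℕ) : Type := lizorkin n →L[ℂ] ℂ

/-- The Lizorkin distribution given by a tempered distribution: its restriction to `𝒮₀(ℝⁿ)`. -/
def toLizorkinDual {n : ℕ} (f : 𝓢'(Rn n, ℂ)) : LizorkinDual n where
  toFun φ := f (φ : 𝓢(Rn n, ℂ))
  map_add' φ χ := by simp
  map_smul' c φ := by simp
  cont := f.continuous.comp continuous_subtype_val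

/-! ### Integrable distributions -/

/-- `f ∈ 𝒟'_{L¹}(ℝⁿ)`. The space `𝒟'_{L¹}` is the dual of the closure of the test functions in the
space of smooth functions with bounded derivatives, topologized by the seminorms
`sup ‖Dᵏφ‖`, `k ∈ ℕ`. As `𝒮(ℝⁿ)` lies densely in that closure, `𝒟'_{L¹}` consists
of the tempered distributions that are continuous for these seminorms. -/
def IsIntegrableDistribution {n : ℕ} (f : 𝓢'(Rn n, ℂ)) : Prop :=
  ∃ (N : ℕ) (C : ℝ), ∀ φ : 𝓢(Rn n, ℂ),
    ‖f φ‖ ≤ C * ∑ k ∈ Finset.range (N + 1), ⨆ x : Rn n, ‖iteratedFDeriv ℝ k φ x‖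

/-- The sequence `g j` of Schwartz functions is bounded in `𝒟_{L^∞}(ℝⁿ)` and converges to `φ` in
`C^∞(ℝⁿ)`, i.e. uniformly on compact sets together with all derivatives. -/
structure BoundedApprox {n : ℕ} (g : ℕ → 𝓢(Rn n, ℂ)) (φ : Rn n → ℂ) : Prop where
  bounded : ∀ k : ℕ, ∃ C : ℝ, ∀ (j : ℕ) (x : Rn n), ‖iteratedFDeriv ℝ k (g j) x‖ ≤ C
  tendsto : ∀ (k : ℕ) (K : Set (Rn n)), IsCompact K →
    TendstoUniformlyOn (fun j => iteratedFDeriv ℝ k (g j)) (iteratedFDeriv ℝ k φ) atTop K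

/-- The value `⟨f, φ⟩` of an integrable distribution `f` on a function `φ ∈ 𝒟_{L^∞}(ℝⁿ)` exists
and equals `c`: the canonical extension of `f` from `𝒮(ℝⁿ)` to `𝒟_{L^∞}(ℝⁿ)`, continuous for
convergence in `C^∞(ℝⁿ)` of sequences that are bounded in `𝒟_{L^∞}(ℝⁿ)`, takes the value `c`
at `φ`. -/
def HasPairing {n : ℕ} (f : 𝓢'(Rn n, ℂ)) (φ : Rn n → ℂ) (c : ℂ) : Prop :=
  (∃ g, BoundedApprox g φ) ∧ ∀ g, BoundedApprox g φ → Tendsto (fun j => f (g j)) atTop (𝓝 c)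

lemma HasPairing.unique {n : ℕ} {f : 𝓢'(Rn n, ℂ)} {φ : Rn n → ℂ} {c d : ℂ}
    (hc : HasPairing f φ c) (hd : HasPairing f φ d) : c = d := by
  obtain ⟨g, hg⟩ := hc.1
  exact tendsto_nhds_unique (hc.2 g hg) (hd.2 g hg)

open Classical in
/-- The number `⟨f, φ⟩`, for `f ∈ 𝒟'_{L¹}(ℝⁿ)` and `φ ∈ 𝒟_{L^∞}(ℝⁿ)`. -/
def pairing {n : ℕ} (f : 𝓢'(Rn n, ℂ)) (φ : Rn n → ℂ) : ℂ :=
  if h : ∃ c, HasPairing f φ c then h.choose else 0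

/-! ### Ridgelets, the ridgelet transform as a function, the ridgelet synthesis operator -/

/-- The ridgelet `ψ_{u,b,a}(x) = a⁻¹ ψ((x·u - b)/a)`. -/
def ridgelet {n : ℕ} (ψ : ℝ → ℂ) (y : Y n) (x : Rn n) : ℂ :=
  (((y.2.2 : ℝ)⁻¹ : ℝ) : ℂ) * ψ ((inner ℝ x (y.1 : Rn n) - y.2.1) / (y.2.2 : ℝ))

/-- The function `(u,b,a) ↦ ⟨f, ψ̄_{u,b,a}⟩` on `𝕐ⁿ⁺¹`, for `f ∈ 𝒟'_{L¹}(ℝⁿ)`. -/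
def ridgeletFunction {n : ℕ} (ψ : ℝ → ℂ) (f : 𝓢'(Rn n, ℂ)) (y : Y n) : ℂ :=
  pairing f fun x => conj (ridgelet ψ y x)

/-- The ridgelet synthesis operator
`R^t_ψ Φ(x) = ∫ Φ(u,b,a) ψ_{u,b,a}(x) a⁻ⁿ db da du`. -/
def synthesis {n : ℕ} (ψ : ℝ → ℂ) (Φ : Y n → ℂ) (x : Rn n) : ℂ :=
  ∫ y, Φ y * ridgelet ψ y x ∂stdMeasure n

/-! ### Smooth functions on `𝕐ⁿ⁺¹` and their derivatives -/

/-- The open set `(ℝⁿ \ {0}) × ℝ × ℝ₊`. -/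
def coneSet (n : ℕ) : Set (Rn n × ℝ × ℝ) := {p | p.1 ≠ 0 ∧ 0 < p.2.2}

lemma norm_inv_smul_mem {n : ℕ} {x : Rn n} (hx : x ≠ 0) :
    ‖x‖⁻¹ • x ∈ Metric.sphere (0 : Rn n) 1 := by
  simp [norm_smul, hx]

open Classical in
/-- The extension of `Φ`, homogeneous of degree `0` in the first variable, to
`(ℝⁿ \ {0}) × ℝ × ℝ₊` (and by zero elsewhere): `(x, b, a) ↦ Φ(x/|x|, b, a)`. -/
def extend {n : ℕ} (Φ : Y n → ℂ) (p : Rn n × ℝ × ℝ) : ℂ :=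
  if h : p ∈ coneSet n then Φ (⟨‖p.1‖⁻¹ • p.1, norm_inv_smul_mem h.1⟩, p.2.1, ⟨p.2.2, h.2⟩) else 0

/-- `Φ ∈ C^∞(𝕐ⁿ⁺¹)`. -/
def IsSmooth {n : ℕ} (Φ : Y n → ℂ) : Prop := ContDiffOn ℝ ∞ (extend Φ) (coneSet n)

/-- The partial derivative `∂/∂a`. -/
def dA {n : ℕ} (Φ : Y n → ℂ) (y : Y n) : ℂ :=
  deriv (fun a : ℝ => extend Φ ((y.1 : Rn n), y.2.1, a)) y.2.2

/-- The partial derivative `∂/∂b`. -/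
def dB {n : ℕ} (Φ : Y n → ℂ) (y : Y n) : ℂ :=
  deriv (fun b : ℝ => extend Φ ((y.1 : Rn n), b, (y.2.2 : ℝ))) y.2.1

/-- The Laplace–Beltrami operator of the unit sphere acting on the variable `u`: the Euclidean
Laplacian of the extension that is homogeneous of degree `0`, restricted to the sphere. -/
def lapU {n : ℕ} (Φ : Y n → ℂ) (y : Y n) : ℂ :=
  Laplacian.laplacian (fun x : Rn n => extend Φ (x, y.2.1, (y.2.2 : ℝ))) (y.1 : Rn n)

/-- The operator `∂_a^l ∂_b^m Δ_u^k`. -/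
def diffOp {n : ℕ} (l m k : ℕ) (Φ : Y n → ℂ) : Y n → ℂ := dA^[l] (dB^[m] (lapU^[k] Φ))

/-! These operators preserve smoothness and are linear on smooth functions. -/

lemma isOpen_coneSet (n : ℕ) : IsOpen (coneSet n) := by
  have h1 : IsOpen {p : Rn n × ℝ × ℝ | p.1 ≠ 0} := isOpen_ne_fun continuous_fst continuous_const
  have h2 : IsOpen {p : Rn n × ℝ × ℝ | 0 < p.2.2} :=
    isOpen_lt continuous_const (continuous_snd.comp continuous_snd)
  exact h1.inter h2

lemma coe_mem_coneSet {n : ℕ} (y : Y n) : ((y.1 : Rn n), y.2.1, (y.2.2 : ℝ)) ∈ coneSet n := by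
  refine ⟨?_, y.2.2.2⟩
  have h : ‖(y.1 : Rn n)‖ = 1 := norm_eq_of_mem_sphere y.1
  intro h0
  simp only at h0
  rw [h0] at h
  simp at h

lemma extend_add {n : ℕ} (Φ Ψ : Y n → ℂ) : extend (Φ + Ψ) = extend Φ + extend Ψ := by
  ext p
  by_cases h : p ∈ coneSet n <;> simp [extend, h]

lemma extend_smul {n : ℕ} (c : ℂ) (Φ : Y n → ℂ) : extend (c • Φ) = c • extend Φ := by
  ext p
  by_cases h : p ∈ coneSet n <;> simp [extend, h]

lemma extend_zero (n : ℕ) : extend (0 : Y n → ℂ) = 0 := by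
  ext p
  by_cases h : p ∈ coneSet n <;> simp [extend, h]

/-- The retraction `(x, b, a) ↦ (x/|x|, b, a)`. -/
def retr {n : ℕ} (p : Rn n × ℝ × ℝ) : Rn n × ℝ × ℝ := (‖p.1‖⁻¹ • p.1, p.2.1, p.2.2)

lemma retr_mem {n : ℕ} {p : Rn n × ℝ × ℝ} (hp : p ∈ coneSet n) : retr p ∈ coneSet n := by
  refine ⟨?_, hp.2⟩
  simpa [retr] using hp.1

lemma contDiffOn_retr (n : ℕ) : ContDiffOn ℝ ∞ (retr (n := n)) (coneSet n) := by
  have h1 : ContDiffOn ℝ ∞ (fun p : Rn n × ℝ × ℝ => ‖p.1‖) (coneSet n) :=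
    contDiff_fst.contDiffOn.norm ℝ fun p hp => hp.1
  have h2 : ContDiffOn ℝ ∞ (fun p : Rn n × ℝ × ℝ => ‖p.1‖⁻¹) (coneSet n) :=
    h1.inv fun p hp => norm_ne_zero_iff.2 hp.1
  exact (h2.smul contDiff_fst.contDiffOn).prodMk contDiff_snd.contDiffOn

/-- If an operator is given on points of `𝕐ⁿ⁺¹` by a smooth function, the result is smooth. -/
lemma isSmooth_of_eq {n : ℕ} {Ψ : Y n → ℂ} {G : Rn n × ℝ × ℝ → ℂ}
    (hG : ContDiffOn ℝ ∞ G (coneSet n))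
    (h : ∀ y : Y n, Ψ y = G ((y.1 : Rn n), y.2.1, (y.2.2 : ℝ))) : IsSmooth Ψ := by
  refine (hG.comp (contDiffOn_retr n) fun p hp => retr_mem hp).congr fun p hp => ?_
  simp only [extend, hp, dif_pos, h]
  rfl

lemma contDiffOn_dir {n : ℕ} {G : Rn n × ℝ × ℝ → ℂ} (hG : ContDiffOn ℝ ∞ G (coneSet n))
    (w : Rn n × ℝ × ℝ) : ContDiffOn ℝ ∞ (fun p => fderiv ℝ G p w) (coneSet n) :=
  (hG.fderiv_of_isOpen (isOpen_coneSet n) (by simp)).clm_apply contDiffOn_const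

lemma hasFDerivAt_of_mem {n : ℕ} {G : Rn n × ℝ × ℝ → ℂ} (hG : ContDiffOn ℝ ∞ G (coneSet n))
    {p : Rn n × ℝ × ℝ} (hp : p ∈ coneSet n) : HasFDerivAt G (fderiv ℝ G p) p :=
  ((hG.contDiffAt ((isOpen_coneSet n).mem_nhds hp)).differentiableAt (by simp)).hasFDerivAt

lemma dA_eq {n : ℕ} {Φ : Y n → ℂ} (h : IsSmooth Φ) (y : Y n) :
    dA Φ y = fderiv ℝ (extend Φ) ((y.1 : Rn n), y.2.1, (y.2.2 : ℝ)) (0, 0, 1) := by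
  have h1 : HasDerivAt (fun a : ℝ => ((y.1 : Rn n), y.2.1, a)) (0, 0, 1) (y.2.2 : ℝ) :=
    (hasDerivAt_const _ _).prodMk ((hasDerivAt_const _ _).prodMk (hasDerivAt_id _))
  exact ((hasFDerivAt_of_mem h (coe_mem_coneSet y)).comp_hasDerivAt _ h1).deriv

lemma dB_eq {n : ℕ} {Φ : Y n → ℂ} (h : IsSmooth Φ) (y : Y n) :
    dB Φ y = fderiv ℝ (extend Φ) ((y.1 : Rn n), y.2.1, (y.2.2 : ℝ)) (0, 1, 0) := by
  have h1 : HasDerivAt (fun b : ℝ => ((y.1 : Rn n), b, (y.2.2 : ℝ))) (0, 1, 0) y.2.1 :=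
    (hasDerivAt_const _ _).prodMk ((hasDerivAt_id _).prodMk (hasDerivAt_const _ _))
  exact ((hasFDerivAt_of_mem h (coe_mem_coneSet y)).comp_hasDerivAt _ h1).deriv

lemma hasFDerivAt_slice {n : ℕ} {G : Rn n × ℝ × ℝ → ℂ} (hG : ContDiffOn ℝ ∞ G (coneSet n))
    {x : Rn n} {b a : ℝ} (hp : (x, b, a) ∈ coneSet n) :
    HasFDerivAt (fun z : Rn n => G (z, b, a))
      ((fderiv ℝ G (x, b, a)).comp (ContinuousLinearMap.inl ℝ (Rn n) (ℝ × ℝ))) x :=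
  (hasFDerivAt_of_mem hG hp).comp x (hasFDerivAt_prodMk_left x (b, a))

lemma lapU_eq {n : ℕ} {Φ : Y n → ℂ} (h : IsSmooth Φ) (y : Y n) :
    lapU Φ y = ∑ i, fderiv ℝ (fun p => fderiv ℝ (extend Φ) p (EuclideanSpace.basisFun (Fin n) ℝ i, 0))
      ((y.1 : Rn n), y.2.1, (y.2.2 : ℝ)) (EuclideanSpace.basisFun (Fin n) ℝ i, 0) := by
  have hy := coe_mem_coneSet y
  rw [lapU, InnerProductSpace.laplacian_eq_iteratedFDeriv_orthonormalBasis _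
    (EuclideanSpace.basisFun (Fin n) ℝ)]
  refine Finset.sum_congr rfl fun i _ => ?_
  rw [iteratedFDeriv_two_apply]
  simp only [Matrix.cons_val_zero, Matrix.cons_val_one]
  set e := EuclideanSpace.basisFun (Fin n) ℝ i
  set g : Rn n → ℂ := fun x => extend Φ (x, y.2.1, (y.2.2 : ℝ)) with hg
  have hgs : ContDiffAt ℝ ∞ g (y.1 : Rn n) :=
    (h.contDiffAt ((isOpen_coneSet n).mem_nhds hy)).comp (y.1 : Rn n)
      (contDiff_prodMk_left (y.2.1, (y.2.2 : ℝ))).contDiffAt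
  have hgd : DifferentiableAt ℝ (fderiv ℝ g) (y.1 : Rn n) :=
    (hgs.fderiv_right (m := 1) (by norm_cast)).differentiableAt (by simp)
  have e1 : fderiv ℝ (fderiv ℝ g) (y.1 : Rn n) e e
      = fderiv ℝ (fun x => fderiv ℝ g x e) (y.1 : Rn n) e := by
    have := (hgd.hasFDerivAt.clm_apply (hasFDerivAt_const e (y.1 : Rn n))).fderiv
    rw [this]
    simp
  have e2 : (fun x => fderiv ℝ g x e) =ᶠ[𝓝 (y.1 : Rn n)]
      fun x => fderiv ℝ (extend Φ) (x, y.2.1, (y.2.2 : ℝ)) (e, 0) := by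
    have hc : Continuous fun x : Rn n => (x, y.2.1, (y.2.2 : ℝ)) := by fun_prop
    filter_upwards [hc.continuousAt.preimage_mem_nhds ((isOpen_coneSet n).mem_nhds hy)] with x hx
    rw [(hasFDerivAt_slice h hx).fderiv]
    simp
  rw [e1, e2.fderiv_eq, (hasFDerivAt_slice (contDiffOn_dir h (e, 0)) hy).fderiv]
  simp

/-- Operators that preserve smoothness and are linear on smooth functions. -/
structure IsGoodOp {n : ℕ} (P : (Y n → ℂ) → Y n → ℂ) : Prop where
  smooth : ∀ {Φ}, IsSmooth Φ → IsSmooth (P Φ)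
  add : ∀ {Φ Ψ}, IsSmooth Φ → IsSmooth Ψ → P (Φ + Ψ) = P Φ + P Ψ
  smul : ∀ (c : ℂ) {Φ}, IsSmooth Φ → P (c • Φ) = c • P Φ

lemma IsSmooth.add {n : ℕ} {Φ Ψ : Y n → ℂ} (h : IsSmooth Φ) (h' : IsSmooth Ψ) :
    IsSmooth (Φ + Ψ) := by
  rw [IsSmooth, extend_add]
  exact ContDiffOn.add h h'

lemma IsSmooth.smul {n : ℕ} (c : ℂ) {Φ : Y n → ℂ} (h : IsSmooth Φ) : IsSmooth (c • Φ) := by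
  rw [IsSmooth, extend_smul]
  exact ContDiffOn.const_smul c h

lemma IsSmooth.zero (n : ℕ) : IsSmooth (0 : Y n → ℂ) := by
  rw [IsSmooth, extend_zero]
  exact contDiffOn_const

lemma fderiv_dir_add {n : ℕ} {G H : Rn n × ℝ × ℝ → ℂ} (hG : ContDiffOn ℝ ∞ G (coneSet n))
    (hH : ContDiffOn ℝ ∞ H (coneSet n)) (w : Rn n × ℝ × ℝ) {p : Rn n × ℝ × ℝ}
    (hp : p ∈ coneSet n) : fderiv ℝ (G + H) p w = fderiv ℝ G p w + fderiv ℝ H p w := by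
  rw [((hasFDerivAt_of_mem hG hp).add (hasFDerivAt_of_mem hH hp)).fderiv]
  rfl

lemma fderiv_dir_smul {n : ℕ} (c : ℂ) {G : Rn n × ℝ × ℝ → ℂ}
    (hG : ContDiffOn ℝ ∞ G (coneSet n)) (w : Rn n × ℝ × ℝ) {p : Rn n × ℝ × ℝ}
    (hp : p ∈ coneSet n) : fderiv ℝ (c • G) p w = c • fderiv ℝ G p w := by
  rw [((hasFDerivAt_of_mem hG hp).const_smul c).fderiv]
  rfl

lemma isGoodOp_dA (n : ℕ) : IsGoodOp (dA (n := n)) where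
  smooth h := isSmooth_of_eq (contDiffOn_dir h (0, 0, 1)) (dA_eq h)
  add h h' := by
    ext y
    rw [dA_eq (h.add h'), Pi.add_apply, dA_eq h, dA_eq h', extend_add]
    exact fderiv_dir_add h h' _ (coe_mem_coneSet y)
  smul c _ h := by
    ext y
    rw [dA_eq (h.smul c), Pi.smul_apply, dA_eq h, extend_smul]
    exact fderiv_dir_smul c h _ (coe_mem_coneSet y)

lemma isGoodOp_dB (n : ℕ) : IsGoodOp (dB (n := n)) where
  smooth h := isSmooth_of_eq (contDiffOn_dir h (0, 1, 0)) (dB_eq h)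
  add h h' := by
    ext y
    rw [dB_eq (h.add h'), Pi.add_apply, dB_eq h, dB_eq h', extend_add]
    exact fderiv_dir_add h h' _ (coe_mem_coneSet y)
  smul c _ h := by
    ext y
    rw [dB_eq (h.smul c), Pi.smul_apply, dB_eq h, extend_smul]
    exact fderiv_dir_smul c h _ (coe_mem_coneSet y)

lemma contDiffAt_slice {n : ℕ} {Φ : Y n → ℂ} (h : IsSmooth Φ) (y : Y n) :
    ContDiffAt ℝ 2 (fun x : Rn n => extend Φ (x, y.2.1, (y.2.2 : ℝ))) (y.1 : Rn n) :=
  ((h.contDiffAt ((isOpen_coneSet n).mem_nhds (coe_mem_coneSet y))).comp (y.1 : Rn n)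
    (contDiff_prodMk_left (y.2.1, (y.2.2 : ℝ))).contDiffAt).of_le (by norm_cast)

lemma isGoodOp_lapU (n : ℕ) : IsGoodOp (lapU (n := n)) where
  smooth {Φ} h := by
    refine isSmooth_of_eq (G := fun q => ∑ i, fderiv ℝ (fun p => fderiv ℝ (extend Φ) p
      (EuclideanSpace.basisFun (Fin n) ℝ i, 0)) q (EuclideanSpace.basisFun (Fin n) ℝ i, 0))
      ?_ (lapU_eq h)
    exact ContDiffOn.sum fun i _ => contDiffOn_dir (contDiffOn_dir h _) _
  add h h' := by
    ext y
    have := (contDiffAt_slice h y).laplacian_add (contDiffAt_slice h' y)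
    rw [Pi.add_apply, lapU, extend_add]
    exact this
  smul c _ h := by
    ext y
    have := InnerProductSpace.laplacian_smul c (contDiffAt_slice h y)
    rw [Pi.smul_apply, lapU, extend_smul]
    exact this

lemma IsGoodOp.comp {n : ℕ} {P Q : (Y n → ℂ) → Y n → ℂ} (hP : IsGoodOp P) (hQ : IsGoodOp Q) :
    IsGoodOp (P ∘ Q) where
  smooth h := hP.smooth (hQ.smooth h)
  add h h' := by
    simp only [Function.comp, hQ.add h h', hP.add (hQ.smooth h) (hQ.smooth h')]
  smul c _ h := by
    simp only [Function.comp, hQ.smul c h, hP.smul c (hQ.smooth h)]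

lemma IsGoodOp.iterate {n : ℕ} {P : (Y n → ℂ) → Y n → ℂ} (hP : IsGoodOp P) (k : ℕ) :
    IsGoodOp P^[k] := by
  induction k with
  | zero => exact ⟨fun h => h, fun _ _ => rfl, fun _ _ _ => rfl⟩
  | succ k ih =>
    rw [Function.iterate_succ]
    exact ih.comp hP

lemma isGoodOp_diffOp (n l m k : ℕ) : IsGoodOp (diffOp (n := n) l m k) :=
  ((isGoodOp_dA n).iterate l).comp (((isGoodOp_dB n).iterate m).comp ((isGoodOp_lapU n).iterate k))

/-! ### The space `𝒮(𝕐ⁿ⁺¹)` -/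

/-- Indices `(s, r, l, m, k)` of the seminorms. -/
abbrev Idx : Type := ℕ × ℕ × ℕ × ℕ × ℕ

/-- The weight `(aˢ + a⁻ˢ)(1 + b²)^{r/2}`. -/
def weight {n : ℕ} (s r : ℕ) (y : Y n) : ℝ :=
  ((y.2.2 : ℝ) ^ s + 1 / (y.2.2 : ℝ) ^ s) * (1 + y.2.1 ^ 2) ^ ((r : ℝ) / 2)

lemma weight_nonneg {n : ℕ} (s r : ℕ) (y : Y n) : 0 ≤ weight s r y := by
  have : 0 < (y.2.2 : ℝ) := y.2.2.2
  unfold weight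
  positivity

/-- The weighted derivative `(aˢ + a⁻ˢ)(1 + b²)^{r/2} |∂_a^l ∂_b^m Δ_u^k Φ(u,b,a)|`. -/
def weighted {n : ℕ} (i : Idx) (Φ : Y n → ℂ) (y : Y n) : ℝ :=
  weight i.1 i.2.1 y * ‖diffOp i.2.2.1 i.2.2.2.1 i.2.2.2.2 Φ y‖

lemma weighted_nonneg {n : ℕ} (i : Idx) (Φ : Y n → ℂ) (y : Y n) : 0 ≤ weighted i Φ y :=
  mul_nonneg (weight_nonneg _ _ y) (norm_nonneg _)

lemma weighted_add_le {n : ℕ} (i : Idx) {Φ Ψ : Y n → ℂ} (h : IsSmooth Φ) (h' : IsSmooth Ψ)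
    (y : Y n) : weighted i (Φ + Ψ) y ≤ weighted i Φ y + weighted i Ψ y := by
  unfold weighted
  rw [(isGoodOp_diffOp n _ _ _).add h h', ← mul_add]
  exact mul_le_mul_of_nonneg_left (norm_add_le _ _) (weight_nonneg _ _ y)

lemma weighted_smul {n : ℕ} (i : Idx) (c : ℂ) {Φ : Y n → ℂ} (h : IsSmooth Φ)
    (y : Y n) : weighted i (c • Φ) y = ‖c‖ * weighted i Φ y := by
  unfold weighted
  rw [(isGoodOp_diffOp n _ _ _).smul c h, Pi.smul_apply, norm_smul]
  ring

lemma weighted_zero {n : ℕ} (i : Idx) (y : Y n) : weighted i (0 : Y n → ℂ) y = 0 := by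
  have := weighted_smul i 0 (IsSmooth.zero n) y
  simpa using this

/-- The space `𝒮(𝕐ⁿ⁺¹)` of smooth functions `Φ` on `𝕐ⁿ⁺¹` such that
`(aˢ + a⁻ˢ)(1 + b²)^{r/2} |∂_a^l ∂_b^m Δ_u^k Φ(u,b,a)|` is bounded for all `s, r, l, m, k`. -/
def schwartzY (n : ℕ) : Submodule ℂ (Y n → ℂ) where
  carrier := {Φ | IsSmooth Φ ∧ ∀ i : Idx, BddAbove (range (weighted i Φ))}
  zero_mem' := by
    refine ⟨IsSmooth.zero n, fun i => ⟨0, ?_⟩⟩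
    rintro _ ⟨y, rfl⟩
    exact (weighted_zero i y).le
  add_mem' := by
    rintro Φ Ψ ⟨h, hb⟩ ⟨h', hb'⟩
    refine ⟨h.add h', fun i => ?_⟩
    obtain ⟨C, hC⟩ := hb i
    obtain ⟨D, hD⟩ := hb' i
    refine ⟨C + D, ?_⟩
    rintro _ ⟨y, rfl⟩
    exact (weighted_add_le i h h' y).trans (add_le_add (hC ⟨y, rfl⟩) (hD ⟨y, rfl⟩))
  smul_mem' := by
    rintro c Φ ⟨h, hb⟩
    refine ⟨h.smul c, fun i => ?_⟩
    obtain ⟨C, hC⟩ := hb i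
    refine ⟨‖c‖ * C, ?_⟩
    rintro _ ⟨y, rfl⟩
    rw [weighted_smul i c h]
    exact mul_le_mul_of_nonneg_left (hC ⟨y, rfl⟩) (norm_nonneg c)

/-- `𝒮(𝕐ⁿ⁺¹)` as a type, carrying its own topology (not the one of pointwise convergence). -/
def SchwartzY (n : ℕ) : Type := schwartzY n

instance (n : ℕ) : AddCommGroup (SchwartzY n) := inferInstanceAs (AddCommGroup (schwartzY n))

instance (n : ℕ) : Module ℂ (SchwartzY n) := inferInstanceAs (Module ℂ (schwartzY n))

instance (n : ℕ) : CoeFun (SchwartzY n) fun _ => Y n → ℂ := ⟨fun Φ => Φ.1⟩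

/-- The seminorm `sup (aˢ + a⁻ˢ)(1 + b²)^{r/2} |∂_a^l ∂_b^m Δ_u^k Φ(u,b,a)|`. -/
def seminormY (n : ℕ) : SeminormFamily ℂ (SchwartzY n) Idx := fun i =>
  Seminorm.of (fun Φ => ⨆ y : Y n, weighted i Φ.1 y)
    (fun Φ Ψ => Real.iSup_le
      (fun y => (weighted_add_le i Φ.2.1 Ψ.2.1 y).trans
        (add_le_add (le_ciSup (Φ.2.2 i) y) (le_ciSup (Ψ.2.2 i) y)))
      (add_nonneg (Real.iSup_nonneg fun y => weighted_nonneg i Φ.1 y)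
        (Real.iSup_nonneg fun y => weighted_nonneg i Ψ.1 y)))
    (fun c Φ => by
      rw [Real.mul_iSup_of_nonneg (norm_nonneg c)]
      exact iSup_congr fun y => weighted_smul i c Φ.2.1 y)

instance (n : ℕ) : TopologicalSpace (SchwartzY n) := (seminormY n).moduleFilterBasis.topology'

/-- The dual space `𝒮'(𝕐ⁿ⁺¹)` (as a vector space). -/
abbrev SchwartzYDual (n : ℕ) : Type := SchwartzY n →L[ℂ] ℂ

/-- `F` is of slow growth on `𝕐ⁿ⁺¹`: `|F(u,b,a)| ≤ C (1+|b|)ˢ (aˢ + a⁻ˢ)` for some `s, C > 0`. -/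
def IsSlowGrowth {n : ℕ} (F : Y n → ℂ) : Prop :=
  ∃ s C : ℝ, 0 < s ∧ 0 < C ∧ ∀ y : Y n,
    ‖F y‖ ≤ C * (1 + |y.2.1|) ^ s * ((y.2.2 : ℝ) ^ s + 1 / (y.2.2 : ℝ) ^ s)

/-- The element `T` of `𝒮'(𝕐ⁿ⁺¹)` is the regular distribution given by the function `F`: `F` is
locally integrable and of slow growth, and `⟨T, Φ⟩ = ∫ F Φ a⁻ⁿ du db da`, with an absolutely
convergent integral, for every `Φ ∈ 𝒮(𝕐ⁿ⁺¹)`. -/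
structure IsRegularDistribution {n : ℕ} (T : SchwartzYDual n) (F : Y n → ℂ) : Prop where
  locallyIntegrable : LocallyIntegrable F (stdMeasure n)
  slowGrowth : IsSlowGrowth F
  integrable : ∀ Φ : SchwartzY n, Integrable (fun y => F y * Φ y) (stdMeasure n)
  apply_eq : ∀ Φ : SchwartzY n, T Φ = ∫ y, F y * Φ y ∂stdMeasure n

/-- `T ∈ 𝒮'(𝕐ⁿ⁺¹)` is the ridgelet transform `R_ψ f` of the Lizorkin distribution `f`, defined by
duality: `⟨R_ψ f, Φ⟩ = ⟨f, R^t_{ψ̄} Φ⟩` for every `Φ ∈ 𝒮(𝕐ⁿ⁺¹)`, where the function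
`R^t_{ψ̄} Φ` belongs to `𝒮₀(ℝⁿ)`. -/
def IsRidgeletTransform {n : ℕ} (ψ : ℝ → ℂ) (f : LizorkinDual n) (T : SchwartzYDual n) : Prop :=
  ∀ Φ : SchwartzY n, ∃ φ : lizorkin n,
    (∀ x : Rn n, (φ : 𝓢(Rn n, ℂ)) x = synthesis (fun t => conj (ψ t)) Φ x) ∧ T Φ = f φ

end

end Ridgelet

open Ridgelet

namespace Ridgelet

noncomputable section

open scoped NNReal CompactlySupported BoundedContinuousFunction

/-! ### Functionals dominated by a finite measure -/

section TotalVariation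

variable {X : Type*} [TopologicalSpace X]

/-! Two independent facts are combined by Fubini's theorem: an integrable distribution is
integration of derivatives against a finite measure, and the synthesis operator maps into the
Lizorkin space.

Structure of `f`. The derivatives of order at most `N` of a Schwartz function `φ`, evaluated in
directions of the unit ball, form a continuous function on `JetSpace n N`. This space differs from
finitely many copies of `ℝⁿ` by a compact factor, so the jets vanish at infinity. By Hahn-Banach,
`f` is a bounded functional of the jet. The total variation of that functional is a finite Radon
measure `μ` (`exists_measure_norm_le`), and the Riesz representation in `L²(μ)` then gives `⟨f, φ⟩ =
∫ (jet φ) κ dμ` with `κ` integrable (`IsIntegrableDistribution.exists_jetDensity`). By dominated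
convergence the same integral is the canonical extension of `f` to functions with bounded
derivatives, which settles the pairing with ridgelets. Since `k` derivatives of a ridgelet are of
size `a^{-(k+1)}`, the function `F` is continuous and of slow growth.

Synthesis. For fixed `b` and `a` a ridgelet is a plane wave in `u`. The Laplace-Beltrami operator,
applied to the plane wave whose profile has second derivative `ψ`, produces `(|x|² - (x·u)²) ψ` plus
first order terms. Moving the operator to `Φ` by Green's identity (`integral_sphere_laplacian`)
writes `|x|²` times a synthesis as a combination of syntheses
(`IsAdmissible.norm_sq_mul_synthesis`). Since every function of `𝒮₀(ℝ)` has an antiderivative in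
`𝒮₀(ℝ)`, this can be iterated and gives rapid decay. Derivatives are bounded by differentiation
under the integral and then decay by Landau's inequality. Moments vanish because a synthesis is the
Laplacian of another synthesis, so that integration by parts lowers the degree of the monomial
(`IsAdmissible.integral_monom_mul_synthesis`).

Conclusion. `IsJetDensity.apply_synthesis` exchanges the integrals over the jet space and over
`𝕐ⁿ⁺¹`, which identifies `⟨f, R^t Φ⟩` with `∫ F Φ`. -/

lemma continuous_mul_div {g : X → ℂ} {s t : X → ℝ} (hg : Continuous g) (hs : Continuous s)
    (ht : Continuous t) (h0 : ∀ x, 0 ≤ t x) (hts : ∀ x, t x ≤ s x) (hgs : ∀ x, ‖g x‖ ≤ s x) :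
    Continuous fun x => ((t x / s x : ℝ) : ℂ) * g x := by
  have hb : ∀ x, ‖((t x / s x : ℝ) : ℂ) * g x‖ ≤ t x := by
    intro x
    have hs0 : 0 ≤ s x := (h0 x).trans (hts x)
    rw [norm_mul, Complex.norm_real, Real.norm_of_nonneg (div_nonneg (h0 x) hs0)]
    rcases hs0.eq_or_lt with h | h
    · simp [← h, h0 x]
    · calc t x / s x * ‖g x‖ ≤ t x / s x * s x :=
          mul_le_mul_of_nonneg_left (hgs x) (div_nonneg (h0 x) hs0)
        _ = t x := by field_simp
  rw [continuous_iff_continuousAt]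
  intro x
  by_cases hx : s x = 0
  · have ht0 : t x = 0 := le_antisymm (hx ▸ hts x) (h0 x)
    have hz : ((t x / s x : ℝ) : ℂ) * g x = 0 := by simp [hx]
    rw [ContinuousAt, hz]
    refine squeeze_zero_norm hb ?_
    have := ht.tendsto x
    rwa [ht0] at this
  · have h1 : ContinuousAt (fun x => t x / s x) x := ht.continuousAt.div hs.continuousAt hx
    exact (Complex.continuous_ofReal.continuousAt.comp h1).mul hg.continuousAt

/-- The total variation of a bounded functional, on nonnegative functions of compact support. -/
def totalVar (Λ : (X →ᵇ ℂ) →L[ℂ] ℂ) (h : C_c(X, ℝ≥0)) : ℝ≥0 :=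
  ⨆ g : {g : X →ᵇ ℂ // ∀ x, ‖g x‖ ≤ h x}, ‖Λ g.1‖₊

lemma totalVar_bddAbove (Λ : (X →ᵇ ℂ) →L[ℂ] ℂ) (h : C_c(X, ℝ≥0)) :
    BddAbove (range fun g : {g : X →ᵇ ℂ // ∀ x, ‖g x‖ ≤ h x} => ‖Λ g.1‖₊) := by
  have hc : HasCompactSupport fun x => (h x : ℝ) :=
    h.hasCompactSupport.comp_left (g := ((↑) : ℝ≥0 → ℝ)) rfl
  obtain ⟨C, hC⟩ := hc.exists_bound_of_continuous (NNReal.continuous_coe.comp h.continuous)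
  refine ⟨‖Λ‖₊ * C.toNNReal, ?_⟩
  rintro _ ⟨g, rfl⟩
  refine (Λ.le_opNNNorm _).trans (mul_le_mul_right ?_ _)
  refine NNReal.coe_le_coe.1 ?_
  rw [coe_nnnorm]
  refine (BoundedContinuousFunction.norm_le NNReal.zero_le_coe).2 fun x => ?_
  refine (g.2 x).trans (le_trans ?_ (Real.le_coe_toNNReal C))
  simpa using hC x

lemma le_totalVar (Λ : (X →ᵇ ℂ) →L[ℂ] ℂ) {h : C_c(X, ℝ≥0)} {g : X →ᵇ ℂ}
    (hg : ∀ x, ‖g x‖ ≤ h x) : ‖Λ g‖₊ ≤ totalVar Λ h :=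
  le_ciSup (totalVar_bddAbove Λ h) ⟨g, hg⟩

lemma totalVar_le {Λ : (X →ᵇ ℂ) →L[ℂ] ℂ} {h : C_c(X, ℝ≥0)} {c : ℝ≥0}
    (hc : ∀ g : X →ᵇ ℂ, (∀ x, ‖g x‖ ≤ h x) → ‖Λ g‖₊ ≤ c) : totalVar Λ h ≤ c := by
  have : Nonempty {g : X →ᵇ ℂ // ∀ x, ‖g x‖ ≤ h x} := ⟨⟨0, fun x => by simp⟩⟩
  exact ciSup_le fun g => hc g.1 g.2

lemma exists_phase (z : ℂ) : ∃ c : ℂ, ‖c‖ = 1 ∧ c * z = (‖z‖ : ℂ) := by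
  by_cases hz : z = 0
  · exact ⟨1, by simp, by simp [hz]⟩
  · have hn : (‖z‖ : ℂ) ≠ 0 := by simpa using hz
    refine ⟨conj z / ‖z‖, by simp [hz], ?_⟩
    rw [div_mul_eq_mul_div, mul_comm, Complex.mul_conj, Complex.normSq_eq_norm_sq]
    push_cast
    field_simp

/-- For `≤`, a function dominated by `h₁ + h₂` splits in the proportion `h₁ : h₂`; the pieces are
continuous by `continuous_mul_div`, even where `h₁ + h₂` vanishes. For `≥`, competitors for `h₁` and
`h₂` are rotated by phases so that the values of `Λ` become nonnegative and add up without
cancellation. -/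
lemma totalVar_add (Λ : (X →ᵇ ℂ) →L[ℂ] ℂ) (h₁ h₂ : C_c(X, ℝ≥0)) :
    totalVar Λ (h₁ + h₂) = totalVar Λ h₁ + totalVar Λ h₂ := by
  apply le_antisymm
  · refine totalVar_le fun g hg => ?_
    have hs : Continuous fun x => ((h₁ x : ℝ) + h₂ x) :=
      (NNReal.continuous_coe.comp h₁.continuous).add (NNReal.continuous_coe.comp h₂.continuous)
    have hgs : ∀ x, ‖g x‖ ≤ (h₁ x : ℝ) + h₂ x := fun x => by simpa using hg x
    have hc1 := continuous_mul_div (t := fun x => (h₁ x : ℝ)) g.continuous hs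
      (NNReal.continuous_coe.comp h₁.continuous) (fun x => NNReal.zero_le_coe) (fun x => by simp) hgs
    have hfac : ∀ x, ‖(((h₁ x : ℝ) / ((h₁ x : ℝ) + h₂ x) : ℝ) : ℂ) * g x‖ ≤ h₁ x := fun x => by
      rw [norm_mul, Complex.norm_real, Real.norm_of_nonneg (by positivity)]
      rcases eq_or_ne ((h₁ x : ℝ) + h₂ x) 0 with h | h
      · simp [h]
      · calc (h₁ x : ℝ) / ((h₁ x : ℝ) + h₂ x) * ‖g x‖
            ≤ (h₁ x : ℝ) / ((h₁ x : ℝ) + h₂ x) * ((h₁ x : ℝ) + h₂ x) := by gcongr; exact hgs x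
          _ = h₁ x := by field_simp
    have hfac2 : ∀ x, ‖g x - (((h₁ x : ℝ) / ((h₁ x : ℝ) + h₂ x) : ℝ) : ℂ) * g x‖ ≤ h₂ x := fun x => by
      rcases eq_or_ne ((h₁ x : ℝ) + h₂ x) 0 with h | h
      · have : g x = 0 := by simpa [h] using hgs x
        simp [this]
      · have e : g x - (((h₁ x : ℝ) / ((h₁ x : ℝ) + h₂ x) : ℝ) : ℂ) * g x
            = (((h₂ x : ℝ) / ((h₁ x : ℝ) + h₂ x) : ℝ) : ℂ) * g x := by
          rw [show (h₂ x : ℝ) / ((h₁ x : ℝ) + h₂ x) = 1 - (h₁ x : ℝ) / ((h₁ x : ℝ) + h₂ x) by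
            field_simp; ring]
          push_cast
          ring
        rw [e, norm_mul, Complex.norm_real, Real.norm_of_nonneg (by positivity)]
        calc (h₂ x : ℝ) / ((h₁ x : ℝ) + h₂ x) * ‖g x‖
            ≤ (h₂ x : ℝ) / ((h₁ x : ℝ) + h₂ x) * ((h₁ x : ℝ) + h₂ x) := by gcongr; exact hgs x
          _ = h₂ x := by field_simp
    let g₁ : X →ᵇ ℂ := BoundedContinuousFunction.ofNormedAddCommGroup _ hc1 ‖g‖ fun x => by
      rw [norm_mul, Complex.norm_real, Real.norm_of_nonneg (by positivity)]
      calc _ ≤ 1 * ‖g x‖ := by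
            gcongr
            exact div_le_one_of_le₀ (by simp) (by positivity)
        _ ≤ ‖g‖ := by rw [one_mul]; exact g.norm_coe_le_norm x
    have e : Λ g = Λ g₁ + Λ (g - g₁) := by rw [← map_add]; simp
    rw [e]
    exact (nnnorm_add_le _ _).trans (add_le_add (le_totalVar Λ hfac) (le_totalVar Λ hfac2))
  · have key : ∀ g₁ g₂ : X →ᵇ ℂ, (∀ x, ‖g₁ x‖ ≤ h₁ x) → (∀ x, ‖g₂ x‖ ≤ h₂ x) →
        ‖Λ g₁‖₊ + ‖Λ g₂‖₊ ≤ totalVar Λ (h₁ + h₂) := by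
      intro g₁ g₂ hg₁ hg₂
      obtain ⟨c₁, hc₁, e₁⟩ := exists_phase (Λ g₁)
      obtain ⟨c₂, hc₂, e₂⟩ := exists_phase (Λ g₂)
      have hle := le_totalVar Λ (h := h₁ + h₂) (g := c₁ • g₁ + c₂ • g₂) fun x => by
        refine (norm_add_le _ _).trans ?_
        simp only [BoundedContinuousFunction.coe_smul, norm_smul, hc₁, hc₂, one_mul]
        simpa using add_le_add (hg₁ x) (hg₂ x)
      refine le_trans (le_of_eq ?_) hle
      rw [map_add, map_smul, map_smul, smul_eq_mul, smul_eq_mul, e₁, e₂]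
      refine NNReal.coe_injective ?_
      rw [NNReal.coe_add, coe_nnnorm, coe_nnnorm, coe_nnnorm, ← Complex.ofReal_add,
        Complex.norm_real, Real.norm_of_nonneg (by positivity)]
    have key2 : ∀ g₁ : X →ᵇ ℂ, (∀ x, ‖g₁ x‖ ≤ h₁ x) →
        ‖Λ g₁‖₊ + totalVar Λ h₂ ≤ totalVar Λ (h₁ + h₂) := by
      intro g₁ hg₁
      have h1 : ‖Λ g₁‖₊ ≤ totalVar Λ (h₁ + h₂) := by
        simpa using key g₁ 0 hg₁ (fun x => by simp)
      have h2 : totalVar Λ h₂ ≤ totalVar Λ (h₁ + h₂) - ‖Λ g₁‖₊ :=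
        totalVar_le fun g₂ hg₂ => le_tsub_of_add_le_left (key g₁ g₂ hg₁ hg₂)
      calc _ ≤ ‖Λ g₁‖₊ + (totalVar Λ (h₁ + h₂) - ‖Λ g₁‖₊) := by gcongr
        _ = _ := add_tsub_cancel_of_le h1
    have h1 : totalVar Λ h₂ ≤ totalVar Λ (h₁ + h₂) := by
      simpa using key2 0 (fun x => by simp)
    have h2 : totalVar Λ h₁ ≤ totalVar Λ (h₁ + h₂) - totalVar Λ h₂ :=
      totalVar_le fun g₁ hg₁ => le_tsub_of_add_le_right (key2 g₁ hg₁)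
    calc _ ≤ (totalVar Λ (h₁ + h₂) - totalVar Λ h₂) + totalVar Λ h₂ := by gcongr
      _ = _ := tsub_add_cancel_of_le h1

lemma smul_totalVar_le (Λ : (X →ᵇ ℂ) →L[ℂ] ℂ) (c : ℝ≥0) (h : C_c(X, ℝ≥0)) :
    c * totalVar Λ h ≤ totalVar Λ (c • h) := by
  rcases eq_or_ne c 0 with rfl | hc
  · simp
  rw [mul_comm, ← le_div_iff₀ (pos_iff_ne_zero.2 hc)]
  refine totalVar_le fun g hg => ?_
  rw [le_div_iff₀ (pos_iff_ne_zero.2 hc), mul_comm]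
  have := le_totalVar Λ (h := c • h) (g := (c : ℂ) • g) fun x => by
    simp only [BoundedContinuousFunction.coe_smul, norm_smul]
    simpa using mul_le_mul_of_nonneg_left (hg x) c.2
  refine le_trans (le_of_eq ?_) this
  rw [map_smul, nnnorm_smul]
  congr 1
  exact NNReal.coe_injective (by simp)

/-- The missing inequality is `smul_totalVar_le` for the factor `c⁻¹` and the function `c • h`. -/
lemma totalVar_smul (Λ : (X →ᵇ ℂ) →L[ℂ] ℂ) (c : ℝ≥0) (h : C_c(X, ℝ≥0)) :
    totalVar Λ (c • h) = c * totalVar Λ h := by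
  rcases eq_or_ne c 0 with rfl | hc
  · refine le_antisymm (totalVar_le fun g hg => ?_) (smul_totalVar_le Λ 0 h)
    have : g = 0 := by
      ext x
      simpa using hg x
    simp [this]
  refine le_antisymm ?_ (smul_totalVar_le Λ c h)
  have := smul_totalVar_le Λ c⁻¹ (c • h)
  rw [smul_smul, inv_mul_cancel₀ hc, one_smul] at this
  calc totalVar Λ (c • h) = c * (c⁻¹ * totalVar Λ (c • h)) := by field_simp
    _ ≤ _ := by gcongr

/-- The total variation as a positive linear functional. -/
def totalVarLM (Λ : (X →ᵇ ℂ) →L[ℂ] ℂ) : C_c(X, ℝ≥0) →ₗ[ℝ≥0] ℝ≥0 where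
  toFun := totalVar Λ
  map_add' := totalVar_add Λ
  map_smul' := totalVar_smul Λ

variable [T2Space X] [LocallyCompactSpace X]

lemma exists_cutoff {K : Set X} (hK : IsCompact K) :
    ∃ h : C_c(X, ℝ≥0), (∀ x, h x ≤ 1) ∧ ∀ x ∈ K, h x = 1 := by
  obtain ⟨f, h1, -, hc, hr⟩ := exists_continuous_one_zero_of_isCompact hK isClosed_empty
    (disjoint_empty K)
  refine ⟨⟨⟨fun x => (f x).toNNReal, by fun_prop⟩, ?_⟩, fun x => ?_, fun x hx => ?_⟩
  · exact hc.comp_left (g := Real.toNNReal) (by simp)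
  · simpa using (hr x).2
  · simp [h1 hx]

variable [SigmaCompactSpace X] [MeasurableSpace X] [BorelSpace X]

/-- A bounded functional on the bounded continuous functions is dominated by a finite measure on
functions vanishing at infinity. -/
theorem exists_measure_norm_le (Λ : (X →ᵇ ℂ) →L[ℂ] ℂ) : ∃ μ : Measure X, IsFiniteMeasure μ ∧
    ∀ g : X →ᵇ ℂ, Tendsto g (cocompact X) (𝓝 0) → ‖Λ g‖ ≤ ∫ x, ‖g x‖ ∂μ := by
  set μ := NNRealRMK.rieszMeasure (totalVarLM Λ) with hμ
  -- The bound does not depend on the compact set, so exhausting `X` by compact sets shows that `μ`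
  -- is finite.
  have hfin : ∀ K : Set X, IsCompact K → μ K ≤ ‖Λ‖₊ := by
    intro K hK
    obtain ⟨h, h1, h2⟩ := exists_cutoff hK
    have hV : totalVar Λ h ≤ ‖Λ‖₊ := by
      refine totalVar_le fun g hg => (Λ.le_opNNNorm g).trans ?_
      refine mul_le_of_le_one_right zero_le ?_
      refine NNReal.coe_le_coe.1 ?_
      rw [coe_nnnorm]
      exact (BoundedContinuousFunction.norm_le NNReal.zero_le_coe).2 fun x =>
        (hg x).trans (NNReal.coe_le_coe.2 (h1 x))
    calc μ K = ∫⁻ x in K, 1 ∂μ := by simp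
      _ ≤ ∫⁻ x in K, h x ∂μ := setLIntegral_mono' hK.measurableSet fun x hx => by simp [h2 x hx]
      _ ≤ ∫⁻ x, h x ∂μ := setLIntegral_le_lintegral _ _
      _ = totalVarLM Λ h := NNRealRMK.lintegral_rieszMeasure _ _
      _ ≤ ‖Λ‖₊ := by exact_mod_cast hV
  have hfm : IsFiniteMeasure μ := by
    refine ⟨lt_of_le_of_lt ?_ (ENNReal.coe_lt_top (r := ‖Λ‖₊))⟩
    rw [← iUnion_compactCovering, Monotone.measure_iUnion fun _ _ h => compactCovering_subset X h]
    exact iSup_le fun n => hfin _ (isCompact_compactCovering X n)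
  refine ⟨μ, hfm, fun g hg => le_of_forall_pos_le_add fun ε hε => ?_⟩
  -- Outside a compact set `|g| < δ`, so a cutoff changes `Λ g` by at most `‖Λ‖ δ ≤ ε`. The summand
  -- `1` covers `Λ = 0`. The truncated function has compact support and is controlled by the total
  -- variation.
  set δ := ε / (‖Λ‖ + 1) with hδ
  have hδ0 : 0 < δ := by positivity
  obtain ⟨K, hK, hKg⟩ := (hasBasis_cocompact.eventually_iff).1
    (hg.norm.eventually (gt_mem_nhds (by simpa using hδ0)))
  obtain ⟨h, h1, h2⟩ := exists_cutoff hK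
  have hcont : Continuous fun x => (((h x : ℝ≥0) : ℝ) : ℂ) * g x :=
    (Complex.continuous_ofReal.comp (NNReal.continuous_coe.comp h.continuous)).mul g.continuous
  have h1' : ∀ x, (h x : ℝ) ≤ 1 := fun x => h1 x
  let g₁ : X →ᵇ ℂ := BoundedContinuousFunction.ofNormedAddCommGroup _ hcont ‖g‖ fun x => by
    rw [norm_mul, Complex.norm_real, Real.norm_of_nonneg NNReal.zero_le_coe]
    calc _ ≤ 1 * ‖g x‖ := by gcongr; exact h1' x
      _ ≤ ‖g‖ := by rw [one_mul]; exact g.norm_coe_le_norm x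
  let k : C_c(X, ℝ≥0) := ⟨⟨fun x => h x * ‖g x‖₊, by fun_prop⟩, h.hasCompactSupport.mul_right⟩
  have hk : ‖Λ g₁‖ ≤ ∫ x, ‖g x‖ ∂μ := by
    have := le_totalVar Λ (h := k) (g := g₁) fun x => by
      simp [g₁, k]
    have e : (totalVar Λ k : ℝ) = ∫ x, (k x : ℝ) ∂μ :=
      (NNRealRMK.integral_rieszMeasure (totalVarLM Λ) k).symm
    calc ‖Λ g₁‖ ≤ totalVar Λ k := this
      _ = ∫ x, (k x : ℝ) ∂μ := e
      _ ≤ ∫ x, ‖g x‖ ∂μ := by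
        refine integral_mono_of_nonneg (Eventually.of_forall fun x => NNReal.zero_le_coe)
          (g.integrable μ).norm (Eventually.of_forall fun x => ?_)
        exact mul_le_of_le_one_left (norm_nonneg _) (h1' x)
  have hd : ‖g - g₁‖ ≤ δ := by
    refine (BoundedContinuousFunction.norm_le hδ0.le).2 fun x => ?_
    have e : (g - g₁) x = ((1 - h x : ℝ) : ℂ) * g x := by
      simp [g₁]; ring
    rw [e, norm_mul, Complex.norm_real, Real.norm_of_nonneg (sub_nonneg.2 (h1' x))]
    by_cases hx : x ∈ K
    · simp [h2 x hx, hδ0.le]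
    · calc _ ≤ 1 * ‖g x‖ := by gcongr; simp
        _ ≤ δ := by rw [one_mul]; exact (hKg hx).le
  have e : Λ g = Λ g₁ + Λ (g - g₁) := by rw [← map_add]; simp
  rw [e]
  refine (norm_add_le _ _).trans (add_le_add hk ((Λ.le_opNorm _).trans ?_))
  calc ‖Λ‖ * ‖g - g₁‖ ≤ (‖Λ‖ + 1) * δ := by gcongr; simp
    _ = ε := by rw [hδ]; field_simp

end TotalVariation

end

noncomputable section

open scoped NNReal CompactlySupported BoundedContinuousFunction

/-! ### Integrable distributions are given by measures on a space of jets -/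

/-- A functional dominated by the norm of a linear map factors through that map. -/
lemma exists_factor {V E : Type*} [AddCommGroup V] [Module ℂ V] [NormedAddCommGroup E]
    [NormedSpace ℂ E] (J : V →ₗ[ℂ] E) (f : V →ₗ[ℂ] ℂ) (C : ℝ) (h : ∀ v, ‖f v‖ ≤ C * ‖J v‖) :
    ∃ Λ : E →L[ℂ] ℂ, ∀ v, f v = Λ (J v) := by
  -- A linear section of `J` turns `f` into a bounded functional on the range of `J`, which
  -- Hahn-Banach extends. The choice of section is irrelevant, as the bound makes `f` vanish on the
  -- kernel of `J`.
  obtain ⟨g, hg⟩ := J.rangeRestrict.exists_rightInverse_of_surjective J.range_rangeRestrict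
  have hg' : ∀ w, J (g w) = w := fun w => congrArg Subtype.val (LinearMap.congr_fun hg w)
  obtain ⟨Λ, hΛ, -⟩ := exists_extension_norm_eq (LinearMap.range J)
    ((f ∘ₗ g).mkContinuous C fun w => by simpa [hg'] using h (g w))
  refine ⟨Λ, fun v => ?_⟩
  have h1 := hΛ (J.rangeRestrict v)
  have h2 := h (g (J.rangeRestrict v) - v)
  rw [map_sub, map_sub, hg'] at h2
  have e : ((J.rangeRestrict v : LinearMap.range J) : E) = J v := rfl
  rw [e, sub_self, norm_zero, mul_zero, norm_le_zero_iff] at h2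
  rw [e] at h1
  rw [h1]
  exact (sub_eq_zero.1 h2).symm

/-- Points `(k, x, v)` at which derivatives of order `k ≤ N` are evaluated, in the directions given
by the first `k` of the vectors `v` of the unit ball. -/
abbrev JetSpace (n N : ℕ) : Type :=
  Fin (N + 1) × Rn n × (Fin N → Metric.closedBall (0 : Rn n) 1)

/-- The directions that enter at a point of the jet space. -/
def JetSpace.dirs {n N : ℕ} (ξ : JetSpace n N) (i : Fin ξ.1) : Rn n :=
  ξ.2.2 (i.castLE (Nat.lt_succ_iff.1 ξ.1.2))

/-- The derivatives of `φ` of order at most `N`, as a function on the jet space. -/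
def jet {n : ℕ} (N : ℕ) (φ : Rn n → ℂ) (ξ : JetSpace n N) : ℂ :=
  iteratedFDeriv ℝ ξ.1 φ ξ.2.1 ξ.dirs

variable {n N : ℕ}

lemma JetSpace.norm_dirs_le (ξ : JetSpace n N) (i : Fin ξ.1) : ‖ξ.dirs i‖ ≤ 1 :=
  mem_closedBall_zero_iff.1 (ξ.2.2 (i.castLE (Nat.lt_succ_iff.1 ξ.1.2))).2

lemma norm_jet_le (φ : Rn n → ℂ) (ξ : JetSpace n N) :
    ‖jet N φ ξ‖ ≤ ‖iteratedFDeriv ℝ ξ.1 φ ξ.2.1‖ := by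
  refine (ContinuousMultilinearMap.le_opNorm _ _).trans (mul_le_of_le_one_right (norm_nonneg _) ?_)
  exact Finset.prod_le_one (fun _ _ => norm_nonneg _) fun i _ => ξ.norm_dirs_le i

/-- The jet sees only directions in the unit ball, which determine the operator norm by
multilinearity. -/
lemma norm_iteratedFDeriv_le_of_jet {φ : Rn n → ℂ} {M : ℝ} (hM : ∀ ξ, ‖jet N φ ξ‖ ≤ M) {k : ℕ}
    (hk : k ≤ N) (x : Rn n) : ‖iteratedFDeriv ℝ k φ x‖ ≤ M := by
  have hM0 : 0 ≤ M :=
    (norm_nonneg _).trans (hM (⟨k, by omega⟩, x, fun _ => ⟨0, by simp⟩))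
  refine ContinuousMultilinearMap.opNorm_le_bound hM0 fun m => ?_
  -- This normalization also holds for zero vectors, because `0⁻¹ = 0`.
  have hm : m = fun i => ‖m i‖ • (‖m i‖⁻¹ • m i) := by
    ext1 i
    rcases eq_or_ne (m i) 0 with h | h
    · simp [h]
    · rw [smul_smul, mul_inv_cancel₀ (norm_ne_zero_iff.2 h), one_smul]
  have hu : ∀ i, ‖m i‖⁻¹ • m i ∈ Metric.closedBall (0 : Rn n) 1 := fun i => by
    rw [mem_closedBall_zero_iff, norm_smul, norm_inv, norm_norm]
    exact inv_mul_le_one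
  let ξ : JetSpace n N := (⟨k, by omega⟩, x,
    fun i => if h : i.1 < k then ⟨‖m ⟨i, h⟩‖⁻¹ • m ⟨i, h⟩, hu _⟩ else ⟨0, by simp⟩)
  have hξ : ξ.dirs = fun i : Fin k => ‖m i‖⁻¹ • m i := by
    ext1 i
    simp [JetSpace.dirs, ξ]
  have h1 := hM ξ
  rw [jet, hξ] at h1
  rw [hm, ContinuousMultilinearMap.map_smul_univ, norm_smul, norm_prod, mul_comm]
  have e : ∏ i, ‖‖m i‖ • (‖m i‖⁻¹ • m i)‖ = ∏ i, ‖‖m i‖‖ := by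
    refine Finset.prod_congr rfl fun i _ => ?_
    conv_lhs => rw [← congrFun hm i]
    simp
  rw [e]
  exact mul_le_mul_of_nonneg_right h1 (by positivity)

lemma continuous_jet {φ : Rn n → ℂ} (hφ : ContDiff ℝ ∞ φ) : Continuous (jet N φ) := by
  refine continuous_prod_of_discrete_left.2 fun k => ?_
  have h1 : Continuous fun p : Rn n × (Fin N → Metric.closedBall (0 : Rn n) 1) =>
      iteratedFDeriv ℝ k φ p.1 :=
    (hφ.continuous_iteratedFDeriv (m := k) (by exact_mod_cast le_top)).comp continuous_fst
  have h2 : Continuous fun p : Rn n × (Fin N → Metric.closedBall (0 : Rn n) 1) =>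
      fun i : Fin k => JetSpace.dirs (k, p) i := by
    refine continuous_pi fun i => ?_
    exact continuous_subtype_val.comp
      ((continuous_apply (i.castLE (Nat.lt_succ_iff.1 k.2))).comp continuous_snd)
  exact h1.eval h2

/-- The projection to `ℝⁿ` forgets only compact factors, hence is proper. -/
lemma tendsto_jetSpace_norm : Tendsto (fun ξ : JetSpace n N => ‖ξ.2.1‖) (cocompact _) atTop := by
  have h1 : IsProperMap (fun ξ : JetSpace n N => ξ.2.1) :=
    (isProperMap_fst_of_compactSpace (Y := Fin N → Metric.closedBall (0 : Rn n) 1)).comp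
      (isProperMap_snd_of_compactSpace (X := Fin (N + 1)))
  exact (tendsto_norm_cocompact_atTop (E := Rn n)).comp (isProperMap_iff_tendsto_cocompact.1 h1).2

lemma exists_bound_jet (φ : 𝓢(Rn n, ℂ)) (j : ℕ) :
    ∃ C, ∀ ξ : JetSpace n N, ‖ξ.2.1‖ ^ j * ‖jet N φ ξ‖ ≤ C := by
  refine ⟨∑ k ∈ Finset.range (N + 1), SchwartzMap.seminorm ℝ j k φ, fun ξ => ?_⟩
  calc ‖ξ.2.1‖ ^ j * ‖jet N φ ξ‖ ≤ ‖ξ.2.1‖ ^ j * ‖iteratedFDeriv ℝ ξ.1 φ ξ.2.1‖ := by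
        gcongr; exact norm_jet_le _ _
    _ ≤ SchwartzMap.seminorm ℝ j ξ.1 φ := SchwartzMap.le_seminorm ℝ j _ φ _
    _ ≤ _ := Finset.single_le_sum (f := fun k => SchwartzMap.seminorm ℝ j k φ)
        (fun _ _ => apply_nonneg _ _) (Finset.mem_range.2 ξ.1.2)

lemma tendsto_jet (φ : 𝓢(Rn n, ℂ)) : Tendsto (jet N φ) (cocompact _) (𝓝 0) := by
  obtain ⟨C, hC⟩ := exists_bound_jet (N := N) φ 1
  refine squeeze_zero_norm' (a := fun ξ => C / ‖ξ.2.1‖) ?_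
    (tendsto_const_nhds.div_atTop tendsto_jetSpace_norm)
  filter_upwards [tendsto_jetSpace_norm.eventually_gt_atTop 0] with ξ hξ
  rw [le_div_iff₀ hξ, mul_comm]
  simpa using hC ξ

/-- The jet of a Schwartz function, as a bounded continuous function. -/
def jetLM (n N : ℕ) : 𝓢(Rn n, ℂ) →ₗ[ℂ] (JetSpace n N →ᵇ ℂ) where
  toFun φ := BoundedContinuousFunction.ofNormedAddCommGroup (jet N φ)
    (continuous_jet (φ.smooth ⊤)) (exists_bound_jet φ 0).choose
    fun ξ => by simpa using (exists_bound_jet φ 0).choose_spec ξ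
  map_add' φ χ := by
    ext ξ
    simp only [BoundedContinuousFunction.coe_ofNormedAddCommGroup, jet,
      BoundedContinuousFunction.coe_add, Pi.add_apply]
    have : ((φ + χ : 𝓢(Rn n, ℂ)) : Rn n → ℂ) = φ + χ := by ext; simp
    rw [this, iteratedFDeriv_add_apply (φ.smooth _).contDiffAt (χ.smooth _).contDiffAt]
    rfl
  map_smul' c φ := by
    ext ξ
    simp only [BoundedContinuousFunction.coe_ofNormedAddCommGroup, jet,
      BoundedContinuousFunction.coe_smul, RingHom.id_apply]
    have : ((c • φ : 𝓢(Rn n, ℂ)) : Rn n → ℂ) = c • φ := by ext; simp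
    rw [this, iteratedFDeriv_const_smul_apply (φ.smooth _).contDiffAt]
    rfl

@[simp]
lemma jetLM_apply (φ : 𝓢(Rn n, ℂ)) (ξ : JetSpace n N) : jetLM n N φ ξ = jet N φ ξ := rfl

/-- A distribution represented by integration of the jet against a density. -/
structure IsJetDensity (f : 𝓢'(Rn n, ℂ)) (μ : Measure (JetSpace n N)) (κ : JetSpace n N → ℂ) :
    Prop where
  integrable : Integrable κ μ
  apply_eq : ∀ φ : 𝓢(Rn n, ℂ), f φ = ∫ ξ, jet N φ ξ * κ ξ ∂μ

/-- Integrable distributions are finite sums of derivatives of finite measures. -/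
theorem IsIntegrableDistribution.exists_jetDensity {f : 𝓢'(Rn n, ℂ)}
    (hf : IsIntegrableDistribution f) :
    ∃ (N : ℕ) (μ : Measure (JetSpace n N)) (κ : JetSpace n N → ℂ),
      IsFiniteMeasure μ ∧ IsJetDensity f μ κ := by
  obtain ⟨N, C, hC⟩ := hf
  let fl : 𝓢(Rn n, ℂ) →ₗ[ℂ] ℂ :=
    { toFun := f, map_add' := map_add f, map_smul' := map_smul f }
  obtain ⟨Λ, hΛ⟩ := exists_factor (jetLM n N) fl (|C| * (N + 1)) fun φ => by
    have h1 : ∀ ξ, ‖jet N φ ξ‖ ≤ ‖jetLM n N φ‖ := (jetLM n N φ).norm_coe_le_norm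
    refine (hC φ).trans ?_
    calc C * ∑ k ∈ Finset.range (N + 1), ⨆ x : Rn n, ‖iteratedFDeriv ℝ k φ x‖
        ≤ |C| * ∑ k ∈ Finset.range (N + 1), ⨆ x : Rn n, ‖iteratedFDeriv ℝ k φ x‖ :=
          mul_le_mul_of_nonneg_right (le_abs_self C)
            (Finset.sum_nonneg fun k _ => Real.iSup_nonneg fun x => norm_nonneg _)
      _ ≤ |C| * ∑ k ∈ Finset.range (N + 1), ‖jetLM n N φ‖ := by
          gcongr with k hk
          exact ciSup_le fun x =>
            norm_iteratedFDeriv_le_of_jet h1 (Nat.lt_succ_iff.1 (Finset.mem_range.1 hk)) x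
      _ = |C| * (N + 1) * ‖jetLM n N φ‖ := by simp; ring
  obtain ⟨μ, hμ, hμΛ⟩ := exists_measure_norm_le Λ
  -- By Cauchy-Schwarz the `L¹(μ)` bound implies an `L²(μ)` bound with constant `μ(X)^{1/2}`.
  -- Factoring `f` a second time, now through the Hilbert space `L²(μ)`, makes the Riesz
  -- representation available.
  obtain ⟨Λ₂, hΛ₂⟩ := exists_factor
    ((BoundedContinuousFunction.toLp (E := ℂ) 2 μ ℂ).toLinearMap ∘ₗ jetLM n N) fl
    (μ.real univ ^ (1 / 2 : ℝ)) fun φ => by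
      rw [hΛ]
      refine (hμΛ _ (tendsto_jet φ)).trans ?_
      set g := jetLM n N φ
      have hg : AEStronglyMeasurable g μ := g.continuous.aestronglyMeasurable
      have h1 := eLpNorm_le_eLpNorm_mul_rpow_measure_univ (μ := μ) (p := 1) (q := 2) (by norm_num) hg
      have h2 : ‖(BoundedContinuousFunction.toLp (E := ℂ) 2 μ ℂ) g‖ = (eLpNorm g 2 μ).toReal := by
        rw [Lp.norm_def]
        congr 1
        exact eLpNorm_congr_ae (BoundedContinuousFunction.coeFn_toLp (p := 2) μ ℂ g)
      have h3 : eLpNorm g 2 μ ≠ ⊤ :=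
        ((memLp_congr_ae (BoundedContinuousFunction.coeFn_toLp (p := 2) μ ℂ g)).1
          (Lp.memLp _)).eLpNorm_ne_top
      have h4 : ∫ ξ, ‖g ξ‖ ∂μ = (eLpNorm g 1 μ).toReal := by
        rw [eLpNorm_one_eq_lintegral_enorm, integral_norm_eq_lintegral_enorm hg]
      simp only [LinearMap.comp_apply, ContinuousLinearMap.coe_coe]
      rw [h2, h4, mul_comm]
      have h5 := ENNReal.toReal_mono (ENNReal.mul_ne_top h3
        (ENNReal.rpow_ne_top_of_nonneg (by norm_num) (measure_ne_top μ univ))) h1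
      rw [ENNReal.toReal_mul, ← ENNReal.toReal_rpow] at h5
      refine h5.trans_eq ?_
      rw [Measure.real]
      norm_num
  set κ := (InnerProductSpace.toDual ℂ (Lp ℂ 2 μ)).symm Λ₂ with hκ
  -- The inner product is conjugate-linear in its first slot, so the density is the conjugate of the
  -- Riesz vector. It is integrable because `L² ⊆ L¹` for a finite measure.
  refine ⟨N, μ, fun ξ => conj (κ ξ), hμ, ?_, fun φ => ?_⟩
  · have : Integrable κ μ := (Lp.memLp κ).integrable (by norm_num)
    refine this.norm.mono' (Complex.continuous_conj.comp_aestronglyMeasurable this.1) ?_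
    exact Eventually.of_forall fun ξ => by simp
  · have h1 : f φ = inner ℂ κ (BoundedContinuousFunction.toLp (E := ℂ) 2 μ ℂ (jetLM n N φ)) := by
      rw [hκ, InnerProductSpace.toDual_symm_apply]
      exact hΛ₂ φ
    rw [h1, L2.inner_def]
    refine integral_congr_ae ?_
    filter_upwards [BoundedContinuousFunction.coeFn_toLp (p := 2) μ ℂ (jetLM n N φ)] with ξ hξ
    rw [hξ]
    simp

end

noncomputable section

/-! ### The pairing of an integrable distribution with a function in `𝒟_{L^∞}` -/

/-- `φ ∈ 𝒟_{L^∞}`: a smooth function with bounded derivatives of all orders. -/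
structure HasBoundedDerivs {E F : Type*} [NormedAddCommGroup E] [NormedSpace ℝ E]
    [NormedAddCommGroup F] [NormedSpace ℝ F] (φ : E → F) : Prop where
  contDiff : ContDiff ℝ ∞ φ
  bounded : ∀ k : ℕ, ∃ C, ∀ x, ‖iteratedFDeriv ℝ k φ x‖ ≤ C

/-- The approximants are `χ(x/(j+1)) φ(x)` for a bump function `χ`. Dilation factors at most `1`
keep the derivatives of the cutoffs uniformly bounded. Near a given compact set the cutoff is
eventually `1`, so all derivatives eventually agree there with those of `φ`. -/
lemma HasBoundedDerivs.exists_boundedApprox {n : ℕ} {φ : Rn n → ℂ} (hφ : HasBoundedDerivs φ) :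
    ∃ g, BoundedApprox g φ := by
  let χ : ContDiffBump (0 : Rn n) := ⟨1, 2, one_pos, one_lt_two⟩
  have hχ : ContDiff ℝ ∞ χ := χ.contDiff
  let c : ℕ → ℝ := fun j => ((j : ℝ) + 1)⁻¹
  have hc0 : ∀ j, 0 < c j := fun j => by positivity
  have hc1 : ∀ j, c j ≤ 1 := fun j => inv_le_one_of_one_le₀ (by simp)
  have hs : ∀ j, ContDiff ℝ ∞ fun x => χ (c j • x) := fun j => hχ.comp (contDiff_const_smul _)
  have hcs : ∀ j, HasCompactSupport fun x => χ (c j • x) := fun j =>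
    χ.hasCompactSupport.comp_homeomorph (Homeomorph.smulOfNeZero (c j) (hc0 j).ne')
  have hsφ : ∀ j, ContDiff ℝ ∞ fun x => χ (c j • x) • φ x := fun j => (hs j).smul hφ.contDiff
  have hcsφ : ∀ j, HasCompactSupport fun x => χ (c j • x) • φ x := fun j => (hcs j).smul_right
  have hg : ∀ j, ⇑((hcsφ j).toSchwartzMap (hsφ j)) = fun x => χ (c j • x) • φ x := fun j => rfl
  refine ⟨fun j => (hcsφ j).toSchwartzMap (hsφ j), fun k => ?_, fun k K hK => ?_⟩
  · have hb : ∀ i : ℕ, ∃ C, ∀ x, ‖iteratedFDeriv ℝ i χ x‖ ≤ C := fun i =>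
      (χ.hasCompactSupport.iteratedFDeriv i).exists_bound_of_continuous
        (hχ.continuous_iteratedFDeriv (by exact_mod_cast le_top))
    choose B hB using hb
    choose D hD using hφ.bounded
    refine ⟨∑ i ∈ Finset.range (k + 1), (k.choose i : ℝ) * B i * D (k - i), fun j x => ?_⟩
    rw [hg]
    refine (norm_iteratedFDeriv_smul_le (hs j) hφ.contDiff x
      (by exact_mod_cast le_top)).trans (Finset.sum_le_sum fun i _ => ?_)
    have h1 : ‖iteratedFDeriv ℝ i (fun x => χ (c j • x)) x‖ ≤ B i := by
      rw [iteratedFDeriv_comp_const_smul (c j) (hχ.of_le (by exact_mod_cast le_top)), norm_smul, norm_pow,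
        Real.norm_of_nonneg (hc0 j).le]
      calc _ ≤ 1 * ‖iteratedFDeriv ℝ i χ (c j • x)‖ := by
            gcongr
            exact pow_le_one₀ (hc0 j).le (hc1 j)
        _ ≤ B i := by rw [one_mul]; exact hB i _
    have hB0 : 0 ≤ B i := (norm_nonneg _).trans (hB i 0)
    gcongr
    exact hD _ x
  · obtain ⟨R, hR⟩ := hK.isBounded.subset_ball 0
    have hev : ∀ᶠ j in atTop, ∀ x ∈ K,
        iteratedFDeriv ℝ k ((hcsφ j).toSchwartzMap (hsφ j)) x = iteratedFDeriv ℝ k φ x := by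
      filter_upwards [eventually_ge_atTop ⌈R⌉₊] with j hj x hx
      refine (Filter.EventuallyEq.iteratedFDeriv ℝ ?_ k).eq_of_nhds
      filter_upwards [Metric.isOpen_ball.mem_nhds (hR hx)] with y hy
      have : χ (c j • y) = 1 := χ.one_of_mem_closedBall <| by
        rw [mem_closedBall_zero_iff, norm_smul, Real.norm_of_nonneg (hc0 j).le]
        have h2 : R ≤ (j : ℝ) := Nat.ceil_le.1 hj
        have h3 := mem_ball_zero_iff.1 hy
        change ((j : ℝ) + 1)⁻¹ * ‖y‖ ≤ 1
        rw [inv_mul_le_iff₀ (by positivity)]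
        linarith
      rw [hg]
      simp [this]
    refine TendstoUniformlyOn.congr (f := iteratedFDeriv ℝ k φ)
      (F := fun _ => iteratedFDeriv ℝ k φ) ?_ ?_
    · exact fun u hu => Eventually.of_forall fun _ x _ => refl_mem_uniformity hu
    · filter_upwards [hev] with j hj x hx
      exact (hj x hx).symm

variable {n N : ℕ} {f : 𝓢'(Rn n, ℂ)} {μ : Measure (JetSpace n N)} {κ : JetSpace n N → ℂ}

/-- The value of the canonical extension of an integrable distribution. -/
lemma IsJetDensity.hasPairing (h : IsJetDensity f μ κ) {φ : Rn n → ℂ} (hφ : HasBoundedDerivs φ) :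
    HasPairing f φ (∫ ξ, jet N φ ξ * κ ξ ∂μ) := by
  refine ⟨hφ.exists_boundedApprox, fun g hg => ?_⟩
  simp only [h.apply_eq]
  choose D hD using hg.bounded
  refine tendsto_integral_of_dominated_convergence
    (fun ξ => (∑ k ∈ Finset.range (N + 1), D k) * ‖κ ξ‖) (fun j => ?_)
    (h.integrable.norm.const_mul _) (fun j => Eventually.of_forall fun ξ => ?_)
    (Eventually.of_forall fun ξ => ?_)
  · exact ((continuous_jet ((g j).smooth ⊤)).aestronglyMeasurable).mul h.integrable.1
  · rw [norm_mul]
    gcongr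
    calc _ ≤ D ξ.1 := (norm_jet_le _ ξ).trans (hD _ _ _)
      _ ≤ _ := Finset.single_le_sum (f := D) (fun k _ => (norm_nonneg _).trans (hD k 0 0))
        (Finset.mem_range.2 ξ.1.2)
  · refine Tendsto.mul_const _ ?_
    have h1 := (hg.tendsto ξ.1 {ξ.2.1} isCompact_singleton).tendsto_at (mem_singleton _)
    exact ((ContinuousMultilinearMap.apply ℝ (fun _ : Fin ξ.1 => Rn n) ℂ ξ.dirs).continuous.tendsto _).comp h1

lemma HasPairing.pairing_eq {φ : Rn n → ℂ} {c : ℂ} (h : HasPairing f φ c) : pairing f φ = c := by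
  have hex : ∃ c, HasPairing f φ c := ⟨c, h⟩
  rw [pairing, dif_pos hex]
  exact hex.choose_spec.unique h

end

noncomputable section

/-! ### Differentiation under the integral sign to all orders -/

section Param

variable {α E F : Type*} [MeasurableSpace α] {μ : Measure α} [NormedAddCommGroup E]
  [NormedSpace ℝ E] [NormedAddCommGroup F] [NormedSpace ℝ F]

/-- A family of smooth functions whose derivatives are dominated by integrable functions. -/
structure IsDominatedFamily (μ : Measure α) (K : α → E → F) : Prop where
  contDiff : ∀ y, ContDiff ℝ ∞ (K y)
  aesm : ∀ k x, AEStronglyMeasurable (fun y => iteratedFDeriv ℝ k (K y) x) μ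
  bound : ∀ k, ∃ B : α → ℝ, Integrable B μ ∧ ∀ y x, ‖iteratedFDeriv ℝ k (K y) x‖ ≤ B y

variable {K : α → E → F}

lemma IsDominatedFamily.integrable (h : IsDominatedFamily μ K) (k : ℕ) (x : E) :
    Integrable (fun y => iteratedFDeriv ℝ k (K y) x) μ := by
  obtain ⟨B, hB, hle⟩ := h.bound k
  exact hB.mono' (h.aesm k x) (Eventually.of_forall fun y => hle y x)

/-- The derivative is described by its values on vectors, which is the form in which it is compared
with the curried next derivative in `IsDominatedFamily.iteratedFDeriv_integral`. -/
lemma exists_hasFDerivAt_integral {G : Type*} [NormedAddCommGroup G] [NormedSpace ℝ G]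
    {P : α → E → G} (hP : ∀ y, Differentiable ℝ (P y)) (hint : ∀ x, Integrable (fun y => P y x) μ)
    {x : E} (hm : AEStronglyMeasurable (fun y => fderiv ℝ (P y) x) μ) {B : α → ℝ}
    (hB : Integrable B μ) (hle : ∀ y x, ‖fderiv ℝ (P y) x‖ ≤ B y) :
    ∃ L : E →L[ℝ] G, HasFDerivAt (fun x => ∫ y, P y x ∂μ) L x ∧
      ∀ v, L v = ∫ y, fderiv ℝ (P y) x v ∂μ := by
  have h1 : Integrable (fun y => fderiv ℝ (P y) x) μ :=
    hB.mono' hm (Eventually.of_forall fun y => hle y x)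
  refine ⟨∫ y, fderiv ℝ (P y) x ∂μ, ?_, fun v => ContinuousLinearMap.integral_apply h1 v⟩
  exact hasFDerivAt_integral_of_dominated_of_fderiv_le (bound := B)
    (F := fun x y => P y x) (F' := fun x y => fderiv ℝ (P y) x) univ_mem
    (Eventually.of_forall fun x => (hint x).1) (hint x) hm
    (Eventually.of_forall fun y x _ => hle y x) hB
    (Eventually.of_forall fun y x _ => (hP y x).hasFDerivAt)

lemma IsDominatedFamily.exists_hasFDerivAt (h : IsDominatedFamily μ K) (k : ℕ) (x : E) :
    ∃ L : E →L[ℝ] E [×k]→L[ℝ] F, HasFDerivAt (fun x => ∫ y, iteratedFDeriv ℝ k (K y) x ∂μ) L x ∧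
      ∀ v, L v = ∫ y, fderiv ℝ (iteratedFDeriv ℝ k (K y)) x v ∂μ := by
  obtain ⟨B, hB, hle⟩ := h.bound (k + 1)
  refine exists_hasFDerivAt_integral (fun y => (h.contDiff y).differentiable_iteratedFDeriv
    (by exact_mod_cast WithTop.coe_lt_top k)) (fun x => h.integrable k x) ?_ hB fun y x => ?_
  · have e : ∀ y, fderiv ℝ (iteratedFDeriv ℝ k (K y)) x =
        (continuousMultilinearCurryLeftEquiv ℝ (fun _ : Fin (k + 1) => E) F)
          (iteratedFDeriv ℝ (k + 1) (K y) x) := fun y => by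
      rw [iteratedFDeriv_succ_eq_comp_left]
      simp
    simp only [e]
    exact (LinearIsometryEquiv.continuous _).comp_aestronglyMeasurable (h.aesm (k + 1) x)
  · rw [norm_fderiv_iteratedFDeriv]
    exact hle y x

lemma IsDominatedFamily.iteratedFDeriv_integral (h : IsDominatedFamily μ K) (k : ℕ) :
    iteratedFDeriv ℝ k (fun x => ∫ y, K y x ∂μ) = fun x => ∫ y, iteratedFDeriv ℝ k (K y) x ∂μ := by
  induction k with
  | zero =>
    ext1 x
    simp only [iteratedFDeriv_zero_eq_comp, Function.comp]
    exact (ContinuousLinearEquiv.integral_comp_comm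
      (continuousMultilinearCurryFin0 ℝ E F).symm.toContinuousLinearEquiv fun y => K y x).symm
  | succ k ih =>
    ext1 x
    obtain ⟨L, hL, hLv⟩ := h.exists_hasFDerivAt k x
    rw [iteratedFDeriv_succ_eq_comp_left, ih, Function.comp_apply, hL.fderiv]
    ext v
    rw [ContinuousMultilinearMap.integral_apply (h.integrable (k + 1) x),
      continuousMultilinearCurryLeftEquiv_symm_apply, hLv]
    refine ContinuousMultilinearMap.integral_apply ?_ _
    have h1 := (h.integrable (k + 1) x)
    have h2 := ((ContinuousLinearMap.apply ℝ (E [×k]→L[ℝ] F) (v 0)) ∘L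
      ((continuousMultilinearCurryLeftEquiv ℝ (fun _ : Fin (k + 1) => E) F).toContinuousLinearEquiv
        : _ →L[ℝ] _)).integrable_comp h1
    refine h2.congr (Eventually.of_forall fun y => ?_)
    simp [iteratedFDeriv_succ_eq_comp_left]

lemma IsDominatedFamily.hasBoundedDerivs (h : IsDominatedFamily μ K) :
    HasBoundedDerivs fun x => ∫ y, K y x ∂μ := by
  refine ⟨contDiff_of_differentiable_iteratedFDeriv (n := ⊤) fun m _ => ?_, fun k => ?_⟩
  · rw [h.iteratedFDeriv_integral]
    exact fun x => (h.exists_hasFDerivAt m x).choose_spec.1.differentiableAt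
  · obtain ⟨B, hB, hle⟩ := h.bound k
    refine ⟨∫ y, B y ∂μ, fun x => ?_⟩
    rw [h.iteratedFDeriv_integral]
    exact norm_integral_le_of_norm_le hB (Eventually.of_forall fun y => hle y x)

end Param

/-! ### Derivatives of ridgelets -/

variable {n : ℕ}

/-- The form `v ↦ ∏ ⟨vᵢ, u⟩`. -/
def dirForm (k : ℕ) (u : Rn n) : ContinuousMultilinearMap ℝ (fun _ : Fin k => Rn n) ℂ :=
  (ContinuousMultilinearMap.mkPiAlgebra ℝ (Fin k) ℂ).compContinuousLinearMap
    fun _ => Complex.ofRealCLM ∘L innerSL ℝ u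

lemma dirForm_apply (k : ℕ) (u : Rn n) (v : Fin k → Rn n) :
    dirForm k u v = ∏ i, ((inner ℝ u (v i) : ℝ) : ℂ) := by
  simp [dirForm]

lemma continuous_dirForm (k : ℕ) : Continuous (dirForm (n := n) k) := by
  have h1 : Continuous fun u : Rn n => fun _ : Fin k => Complex.ofRealCLM ∘L innerSL ℝ u := by
    refine continuous_pi fun _ => ?_
    exact ((ContinuousLinearMap.compL ℝ (Rn n) ℝ ℂ) Complex.ofRealCLM).continuous.comp
      (innerSL ℝ).continuous
  have h2 := (ContinuousMultilinearMap.compContinuousLinearMapContinuousMultilinear ℝ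
    (fun _ : Fin k => Rn n) (fun _ : Fin k => ℂ) ℂ).cont.comp h1
  exact ((ContinuousLinearMap.apply ℝ _ (ContinuousMultilinearMap.mkPiAlgebra ℝ (Fin k) ℂ)).continuous).comp h2

lemma norm_dirForm_le (k : ℕ) (u : Rn n) (hu : ‖u‖ = 1) : ‖dirForm k u‖ ≤ 1 := by
  refine ContinuousMultilinearMap.opNorm_le_bound zero_le_one fun v => ?_
  rw [dirForm_apply, norm_prod, one_mul]
  refine Finset.prod_le_prod (fun _ _ => norm_nonneg _) fun i _ => ?_
  rw [Complex.norm_real]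
  simpa [hu] using norm_inner_le_norm (𝕜 := ℝ) u (v i)

lemma norm_sph (u : Sph n) : ‖(u : Rn n)‖ = 1 := norm_eq_of_mem_sphere u

lemma Y.pos (y : Y n) : 0 < (y.2.2 : ℝ) := y.2.2.2

lemma ridgelet_eq_comp (ψ : ℝ → ℂ) (y : Y n) : ridgelet ψ y =
    (fun t : ℝ => (y.2.2 : ℝ)⁻¹ • ψ ((y.2.2 : ℝ)⁻¹ * t - y.2.1 / y.2.2)) ∘ innerSL ℝ (y.1 : Rn n) := by
  ext x
  simp only [ridgelet, Function.comp, innerSL_apply_apply, Complex.real_smul]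
  rw [real_inner_comm, sub_div, div_eq_inv_mul]

lemma contDiff_ridgelet {ψ : ℝ → ℂ} (hψ : ContDiff ℝ ∞ ψ) (y : Y n) :
    ContDiff ℝ ∞ (ridgelet ψ y) := by
  rw [ridgelet_eq_comp]
  refine ContDiff.comp ?_ (innerSL ℝ (y.1 : Rn n)).contDiff
  have h1 : ContDiff ℝ ∞ fun t : ℝ => (y.2.2 : ℝ)⁻¹ * t - y.2.1 / y.2.2 := by fun_prop
  exact (hψ.comp h1).const_smul _

/-- A ridgelet is a one-dimensional profile composed with `⟨·, u⟩`. Each derivative contributes a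
factor `a⁻¹` beyond the normalizing one, whence the exponent `k + 1`. -/
lemma iteratedFDeriv_ridgelet {ψ : ℝ → ℂ} (hψ : ContDiff ℝ ∞ ψ) (y : Y n) (k : ℕ) (x : Rn n) :
    iteratedFDeriv ℝ k (ridgelet ψ y) x =
      ((((y.2.2 : ℝ)⁻¹ ^ (k + 1) : ℝ) : ℂ) *
        iteratedDeriv k ψ ((inner ℝ x (y.1 : Rn n) - y.2.1) / y.2.2)) • dirForm k (y.1 : Rn n) := by
  have hψ' : ContDiff ℝ ∞ fun s => ψ (s - y.2.1 / y.2.2) :=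
    hψ.comp (contDiff_id.sub contDiff_const)
  have h1 : iteratedDeriv k (fun t : ℝ => (y.2.2 : ℝ)⁻¹ • ψ ((y.2.2 : ℝ)⁻¹ * t - y.2.1 / y.2.2)) =
      fun t => (y.2.2 : ℝ)⁻¹ ^ (k + 1) • iteratedDeriv k ψ ((y.2.2 : ℝ)⁻¹ * t - y.2.1 / y.2.2) := by
    ext t
    have e := iteratedDeriv_comp_const_smul (n := k) (f := fun s => ψ (s - y.2.1 / y.2.2))
      (hψ'.of_le (by exact_mod_cast le_top)) (y.2.2 : ℝ)⁻¹
    have h2 : ContDiff ℝ ∞ fun t => ψ ((y.2.2 : ℝ)⁻¹ * t - y.2.1 / y.2.2) :=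
      hψ'.comp (contDiff_const.mul contDiff_id)
    rw [iteratedDeriv_fun_const_smul (h2.contDiffAt.of_le (by exact_mod_cast le_top)), e,
      iteratedDeriv_comp_sub_const, smul_smul, ← pow_succ']
  have hs : ContDiff ℝ ∞ (fun t : ℝ => (y.2.2 : ℝ)⁻¹ • ψ ((y.2.2 : ℝ)⁻¹ * t - y.2.1 / y.2.2)) :=
    (hψ'.comp (contDiff_const.mul contDiff_id)).const_smul _
  rw [ridgelet_eq_comp, ContinuousLinearMap.iteratedFDeriv_comp_right _ hs x
    (by exact_mod_cast le_top)]
  ext v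
  rw [ContinuousMultilinearMap.compContinuousLinearMap_apply,
    iteratedFDeriv_apply_eq_iteratedDeriv_mul_prod, h1]
  simp only [innerSL_apply_apply, _root_.smul_apply, dirForm_apply, smul_eq_mul,
    Complex.real_smul, Complex.ofReal_prod]
  rw [real_inner_comm x, sub_div, div_eq_inv_mul (inner ℝ x _), mul_comm]

lemma norm_iteratedFDeriv_ridgelet_le (ψ : 𝓢(ℝ, ℂ)) (y : Y n) (k : ℕ) (x : Rn n) :
    ‖iteratedFDeriv ℝ k (ridgelet ψ y) x‖ ≤
      (y.2.2 : ℝ)⁻¹ ^ (k + 1) * SchwartzMap.seminorm ℝ 0 k ψ := by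
  have ha := y.pos
  rw [iteratedFDeriv_ridgelet (ψ.smooth ⊤), norm_smul, norm_mul, Complex.norm_real,
    Real.norm_of_nonneg (by positivity)]
  have h1 := SchwartzMap.le_seminorm' ℝ 0 k ψ ((inner ℝ x (y.1 : Rn n) - y.2.1) / y.2.2)
  rw [pow_zero, one_mul] at h1
  calc _ ≤ (y.2.2 : ℝ)⁻¹ ^ (k + 1) * SchwartzMap.seminorm ℝ 0 k ψ * 1 := by
        gcongr
        exact norm_dirForm_le k _ (norm_sph _)
    _ = _ := mul_one _

lemma hasBoundedDerivs_ridgelet (ψ : 𝓢(ℝ, ℂ)) (y : Y n) : HasBoundedDerivs (ridgelet ψ y) :=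
  ⟨contDiff_ridgelet (ψ.smooth ⊤) y, fun k => ⟨_, norm_iteratedFDeriv_ridgelet_le ψ y k⟩⟩

lemma continuous_iteratedDeriv_ridgelet {ψ : ℝ → ℂ} (hψ : ContDiff ℝ ∞ ψ) (k : ℕ) :
    Continuous fun p : Y n × Rn n => (((((p.1.2.2 : ℝ)⁻¹ ^ (k + 1) : ℝ) : ℂ) *
        iteratedDeriv k ψ ((inner ℝ p.2 (p.1.1 : Rn n) - p.1.2.1) / p.1.2.2))) := by
  have ha : ∀ p : Y n × Rn n, (p.1.2.2 : ℝ) ≠ 0 := fun p => (Y.pos p.1).ne'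
  have h0 : Continuous fun p : Y n × Rn n => (p.1.2.2 : ℝ) := by fun_prop
  have h1 : Continuous (iteratedDeriv k ψ) := hψ.continuous_iteratedDeriv k (by exact_mod_cast le_top)
  refine (Complex.continuous_ofReal.comp ((h0.inv₀ ha).pow _)).mul (h1.comp ?_)
  refine Continuous.div ?_ h0 ha
  fun_prop

lemma continuous_iteratedFDeriv_ridgelet {ψ : ℝ → ℂ} (hψ : ContDiff ℝ ∞ ψ) (k : ℕ) :
    Continuous fun p : Y n × Rn n => iteratedFDeriv ℝ k (ridgelet ψ p.1) p.2 := by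
  simp only [iteratedFDeriv_ridgelet hψ]
  refine (continuous_iteratedDeriv_ridgelet hψ k).smul ((continuous_dirForm k).comp ?_)
  fun_prop

/-! ### Integrability on `𝕐ⁿ⁺¹` -/

lemma weight_pos (s r : ℕ) (y : Y n) : 0 < weight s r y := by
  have := y.pos
  unfold weight
  positivity

/-- The exponent `n + 2` compensates the density `a⁻ⁿ`: the integrand in `a` becomes `1/(a^{2n+2} +
a^{-2}) ≤ 2/(1 + a²)`. The second index `2` gives `1/(1 + b²)`, and the sphere has finite measure.
-/
lemma integrable_inv_weight : Integrable (fun y : Y n => (weight (n + 2) 2 y)⁻¹) (stdMeasure n) := by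
  have hA : Integrable (fun a : Ioi (0 : ℝ) => (((a : ℝ) ^ (n + 2) + 1 / (a : ℝ) ^ (n + 2)))⁻¹)
      (((volume : Measure ℝ).comap ((↑) : Ioi (0 : ℝ) → ℝ)).withDensity
        fun a => ENNReal.ofReal (((a : ℝ) ^ n)⁻¹)) := by
    have hm : Measurable fun a : Ioi (0 : ℝ) => ENNReal.ofReal (((a : ℝ) ^ n)⁻¹) := by fun_prop
    rw [integrable_withDensity_iff_integrable_smul' hm (Eventually.of_forall fun _ =>
      ENNReal.ofReal_lt_top)]
    have h2 : Integrable (fun a : Ioi (0 : ℝ) => 2 * (1 + (a : ℝ) ^ 2)⁻¹)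
        ((volume : Measure ℝ).comap ((↑) : Ioi (0 : ℝ) → ℝ)) :=
      (integrableOn_iff_comap_subtypeVal measurableSet_Ioi).1
        (integrable_inv_one_add_sq.const_mul 2).integrableOn
    refine h2.mono' ?_ (Eventually.of_forall fun a => ?_)
    · refine Measurable.aestronglyMeasurable ?_
      fun_prop
    · have ha : 0 < (a : ℝ) := a.2
      rw [ENNReal.toReal_ofReal (by positivity), smul_eq_mul, ← mul_inv,
        Real.norm_of_nonneg (by positivity), ← div_eq_mul_inv, inv_eq_one_div,
        div_le_div_iff₀ (by positivity) (by positivity), one_mul]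
      generalize (a : ℝ) = t at ha
      have e : t ^ n * (t ^ (n + 2) + 1 / t ^ (n + 2)) = t ^ (2 * n + 2) + 1 / t ^ 2 := by
        field_simp
        ring
      rw [e]
      rcases le_total t 1 with h | h
      · have h3 : 1 ≤ 1 / t ^ 2 := by
          rw [le_div_iff₀ (by positivity), one_mul]
          exact pow_le_one₀ ha.le h
        have h4 : t ^ 2 ≤ 1 := pow_le_one₀ ha.le h
        have : 0 ≤ t ^ (2 * n + 2) := by positivity
        linarith
      · have h3 : t ^ 2 ≤ t ^ (2 * n + 2) := pow_le_pow_right₀ h (by omega)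
        have h4 : 1 ≤ t ^ 2 := one_le_pow₀ h
        have : 0 ≤ 1 / t ^ 2 := by positivity
        linarith
  have hB : Integrable (fun b : ℝ => ((1 + b ^ 2) ^ (((2 : ℕ) : ℝ) / 2))⁻¹) := by
    have e : ((2 : ℕ) : ℝ) / 2 = 1 := by norm_num
    simp only [e, Real.rpow_one]
    exact integrable_inv_one_add_sq
  have := (integrable_const (1 : ℝ) (μ := (volume : Measure (Rn n)).toSphere)).mul_prod
    (hB.mul_prod hA)
  refine this.congr (Eventually.of_forall fun y => ?_)
  simp only [weight, one_mul, mul_inv]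
  ring

lemma integrable_of_weight {E : Type*} [NormedAddCommGroup E] {G : Y n → E} {C : ℝ}
    (hG : AEStronglyMeasurable G (stdMeasure n)) (h : ∀ y, weight (n + 2) 2 y * ‖G y‖ ≤ C) :
    Integrable G (stdMeasure n) := by
  refine (integrable_inv_weight.const_mul C).mono' hG (Eventually.of_forall fun y => ?_)
  rw [← div_eq_mul_inv, le_div_iff₀ (weight_pos _ _ y), mul_comm]
  exact h y

lemma continuous_weight (s r : ℕ) : Continuous (weight (n := n) s r) := by
  have h0 : Continuous fun y : Y n => (y.2.2 : ℝ) := by fun_prop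
  have ha : ∀ y : Y n, (y.2.2 : ℝ) ^ s ≠ 0 := fun y => (pow_pos y.pos s).ne'
  refine ((h0.pow s).add (continuous_const.div (h0.pow s) ha)).mul ?_
  exact Continuous.rpow_const (by fun_prop) fun y => Or.inl (by positivity)

/-! ### Admissible functions -/

/-- Smooth functions on `𝕐ⁿ⁺¹` for which the seminorms that only involve the Laplace–Beltrami
operator are finite. -/
structure IsAdmissible (Φ : Y n → ℂ) : Prop where
  smooth : IsSmooth Φ
  bound : ∀ s r k, ∃ C, ∀ y, weight s r y * ‖lapU^[k] Φ y‖ ≤ C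

lemma SchwartzY.isAdmissible (Φ : SchwartzY n) : IsAdmissible (Φ : Y n → ℂ) := by
  refine ⟨Φ.2.1, fun s r k => ?_⟩
  obtain ⟨C, hC⟩ := Φ.2.2 (s, r, 0, 0, k)
  exact ⟨C, fun y => hC ⟨y, rfl⟩⟩

lemma extend_coe (Φ : Y n → ℂ) (y : Y n) : extend Φ ((y.1 : Rn n), y.2.1, (y.2.2 : ℝ)) = Φ y := by
  rw [extend, dif_pos (coe_mem_coneSet y)]
  congr 1
  ext1
  · ext1
    simp
  · rfl

lemma IsSmooth.continuous {Φ : Y n → ℂ} (h : IsSmooth Φ) : Continuous Φ := by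
  have h1 : Continuous fun y : Y n => ((y.1 : Rn n), y.2.1, (y.2.2 : ℝ)) := by fun_prop
  have h2 := h.continuousOn.comp_continuous h1 coe_mem_coneSet
  exact h2.congr fun y => extend_coe Φ y

lemma IsAdmissible.lapU {Φ : Y n → ℂ} (h : IsAdmissible Φ) : IsAdmissible (lapU Φ) :=
  ⟨(isGoodOp_lapU n).smooth h.smooth, fun s r k => h.bound s r (k + 1)⟩

/-- Multiplication by a function of `b` and `a`. -/
def mulBA (m : ℝ → ℝ → ℂ) (Φ : Y n → ℂ) (y : Y n) : ℂ := m y.2.1 y.2.2 * Φ y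

lemma extend_mulBA (m : ℝ → ℝ → ℂ) (Φ : Y n → ℂ) (p : Rn n × ℝ × ℝ) :
    extend (mulBA m Φ) p = m p.2.1 p.2.2 * extend Φ p := by
  by_cases h : p ∈ coneSet n <;> simp [extend, h, mulBA]

/-- A factor depending only on `(b, a)` is a constant for the operator in `u`. Thus admissibility,
which asks for no bounds on `b`- or `a`-derivatives, is stable under such multiplications. -/
lemma lapU_mulBA (m : ℝ → ℝ → ℂ) {Φ : Y n → ℂ} (h : IsSmooth Φ) :
    lapU (mulBA m Φ) = mulBA m (lapU Φ) := by
  ext y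
  have := InnerProductSpace.laplacian_smul (m y.2.1 y.2.2) (contDiffAt_slice h y)
  simp only [lapU, extend_mulBA, mulBA]
  exact this

lemma iterate_lapU_mulBA (m : ℝ → ℝ → ℂ) (k : ℕ) : ∀ {Φ : Y n → ℂ}, IsSmooth Φ →
    lapU^[k] (mulBA m Φ) = mulBA m (lapU^[k] Φ) := by
  induction k with
  | zero => intro Φ _; rfl
  | succ k ih =>
    intro Φ h
    rw [Function.iterate_succ_apply, Function.iterate_succ_apply, lapU_mulBA m h,
      ih ((isGoodOp_lapU n).smooth h)]

lemma weight_mul_le (p q s r : ℕ) (y : Y n) :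
    weight s r y * weight p q y ≤ 2 * weight (s + p) (r + q) y := by
  have ha := y.pos
  unfold weight
  have hb : (0 : ℝ) < 1 + y.2.1 ^ 2 := by positivity
  have e : (1 + y.2.1 ^ 2) ^ (((r + q : ℕ) : ℝ) / 2)
      = (1 + y.2.1 ^ 2) ^ ((r : ℝ) / 2) * (1 + y.2.1 ^ 2) ^ ((q : ℝ) / 2) := by
    rw [← Real.rpow_add hb]
    congr 1
    push_cast
    ring
  rw [e, pow_add]
  generalize (y.2.2 : ℝ) = a at ha
  have h : (a ^ s + 1 / a ^ s) * (a ^ p + 1 / a ^ p) ≤ 2 * (a ^ s * a ^ p + 1 / (a ^ s * a ^ p)) := by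
    have hs : 0 < a ^ s := by positivity
    have hp : 0 < a ^ p := by positivity
    -- Both factors have the sign of `a - 1`; their product is, up to a positive factor, the
    -- difference of the two sides.
    have h1 : 0 ≤ ((a ^ s) ^ 2 - 1) * ((a ^ p) ^ 2 - 1) := by
      rcases le_total a 1 with h | h
      · refine mul_nonneg_of_nonpos_of_nonpos ?_ ?_ <;>
        exact sub_nonpos.2 (pow_le_one₀ (by positivity) (pow_le_one₀ ha.le h))
      · refine mul_nonneg ?_ ?_ <;> exact sub_nonneg.2 (one_le_pow₀ (one_le_pow₀ h))
    generalize a ^ s = S at *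
    generalize a ^ p = P at *
    have e2 : 2 * (S * P + 1 / (S * P)) - (S + 1 / S) * (P + 1 / P)
        = ((S ^ 2 - 1) * (P ^ 2 - 1)) / (S * P) := by
      field_simp
      ring
    have : 0 ≤ ((S ^ 2 - 1) * (P ^ 2 - 1)) / (S * P) := by positivity
    linarith
  have h1 : 0 ≤ (1 + y.2.1 ^ 2) ^ ((r : ℝ) / 2) * (1 + y.2.1 ^ 2) ^ ((q : ℝ) / 2) := by positivity
  calc _ = (a ^ s + 1 / a ^ s) * (a ^ p + 1 / a ^ p) *
        ((1 + y.2.1 ^ 2) ^ ((r : ℝ) / 2) * (1 + y.2.1 ^ 2) ^ ((q : ℝ) / 2)) := by ring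
    _ ≤ _ := mul_le_mul_of_nonneg_right h h1
    _ = _ := by ring

lemma IsAdmissible.mulBA {m : ℝ → ℝ → ℂ} {Φ : Y n → ℂ} (h : IsAdmissible Φ) {p q : ℕ}
    (hm : ContDiffOn ℝ ∞ (fun z : ℝ × ℝ => m z.1 z.2) {z | 0 < z.2})
    (hb : ∀ y : Y n, ‖m y.2.1 y.2.2‖ ≤ weight p q y) : IsAdmissible (mulBA m Φ) := by
  refine ⟨?_, fun s r k => ?_⟩
  · have : extend (Ridgelet.mulBA m Φ) = fun p => m p.2.1 p.2.2 * extend Φ p := by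
      ext p
      exact extend_mulBA m Φ p
    rw [IsSmooth, this]
    exact (hm.comp contDiff_snd.contDiffOn fun p hp => hp.2).mul h.smooth
  · obtain ⟨C, hC⟩ := h.bound (s + p) (r + q) k
    refine ⟨2 * C, fun y => ?_⟩
    rw [iterate_lapU_mulBA m k h.smooth, Ridgelet.mulBA, norm_mul]
    calc weight s r y * (‖m y.2.1 y.2.2‖ * ‖Ridgelet.lapU^[k] Φ y‖)
        ≤ weight s r y * (weight p q y * ‖Ridgelet.lapU^[k] Φ y‖) := by
          refine mul_le_mul_of_nonneg_left ?_ (weight_nonneg _ _ _)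
          exact mul_le_mul_of_nonneg_right (hb y) (norm_nonneg _)
      _ = weight s r y * weight p q y * ‖Ridgelet.lapU^[k] Φ y‖ := by ring
      _ ≤ 2 * weight (s + p) (r + q) y * ‖Ridgelet.lapU^[k] Φ y‖ := by
          exact mul_le_mul_of_nonneg_right (weight_mul_le _ _ _ _ _) (norm_nonneg _)
      _ ≤ 2 * C := by linarith [hC y]

/-- Multiplication by `a`. -/
def mulA : (Y n → ℂ) → Y n → ℂ := mulBA fun _ a => (a : ℂ)

/-- Multiplication by `b`. -/
def mulB : (Y n → ℂ) → Y n → ℂ := mulBA fun b _ => (b : ℂ)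

/-- Multiplication by `a⁻¹`. -/
def divA : (Y n → ℂ) → Y n → ℂ := mulBA fun _ a => ((a⁻¹ : ℝ) : ℂ)

lemma mulA_apply (Φ : Y n → ℂ) (y : Y n) : mulA Φ y = (y.2.2 : ℝ) * Φ y := rfl

lemma mulB_apply (Φ : Y n → ℂ) (y : Y n) : mulB Φ y = y.2.1 * Φ y := rfl

lemma divA_apply (Φ : Y n → ℂ) (y : Y n) : divA Φ y = (((y.2.2 : ℝ)⁻¹ : ℝ) : ℂ) * Φ y := rfl

lemma IsAdmissible.mulA {Φ : Y n → ℂ} (h : IsAdmissible Φ) : IsAdmissible (mulA Φ) := by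
  refine h.mulBA (p := 1) (q := 0) ?_ fun y => ?_
  · exact (Complex.ofRealCLM.contDiff.comp contDiff_snd).contDiffOn
  · have := y.pos
    simp [weight, abs_of_pos this, this.le]

lemma IsAdmissible.divA {Φ : Y n → ℂ} (h : IsAdmissible Φ) : IsAdmissible (divA Φ) := by
  refine h.mulBA (p := 1) (q := 0) ?_ fun y => ?_
  · refine Complex.ofRealCLM.contDiff.comp_contDiffOn (contDiff_snd.contDiffOn.inv ?_)
    exact fun z hz => (ne_of_gt hz)
  · have := y.pos
    simp [weight, abs_of_pos this, this.le]

lemma IsAdmissible.mulB {Φ : Y n → ℂ} (h : IsAdmissible Φ) : IsAdmissible (mulB Φ) := by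
  refine h.mulBA (p := 0) (q := 1) ?_ fun y => ?_
  · exact (Complex.ofRealCLM.contDiff.comp contDiff_fst).contDiffOn
  · have h1 : |y.2.1| ≤ √(1 + y.2.1 ^ 2) := Real.abs_le_sqrt (by linarith)
    have h2 : 0 ≤ √(1 + y.2.1 ^ 2) := Real.sqrt_nonneg _
    rw [Complex.norm_real, Real.norm_eq_abs, weight, Nat.cast_one, ← Real.sqrt_eq_rpow]
    norm_num
    linarith

lemma IsAdmissible.iterate_divA {Φ : Y n → ℂ} (h : IsAdmissible Φ) (k : ℕ) :
    IsAdmissible (Ridgelet.divA^[k] Φ) := by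
  induction k with
  | zero => exact h
  | succ k ih =>
    rw [Function.iterate_succ_apply']
    exact ih.divA

lemma iterate_divA_apply (Φ : Y n → ℂ) (k : ℕ) (y : Y n) :
    divA^[k] Φ y = (((y.2.2 : ℝ)⁻¹ ^ k : ℝ) : ℂ) * Φ y := by
  induction k with
  | zero => simp
  | succ k ih =>
    rw [Function.iterate_succ_apply', divA_apply, ih, pow_succ']
    push_cast
    ring

lemma IsAdmissible.integrable {Φ : Y n → ℂ} (h : IsAdmissible Φ) :
    Integrable Φ (stdMeasure n) := by
  obtain ⟨C, hC⟩ := h.bound (n + 2) 2 0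
  exact integrable_of_weight h.smooth.continuous.aestronglyMeasurable hC

lemma iteratedFDeriv_mul_ridgelet (c : ℂ) (ψ : 𝓢(ℝ, ℂ)) (y : Y n) (k : ℕ) (x : Rn n) :
    iteratedFDeriv ℝ k (fun x => c * ridgelet ψ y x) x =
      c • iteratedFDeriv ℝ k (ridgelet ψ y) x :=
  iteratedFDeriv_const_smul_apply (a := c) (f := ridgelet ψ y)
    ((contDiff_ridgelet (ψ.smooth ⊤) y).contDiffAt.of_le (by exact_mod_cast le_top))

lemma IsAdmissible.isDominatedFamily {Φ : Y n → ℂ} (h : IsAdmissible Φ) (ψ : 𝓢(ℝ, ℂ)) :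
    IsDominatedFamily (stdMeasure n) fun y x => Φ y * ridgelet ψ y x := by
  have e : ∀ k x y, iteratedFDeriv ℝ k (fun x => Φ y * ridgelet ψ y x) x
      = Φ y • iteratedFDeriv ℝ k (ridgelet ψ y) x := fun k x y =>
    iteratedFDeriv_mul_ridgelet _ ψ y k x
  refine ⟨fun y => contDiff_const.mul (contDiff_ridgelet (ψ.smooth ⊤) y), fun k x => ?_, fun k => ?_⟩
  · simp only [e]
    refine Continuous.aestronglyMeasurable (h.smooth.continuous.smul ?_)
    exact (continuous_iteratedFDeriv_ridgelet (ψ.smooth ⊤) k).comp (Continuous.prodMk_left x)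
  · refine ⟨fun y => ‖Ridgelet.divA^[k + 1] Φ y‖ * SchwartzMap.seminorm ℝ 0 k ψ,
      ((h.iterate_divA (k + 1)).integrable.norm.mul_const _), fun y x => ?_⟩
    have ha := y.pos
    beta_reduce
    rw [e, norm_smul, iterate_divA_apply, norm_mul, Complex.norm_real,
      Real.norm_of_nonneg (by positivity)]
    calc _ ≤ ‖Φ y‖ * ((y.2.2 : ℝ)⁻¹ ^ (k + 1) * SchwartzMap.seminorm ℝ 0 k ψ) := by
          gcongr
          exact norm_iteratedFDeriv_ridgelet_le ψ y k x
      _ = _ := by ring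

lemma IsAdmissible.hasBoundedDerivs {Φ : Y n → ℂ} (h : IsAdmissible Φ) (ψ : 𝓢(ℝ, ℂ)) :
    HasBoundedDerivs (synthesis ψ Φ) := (h.isDominatedFamily ψ).hasBoundedDerivs

lemma IsAdmissible.iteratedFDeriv_synthesis {Φ : Y n → ℂ} (h : IsAdmissible Φ) (ψ : 𝓢(ℝ, ℂ))
    (k : ℕ) (x : Rn n) : iteratedFDeriv ℝ k (synthesis ψ Φ) x =
      ∫ y, Φ y • iteratedFDeriv ℝ k (ridgelet ψ y) x ∂stdMeasure n := by
  refine (congrFun ((h.isDominatedFamily ψ).iteratedFDeriv_integral k) x).trans ?_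
  refine integral_congr_ae (Eventually.of_forall fun y => ?_)
  exact iteratedFDeriv_mul_ridgelet _ ψ y k x

end

noncomputable section

/-! ### Green's identity on the sphere -/

variable {n : ℕ}

/-- The standard basis vectors of `ℝⁿ`. -/
def stdVec (i : Fin n) : Rn n := EuclideanSpace.basisFun (Fin n) ℝ i

lemma inner_stdVec (x : Rn n) (i : Fin n) : inner ℝ x (stdVec i) = x i := by
  simp [stdVec, EuclideanSpace.inner_single_right]

lemma sum_smul_stdVec (x : Rn n) : ∑ i, x i • stdVec i = x := by
  simpa [stdVec] using (EuclideanSpace.basisFun (Fin n) ℝ).sum_repr x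

/-- The partial derivative `∂ᵢ`. -/
def pderiv (i : Fin n) (g : Rn n → ℂ) (x : Rn n) : ℂ := fderiv ℝ g x (stdVec i)

lemma contDiffOn_pderiv {s : Set (Rn n)} (hs : IsOpen s) {g : Rn n → ℂ} (hg : ContDiffOn ℝ ∞ g s)
    (i : Fin n) : ContDiffOn ℝ ∞ (pderiv i g) s :=
  (hg.fderiv_of_isOpen hs (by simp)).clm_apply contDiffOn_const

lemma laplacian_eq_sum_pderiv {g : Rn n → ℂ} {x : Rn n} (hg : ContDiffAt ℝ ∞ g x) :
    Laplacian.laplacian g x = ∑ i, pderiv i (pderiv i g) x := by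
  rw [InnerProductSpace.laplacian_eq_iteratedFDeriv_orthonormalBasis _
    (EuclideanSpace.basisFun (Fin n) ℝ)]
  refine Finset.sum_congr rfl fun i _ => ?_
  rw [iteratedFDeriv_two_apply]
  simp only [Matrix.cons_val_zero, Matrix.cons_val_one]
  have hgd : DifferentiableAt ℝ (fderiv ℝ g) x :=
    (hg.fderiv_right (m := 1) (by norm_cast)).differentiableAt (by simp)
  have := (hgd.hasFDerivAt.clm_apply (hasFDerivAt_const (stdVec i) x)).fderiv
  change _ = fderiv ℝ (fun x => fderiv ℝ g x (stdVec i)) x (stdVec i)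
  rw [this]
  simp [stdVec]

/-- Smooth functions on `ℝⁿ \ {0}` that are homogeneous of degree `0`. -/
structure IsConic (g : Rn n → ℂ) : Prop where
  contDiffOn : ContDiffOn ℝ ∞ g {0}ᶜ
  homogeneous : ∀ r : ℝ, 0 < r → ∀ x, g (r • x) = g x

lemma IsConic.contDiffAt {g : Rn n → ℂ} (h : IsConic g) {x : Rn n} (hx : x ≠ 0) :
    ContDiffAt ℝ ∞ g x := h.contDiffOn.contDiffAt (isOpen_compl_singleton.mem_nhds hx)

/-- Euler's relation in degree `0`: `g` is constant along rays. -/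
lemma IsConic.fderiv_self {g : Rn n → ℂ} (h : IsConic g) {x : Rn n} (hx : x ≠ 0) :
    fderiv ℝ g x x = 0 := by
  have h1 : HasDerivAt (fun t : ℝ => t • x) x 1 := by
    simpa using (hasDerivAt_id (1 : ℝ)).smul_const x
  have hd : HasFDerivAt g (fderiv ℝ g x) ((1 : ℝ) • x) := by
    rw [one_smul]
    exact ((h.contDiffAt hx).differentiableAt (by simp)).hasFDerivAt
  have h2 := hd.comp_hasDerivAt (1 : ℝ) h1
  have h3 : (g ∘ fun t : ℝ => t • x) =ᶠ[𝓝 1] fun _ => g x := by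
    filter_upwards [lt_mem_nhds (zero_lt_one' ℝ)] with t ht
    exact h.homogeneous t ht x
  exact h2.unique ((hasDerivAt_const (1 : ℝ) (g x)).congr_of_eventuallyEq h3)

lemma pderiv_smul_of_homogeneous {g : Rn n → ℂ} {c : ℝ} {r : ℝ} (hr : r ≠ 0)
    (h : ∀ x, g (r • x) = c • g x) (i : Fin n) (x : Rn n) :
    pderiv i g (r • x) = (r⁻¹ * c) • pderiv i g x := by
  have h1 : (fun x => g (r • x)) = c • g := funext h
  have h2 := fderiv_comp_smul (𝕜 := ℝ) (f := g) (x := x) r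
  rw [h1, fderiv_const_smul_field] at h2
  have h3 := congrArg (fun L : Rn n →L[ℝ] ℂ => L (stdVec i)) h2
  simp only [Pi.smul_apply, _root_.smul_apply] at h3
  rw [pderiv, pderiv, mul_smul, h3, smul_smul, inv_mul_cancel₀ hr, one_smul]

lemma IsConic.pderiv_pderiv_smul {g : Rn n → ℂ} (h : IsConic g) {r : ℝ} (hr : 0 < r) (i : Fin n)
    (x : Rn n) : pderiv i (pderiv i g) (r • x) = (r⁻¹ * r⁻¹) • pderiv i (pderiv i g) x := by
  refine pderiv_smul_of_homogeneous hr.ne' (fun x => ?_) i x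
  have := pderiv_smul_of_homogeneous (c := 1) hr.ne' (fun x => by rw [h.homogeneous r hr, one_smul])
    (g := g) i x
  rwa [mul_one] at this

lemma IsConic.laplacian_smul {g : Rn n → ℂ} (h : IsConic g) {r : ℝ} (hr : 0 < r) {x : Rn n}
    (hx : x ≠ 0) :
    Laplacian.laplacian g (r • x) = (r⁻¹ * r⁻¹) • Laplacian.laplacian g x := by
  rw [laplacian_eq_sum_pderiv (h.contDiffAt hx),
    laplacian_eq_sum_pderiv (h.contDiffAt (smul_ne_zero hr.ne' hx)), Finset.smul_sum]
  exact Finset.sum_congr rfl fun i _ => h.pderiv_pderiv_smul hr i x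

/-- Integration of a product in polar coordinates. -/
lemma integral_polar [Nontrivial (Rn n)] (Θ : Rn n → ℂ) (c : ℝ → ℂ) (A : Sph n → ℂ)
    (h : ∀ r : ℝ, 0 < r → ∀ u : Sph n, Θ (r • (u : Rn n)) = A u * c r) :
    ∫ x, Θ x = (∫ u, A u ∂(volume : Measure (Rn n)).toSphere) *
      ∫ r : Ioi (0 : ℝ), c r ∂Measure.volumeIoiPow (Module.finrank ℝ (Rn n) - 1) := by
  calc ∫ x, Θ x
    _ = ∫ x : ({(0 : Rn n)}ᶜ : Set (Rn n)), Θ x ∂(volume.comap Subtype.val) := by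
      rw [integral_subtype_comap (measurableSet_singleton (0 : Rn n)).compl fun x => Θ x,
        restrict_compl_singleton]
    _ = ∫ p : Sph n × Ioi (0 : ℝ), A p.1 * c p.2 ∂(volume : Measure (Rn n)).toSphere.prod
          (.volumeIoiPow (Module.finrank ℝ (Rn n) - 1)) := by
      rw [← (volume : Measure (Rn n)).measurePreserving_homeomorphUnitSphereProd.integral_comp
        (Homeomorph.measurableEmbedding _)]
      refine integral_congr_ae (Eventually.of_forall fun x => ?_)
      have hx : ‖(x : Rn n)‖ ≠ 0 := norm_ne_zero_iff.2 x.2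
      have := h ‖(x : Rn n)‖ (by positivity) (homeomorphUnitSphereProd (Rn n) x).1
      simp only [homeomorphUnitSphereProd_apply_fst_coe, smul_smul, mul_inv_cancel₀ hx, one_smul] at this
      simp only [homeomorphUnitSphereProd_apply_snd_coe]
      exact this
    _ = _ := integral_prod_mul (fun u : Sph n => A u) (fun r : Ioi (0 : ℝ) => c r)

lemma integral_fderiv_eq_zero {V : Rn n → ℂ} (hV : ContDiff ℝ 1 V) (hc : HasCompactSupport V)
    (e : Rn n) : ∫ x, fderiv ℝ V x e = 0 := by
  have h1 : Integrable fun x => fderiv ℝ V x e :=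
    ((hV.continuous_fderiv (by simp)).clm_apply continuous_const).integrable_of_hasCompactSupport
      (hc.fderiv_apply ℝ e)
  have h2 : Integrable V := hV.continuous.integrable_of_hasCompactSupport hc
  have := integral_mul_fderiv_eq_neg_fderiv_mul_of_integrable (μ := (volume : Measure (Rn n)))
    (f := fun _ => (1 : ℂ)) (g := V) (v := e) (by simp) (by simpa using h1) (by simpa using h2)
    (fun x _ => differentiableAt_const _) (fun x _ => hV.differentiable (by simp) x)
  simpa using this

/-- A radial profile: a smooth function of compact support in `(0, ∞)`. -/
lemma exists_radial_profile : ∃ β : ℝ → ℝ, ContDiff ℝ ∞ β ∧ (∀ t, 0 ≤ β t) ∧ 0 < β 1 ∧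
    (∀ t, t < 1 / 2 → β t = 0) ∧ ∀ t, 2 < t → β t = 0 := by
  let χ : ContDiffBump (1 : ℝ) := ⟨1 / 4, 1 / 2, by norm_num, by norm_num⟩
  refine ⟨χ, χ.contDiff, fun t => χ.nonneg, ?_, fun t ht => ?_, fun t ht => ?_⟩
  · exact χ.pos_of_mem_ball (Metric.mem_ball_self χ.rOut_pos)
  · refine χ.zero_of_le_dist ?_
    rw [Real.dist_eq, abs_of_neg (by linarith)]
    change 1 / 2 ≤ _
    linarith
  · refine χ.zero_of_le_dist ?_
    rw [Real.dist_eq, abs_of_pos (by linarith)]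
    change 1 / 2 ≤ _
    linarith

lemma hasFDerivAt_radial {η : ℝ → ℝ} (hη : ContDiff ℝ ∞ η) (x : Rn n) :
    HasFDerivAt (fun x : Rn n => η (‖x‖ ^ 2)) ((deriv η (‖x‖ ^ 2) * 2) • innerSL ℝ x) x := by
  have h1 : HasFDerivAt (fun x : Rn n => ‖x‖ ^ 2) (2 • innerSL ℝ x) x :=
    (hasStrictFDerivAt_norm_sq x).hasFDerivAt
  have h2 := ((hη.differentiable (by simp) (‖x‖ ^ 2)).hasDerivAt).comp_hasFDerivAt x h1
  refine h2.congr_fderiv ?_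
  rw [mul_smul]
  congr 1
  ext v
  simp

lemma sum_pderiv_mul {g : Rn n → ℂ} (x : Rn n) :
    ∑ i, (x i : ℂ) * pderiv i g x = fderiv ℝ g x x := by
  conv_rhs => rw [← sum_smul_stdVec x, map_sum]
  rw [sum_smul_stdVec x]
  simp [pderiv]

/-- The divergence of the field `ρ (w ∇g - g ∇w)`, for `ρ` radial and `g`, `w` homogeneous of
degree `0`. -/
lemma sum_fderiv_green {g w : Rn n → ℂ} (hg : IsConic g) (hw : IsConic w) {η : ℝ → ℝ}
    (hη : ContDiff ℝ ∞ η) {x : Rn n} (hx : x ≠ 0) :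
    ∑ i, fderiv ℝ (fun z => (η (‖z‖ ^ 2) : ℂ) * (w z * pderiv i g z - g z * pderiv i w z)) x
      (stdVec i) =
    (η (‖x‖ ^ 2) : ℂ) * (w x * Laplacian.laplacian g x - g x * Laplacian.laplacian w x) := by
  have ho : IsOpen ({0}ᶜ : Set (Rn n)) := isOpen_compl_singleton
  have hd : ∀ {h : Rn n → ℂ}, ContDiffOn ℝ ∞ h {0}ᶜ → HasFDerivAt h (fderiv ℝ h x) x :=
    fun hh => ((hh.contDiffAt (ho.mem_nhds hx)).differentiableAt (by simp)).hasFDerivAt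
  have hρ : HasFDerivAt (fun x : Rn n => (η (‖x‖ ^ 2) : ℂ)) _ x :=
    Complex.ofRealCLM.hasFDerivAt.comp x (hasFDerivAt_radial hη x)
  -- The last term comes from differentiating the radial factor, whose gradient is parallel to `x`.
  -- Summed over `i` it contains only `x·∇g` and `x·∇w`, which vanish by Euler's relation.
  have key : ∀ i, fderiv ℝ (fun z => (η (‖z‖ ^ 2) : ℂ) *
      (w z * pderiv i g z - g z * pderiv i w z)) x (stdVec i) =
      (η (‖x‖ ^ 2) : ℂ) * (w x * pderiv i (pderiv i g) x - g x * pderiv i (pderiv i w) x)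
      + (deriv η (‖x‖ ^ 2) * 2 : ℝ) * (w x * (x i * pderiv i g x) - g x * (x i * pderiv i w x)) := by
    intro i
    have h1 := hρ.mul (((hd hw.contDiffOn).mul (hd (contDiffOn_pderiv ho hg.contDiffOn i))).sub
      ((hd hg.contDiffOn).mul (hd (contDiffOn_pderiv ho hw.contDiffOn i))))
    have e := h1.fderiv
    rw [show (fun z => (η (‖z‖ ^ 2) : ℂ) * (w z * pderiv i g z - g z * pderiv i w z)) =
      ((fun x : Rn n => (η (‖x‖ ^ 2) : ℂ)) * (w * pderiv i g - g * pderiv i w)) from rfl, e]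
    simp only [_root_.add_apply, _root_.smul_apply,
      _root_.sub_apply, ContinuousLinearMap.comp_apply, innerSL_apply_apply,
      inner_stdVec, smul_eq_mul, Pi.sub_apply, Pi.mul_apply, Complex.ofRealCLM_apply]
    change _ = (η (‖x‖ ^ 2) : ℂ) * (w x * fderiv ℝ (pderiv i g) x (stdVec i)
      - g x * fderiv ℝ (pderiv i w) x (stdVec i)) + _
    simp only [pderiv]
    push_cast
    ring
  rw [Finset.sum_congr rfl fun i _ => key i, Finset.sum_add_distrib, ← Finset.mul_sum,
    ← Finset.mul_sum, Finset.sum_sub_distrib, Finset.sum_sub_distrib, ← Finset.mul_sum,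
    ← Finset.mul_sum, ← Finset.mul_sum, ← Finset.mul_sum, sum_pderiv_mul, sum_pderiv_mul,
    hg.fderiv_self hx, hw.fderiv_self hx, ← laplacian_eq_sum_pderiv (hg.contDiffAt hx),
    ← laplacian_eq_sum_pderiv (hw.contDiffAt hx)]
  simp

/-- The Laplacian is symmetric on the sphere. -/
theorem integral_sphere_laplacian [Nontrivial (Rn n)] {g w : Rn n → ℂ} (hg : IsConic g)
    (hw : IsConic w) :
    ∫ u : Sph n, (w u * Laplacian.laplacian g (u : Rn n) - g u * Laplacian.laplacian w (u : Rn n))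
      ∂(volume : Measure (Rn n)).toSphere = 0 := by
  obtain ⟨β, hβ, hβ0, hβ1, hβs, hβl⟩ := exists_radial_profile
  -- The factor `t = |x|²` cancels the degree `-2` of the Laplacians, so that the divergence is an
  -- angular function times `β(r²)`.
  set η : ℝ → ℝ := fun t => t * β t with hη
  have hηs : ContDiff ℝ ∞ η := contDiff_id.mul hβ
  set V : Fin n → Rn n → ℂ := fun i z =>
    (η (‖z‖ ^ 2) : ℂ) * (w z * pderiv i g z - g z * pderiv i w z) with hV
  have hn2 : Continuous fun z : Rn n => ‖z‖ ^ 2 := by fun_prop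
  have hzero : ∀ᶠ z : Rn n in 𝓝 0, ‖z‖ ^ 2 < 1 / 2 :=
    hn2.continuousAt.eventually (gt_mem_nhds (by simp))
  have hVz : ∀ i, V i =ᶠ[𝓝 0] fun _ => 0 := fun i => by
    filter_upwards [hzero] with z hz
    simp [hV, hη, hβs _ hz]
  have hsupp : ∀ z : Rn n, 2 < ‖z‖ → 2 < ‖z‖ ^ 2 := fun z hz => by nlinarith
  have hVc : ∀ i, HasCompactSupport (V i) := fun i => by
    refine HasCompactSupport.intro (isCompact_closedBall (0 : Rn n) 2) fun z hz => ?_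
    rw [mem_closedBall_zero_iff, not_le] at hz
    simp [hV, hη, hβl _ (hsupp z hz)]
  have ho : IsOpen ({0}ᶜ : Set (Rn n)) := isOpen_compl_singleton
  have hVs : ∀ i, ContDiff ℝ 1 (V i) := fun i => by
    rw [contDiff_iff_contDiffAt]
    intro z
    rcases eq_or_ne z 0 with rfl | hz
    · exact contDiffAt_const.congr_of_eventuallyEq (hVz i)
    · have h1 : ContDiffOn ℝ ∞ (V i) {0}ᶜ :=
        ((Complex.ofRealCLM.contDiff.comp (hηs.comp (contDiff_norm_sq ℝ))).contDiffOn).mul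
          ((hw.contDiffOn.mul (contDiffOn_pderiv ho hg.contDiffOn i)).sub
            (hg.contDiffOn.mul (contDiffOn_pderiv ho hw.contDiffOn i)))
      exact (h1.contDiffAt (ho.mem_nhds hz)).of_le (by norm_cast)
  set Θ : Rn n → ℂ := fun x =>
    (η (‖x‖ ^ 2) : ℂ) * (w x * Laplacian.laplacian g x - g x * Laplacian.laplacian w x) with hΘ
  have hsum : ∀ x, ∑ i, fderiv ℝ (V i) x (stdVec i) = Θ x := fun x => by
    rcases eq_or_ne x 0 with rfl | hx
    · rw [Finset.sum_eq_zero fun i _ => by rw [(hVz i).fderiv_eq]; simp]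
      simp [hΘ, hη]
    · exact sum_fderiv_green hg hw hηs hx
  have hint : ∫ x, Θ x = 0 := by
    simp only [← hsum]
    rw [integral_finsetSum]
    · exact Finset.sum_eq_zero fun i _ => integral_fderiv_eq_zero (hVs i) (hVc i) _
    · intro i _
      exact (((hVs i).continuous_fderiv (by simp)).clm_apply
        continuous_const).integrable_of_hasCompactSupport ((hVc i).fderiv_apply ℝ _)
  have hun : ∀ u : Sph n, (u : Rn n) ≠ 0 := fun u h => by
    simpa [h] using norm_sph u
  have hnr : ∀ r : ℝ, 0 < r → ∀ u : Sph n, ‖r • (u : Rn n)‖ = r := fun r hr u => by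
    rw [norm_smul, norm_sph, mul_one, Real.norm_of_nonneg hr.le]
  have hpol := integral_polar Θ (fun r => (β (r ^ 2) : ℂ))
    (fun u : Sph n => w u * Laplacian.laplacian g (u : Rn n)
      - g u * Laplacian.laplacian w (u : Rn n)) fun r hr u => by
    simp only [hΘ, hη]
    rw [hnr r hr u, hg.laplacian_smul hr (hun u), hw.laplacian_smul hr (hun u),
      hg.homogeneous r hr, hw.homogeneous r hr]
    have hr' : (r : ℂ) ≠ 0 := by exact_mod_cast hr.ne'
    simp only [Complex.real_smul]
    push_cast
    field_simp
  -- The same radial integral occurs in `∫ β(|x|²) dx > 0`, hence is nonzero. The vanishing of the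
  -- integral of a divergence therefore forces the spherical factor to vanish.
  have hpol1 := integral_polar (fun x : Rn n => (β (‖x‖ ^ 2) : ℂ)) (fun r => (β (r ^ 2) : ℂ))
    (fun _ : Sph n => 1) fun r hr u => by rw [hnr r hr u, one_mul]
  have hpos : 0 < ∫ x : Rn n, β (‖x‖ ^ 2) := by
    have hc : Continuous fun x : Rn n => β (‖x‖ ^ 2) := hβ.continuous.comp hn2
    obtain ⟨x, hx⟩ := exists_norm_eq (Rn n) zero_le_one
    refine hc.integral_pos_of_hasCompactSupport_nonneg_nonzero ?_ (fun x => hβ0 _) (x := x) ?_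
    · refine HasCompactSupport.intro (isCompact_closedBall (0 : Rn n) 2) fun z hz => ?_
      rw [mem_closedBall_zero_iff, not_le] at hz
      exact hβl _ (hsupp z hz)
    · rw [hx, one_pow]
      exact hβ1.ne'
  rw [integral_complex_ofReal] at hpol1
  rw [hint] at hpol
  refine (mul_eq_zero.1 hpol.symm).resolve_right fun h0 => ?_
  rw [h0, mul_zero] at hpol1
  exact hpos.ne' (by exact_mod_cast hpol1)

end

noncomputable section

/-! ### The Lizorkin space on the line -/

/-- Multiplication by the variable on `𝒮(ℝ)`. -/
def mulVar (ψ : 𝓢(ℝ, ℂ)) : 𝓢(ℝ, ℂ) := SchwartzMap.smulLeftCLM ℂ (fun t : ℝ => t) ψ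

@[simp]
lemma mulVar_apply (ψ : 𝓢(ℝ, ℂ)) (t : ℝ) : mulVar ψ t = t * ψ t := by
  rw [mulVar, SchwartzMap.smulLeftCLM_apply_apply Function.HasTemperateGrowth.id']
  exact Complex.real_smul

lemma mulVar_mem {ψ : 𝓢(ℝ, ℂ)} (hψ : ψ ∈ lizorkinReal) : mulVar ψ ∈ lizorkinReal := by
  intro m
  have := hψ (m + 1)
  refine Eq.trans (integral_congr_ae (Eventually.of_forall fun t => ?_)) this
  simp only [mulVar_apply]
  push_cast
  ring

lemma integrable_pow_abs_mul_norm (ψ : 𝓢(ℝ, ℂ)) (k : ℕ) : Integrable fun s : ℝ => |s| ^ k * ‖ψ s‖ :=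
  ψ.integrable_pow_mul volume k

lemma integral_Iic_eq_neg {ψ : 𝓢(ℝ, ℂ)} (h0 : ∫ s, ψ s = 0) (t : ℝ) :
    ∫ s in Iic t, ψ s = -∫ s in Ioi t, ψ s := by
  have := intervalIntegral.integral_Iic_add_Ioi (b := t) ψ.integrable.integrableOn
    ψ.integrable.integrableOn (μ := volume)
  rw [h0] at this
  exact eq_neg_of_add_eq_zero_left this

/-- On a half-line leading from `t` away from the origin one has `|t| ≤ |s|`. For `t ≥ 0` this is
the right half-line, to which the vanishing mean transfers the integral. -/
lemma pow_mul_norm_integral_Iic_le {ψ : 𝓢(ℝ, ℂ)} (h0 : ∫ s, ψ s = 0) (k : ℕ) (t : ℝ) :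
    |t| ^ k * ‖∫ s in Iic t, ψ s‖ ≤ ∫ s, |s| ^ k * ‖ψ s‖ := by
  have key : ∀ S : Set ℝ, MeasurableSet S → (∀ s ∈ S, |t| ≤ |s|) →
      |t| ^ k * ‖∫ s in S, ψ s‖ ≤ ∫ s, |s| ^ k * ‖ψ s‖ := by
    intro S hS hs
    calc |t| ^ k * ‖∫ s in S, ψ s‖ ≤ |t| ^ k * ∫ s in S, ‖ψ s‖ := by
          gcongr
          exact norm_integral_le_integral_norm _
      _ = ∫ s in S, |t| ^ k * ‖ψ s‖ := (integral_const_mul _ _).symm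
      _ ≤ ∫ s in S, |s| ^ k * ‖ψ s‖ := by
          refine setIntegral_mono_on (ψ.integrable.norm.const_mul _).integrableOn
            (integrable_pow_abs_mul_norm ψ k).integrableOn hS fun s hs' => ?_
          exact mul_le_mul_of_nonneg_right (pow_le_pow_left₀ (abs_nonneg _) (hs s hs') k)
            (norm_nonneg _)
      _ ≤ _ := setIntegral_le_integral (integrable_pow_abs_mul_norm ψ k)
          (Eventually.of_forall fun s => by positivity)
  rcases le_total t 0 with ht | ht
  · refine key _ measurableSet_Iic fun s hs => ?_
    rw [abs_of_nonpos ht, abs_of_nonpos (le_trans hs ht)]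
    exact neg_le_neg hs
  · rw [integral_Iic_eq_neg h0, norm_neg]
    refine key _ measurableSet_Ioi fun s hs => ?_
    rw [abs_of_nonneg ht, abs_of_nonneg (ht.trans (le_of_lt hs))]
    exact le_of_lt hs

lemma exists_antideriv_schwartz {ψ : 𝓢(ℝ, ℂ)} (h0 : ∫ s, ψ s = 0) :
    ∃ θ : 𝓢(ℝ, ℂ), ∀ t, HasDerivAt θ (ψ t) t := by
  set F : ℝ → ℂ := fun t => ∫ s in Iic t, ψ s with hF
  have hd : ∀ t, HasDerivAt F (ψ t) t := by
    intro t
    have h1 : HasDerivAt (fun t => F 0 + ∫ s in (0 : ℝ)..t, ψ s) (ψ t) t :=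
      (intervalIntegral.integral_hasDerivAt_right (ψ.continuous.intervalIntegrable _ _)
        (ψ.continuous.stronglyMeasurableAtFilter _ _) ψ.continuous.continuousAt).const_add _
    have e : F = fun t => F 0 + ∫ s in (0 : ℝ)..t, ψ s := by
      ext t
      rw [← intervalIntegral.integral_Iic_sub_Iic ψ.integrable.integrableOn
        ψ.integrable.integrableOn]
      simp [hF]
    rwa [← e] at h1
  have hder : deriv F = ψ := funext fun t => (hd t).deriv
  have hs : ContDiff ℝ ∞ F :=
    contDiff_infty_iff_deriv.2 ⟨fun t => (hd t).differentiableAt, by rw [hder]; exact ψ.smooth ⊤⟩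
  refine ⟨⟨F, hs, fun k n => ?_⟩, hd⟩
  cases n with
  | zero =>
    refine ⟨∫ s, |s| ^ k * ‖ψ s‖, fun t => ?_⟩
    rw [norm_iteratedFDeriv_zero, Real.norm_eq_abs]
    exact pow_mul_norm_integral_Iic_le h0 k t
  | succ n =>
    obtain ⟨C, hC⟩ := ψ.decay k n
    refine ⟨C, fun t => ?_⟩
    rw [norm_iteratedFDeriv_eq_norm_iteratedDeriv, iteratedDeriv_succ', hder,
      ← norm_iteratedFDeriv_eq_norm_iteratedDeriv]
    exact hC.2 t

/-- Integration by parts makes the `m`-th moment of `θ` a multiple of the `(m+1)`-st moment of `ψ`.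
Vanishing of all moments is thus what permits repeated antiderivatives. -/
lemma exists_antideriv {ψ : 𝓢(ℝ, ℂ)} (hψ : ψ ∈ lizorkinReal) :
    ∃ θ ∈ lizorkinReal, ∀ t, HasDerivAt θ (ψ t) t := by
  obtain ⟨θ, hθ⟩ := exists_antideriv_schwartz (ψ := ψ) (by simpa using hψ 0)
  refine ⟨θ, fun m => ?_, hθ⟩
  have hu : ∀ x : ℝ, HasDerivAt (fun x : ℝ => ((x ^ (m + 1) : ℝ) : ℂ)) (((m + 1) * x ^ m : ℝ) : ℂ) x :=
    fun x => by simpa using (hasDerivAt_pow (m + 1) x).ofReal_comp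
  have h := integral_mul_deriv_eq_deriv_mul_of_integrable (fun x _ => hu x) (fun x _ => hθ x)
    (integrable_pow_mul_real (m + 1) ψ)
    (by
      refine ((integrable_pow_mul_real m θ).const_mul ((m : ℂ) + 1)).congr
        (Eventually.of_forall fun x => ?_)
      simp only [Pi.mul_apply]
      push_cast
      ring) (integrable_pow_mul_real (m + 1) θ)
  rw [hψ (m + 1)] at h
  have e : ∀ x : ℝ, (((m + 1) * x ^ m : ℝ) : ℂ) * θ x
      = ((m : ℂ) + 1) * (((x ^ m : ℝ) : ℂ) * θ x) := fun x => by
    push_cast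
    ring
  simp only [e, integral_const_mul] at h
  have h1 := neg_eq_zero.1 h.symm
  refine (mul_eq_zero.1 h1).resolve_left ?_
  exact_mod_cast m.succ_ne_zero

/-! ### Rapidly decreasing functions with bounded derivatives -/

section Landau

variable {E F : Type*} [NormedAddCommGroup E] [NormedSpace ℝ E] [NormedAddCommGroup F]
  [NormedSpace ℝ F]

/-- Landau's inequality: a rapidly decreasing function with Lipschitz derivative has a rapidly
decreasing derivative. -/
lemma exists_bound_fderiv {g : E → F} (hg : Differentiable ℝ g) {M : ℝ}
    (hM' : ∀ x y v, ‖fderiv ℝ g x v - fderiv ℝ g y v‖ ≤ M * ‖x - y‖ * ‖v‖)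
    (hdec : ∀ k : ℕ, ∃ C, ∀ x, (1 + ‖x‖) ^ k * ‖g x‖ ≤ C) (k : ℕ) :
    ∃ C, ∀ x, (1 + ‖x‖) ^ k * ‖fderiv ℝ g x‖ ≤ C := by
  have hM : ∀ x y, ‖fderiv ℝ g x - fderiv ℝ g y‖ ≤ |M| * ‖x - y‖ := fun x y =>
    ContinuousLinearMap.opNorm_le_bound _ (by positivity) fun v => by
      refine (hM' x y v).trans ?_
      gcongr
      exact le_abs_self M
  obtain ⟨A, hA⟩ := hdec (2 * k)
  have hA0 : 0 ≤ A := le_trans (by positivity) (hA 0)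
  refine ⟨4 ^ k * A + A + |M|, fun x => ?_⟩
  set R := (1 + ‖x‖) ^ k with hR
  have hR1 : 1 ≤ R := one_le_pow₀ (by linarith [norm_nonneg x])
  have hR0 : 0 < R := by linarith
  rw [mul_comm, ← le_div_iff₀ hR0]
  refine ContinuousLinearMap.opNorm_le_of_unit_norm (by positivity) fun v hv => ?_
  rw [le_div_iff₀ hR0, mul_comm]
  -- A difference quotient with step `t = (1 + |x|)^{-k}` has error at most `|M| t`. Dividing by `t`
  -- costs one further power `R`, which is why decay of order `2k` of `g` is used. The factor `4^k`
  -- in the constant comes from `1 + |x| ≤ 2(1 + |x + tv|)`.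
  set t := R⁻¹ with ht
  have ht0 : 0 < t := inv_pos.2 hR0
  have ht1 : t ≤ 1 := inv_le_one_of_one_le₀ hR1
  have hnt : ‖t • v‖ = t := by rw [norm_smul, hv, mul_one, Real.norm_of_nonneg ht0.le]
  have h1 : ‖g (x + t • v) - g x - fderiv ℝ g x (x + t • v - x)‖ ≤ |M| * t * ‖x + t • v - x‖ := by
    refine (convex_closedBall x t).norm_image_sub_le_of_norm_fderiv_le' (𝕜 := ℝ)
      (fun z _ => hg z) (fun z hz => ?_) (Metric.mem_closedBall_self ht0.le) ?_
    · refine (hM z x).trans ?_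
      rw [mem_closedBall_iff_norm] at hz
      exact mul_le_mul_of_nonneg_left hz (abs_nonneg _)
    · rw [mem_closedBall_iff_norm, add_sub_cancel_left, hnt]
  rw [add_sub_cancel_left, hnt, map_smul] at h1
  have h2 : t * ‖fderiv ℝ g x v‖ ≤ ‖g (x + t • v)‖ + ‖g x‖ + |M| * t * t := by
    calc t * ‖fderiv ℝ g x v‖ = ‖t • fderiv ℝ g x v‖ := by
          rw [norm_smul, Real.norm_of_nonneg ht0.le]
      _ = ‖(g (x + t • v) - g x) - (g (x + t • v) - g x - t • fderiv ℝ g x v)‖ := by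
          congr 1; abel
      _ ≤ ‖g (x + t • v) - g x‖ + ‖g (x + t • v) - g x - t • fderiv ℝ g x v‖ := norm_sub_le _ _
      _ ≤ _ := add_le_add (norm_sub_le _ _) h1
  have h3 : R ^ 2 * ‖g x‖ ≤ A := by
    rw [hR, ← pow_mul, mul_comm k]
    exact hA x
  have h4 : R ^ 2 * ‖g (x + t • v)‖ ≤ 4 ^ k * A := by
    have h5 : 1 + ‖x‖ ≤ 2 * (1 + ‖x + t • v‖) := by
      have : ‖x‖ ≤ ‖x + t • v‖ + ‖t • v‖ := by
        simpa using norm_sub_le (x + t • v) (t • v)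
      have := norm_nonneg (x + t • v)
      linarith
    calc R ^ 2 * ‖g (x + t • v)‖ = (1 + ‖x‖) ^ (2 * k) * ‖g (x + t • v)‖ := by
          rw [hR, ← pow_mul, mul_comm k]
      _ ≤ (2 * (1 + ‖x + t • v‖)) ^ (2 * k) * ‖g (x + t • v)‖ := by gcongr
      _ = 4 ^ k * ((1 + ‖x + t • v‖) ^ (2 * k) * ‖g (x + t • v)‖) := by
          rw [mul_pow, pow_mul 2 2 k]
          norm_num
          ring
      _ ≤ _ := by gcongr; exact hA _
  have hRt : R * t = 1 := mul_inv_cancel₀ hR0.ne'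
  calc R * ‖fderiv ℝ g x v‖ = R ^ 2 * (t * ‖fderiv ℝ g x v‖) := by
        rw [sq, mul_assoc, ← mul_assoc R t, hRt, one_mul]
    _ ≤ R ^ 2 * (‖g (x + t • v)‖ + ‖g x‖ + |M| * t * t) := by gcongr
    _ = R ^ 2 * ‖g (x + t • v)‖ + R ^ 2 * ‖g x‖ + |M| * ((R * t) * (R * t)) := by ring
    _ ≤ _ := by rw [hRt]; linarith

lemma HasBoundedDerivs.exists_bound {f : E → F} (hf : HasBoundedDerivs f)
    (hdec : ∀ k : ℕ, ∃ C, ∀ x, (1 + ‖x‖) ^ k * ‖f x‖ ≤ C) (n : ℕ) :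
    ∀ k : ℕ, ∃ C, ∀ x, (1 + ‖x‖) ^ k * ‖iteratedFDeriv ℝ n f x‖ ≤ C := by
  have hdiff : ∀ m : ℕ, Differentiable ℝ (iteratedFDeriv ℝ m f) := fun m =>
    hf.contDiff.differentiable_iteratedFDeriv (by exact_mod_cast WithTop.coe_lt_top m)
  induction n with
  | zero => simpa using hdec
  | succ n ih =>
    -- Boundedness of the derivative of order `n + 2` is the Lipschitz condition that Landau's
    -- inequality needs to pass from order `n` to `n + 1`.
    obtain ⟨M, hM⟩ := hf.bounded (n + 2)
    intro k
    have hlip : ∀ x y, ‖iteratedFDeriv ℝ (n + 1) f x - iteratedFDeriv ℝ (n + 1) f y‖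
        ≤ M * ‖x - y‖ := fun x y => by
      refine convex_univ.norm_image_sub_le_of_norm_fderiv_le (𝕜 := ℝ)
        (fun z _ => hdiff (n + 1) z) (fun z _ => ?_) (mem_univ y) (mem_univ x)
      rw [norm_fderiv_iteratedFDeriv]
      exact hM z
    have hlip' : ∀ x y v, ‖fderiv ℝ (iteratedFDeriv ℝ n f) x v -
        fderiv ℝ (iteratedFDeriv ℝ n f) y v‖ ≤ M * ‖x - y‖ * ‖v‖ := fun x y v => by
      have hM0 : 0 ≤ M := (norm_nonneg _).trans (hM 0)
      refine ContinuousMultilinearMap.opNorm_le_bound (by positivity) fun m => ?_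
      have h1 := (iteratedFDeriv ℝ (n + 1) f x - iteratedFDeriv ℝ (n + 1) f y).le_opNorm
        (Fin.cons v m)
      rw [Fin.prod_univ_succ, Fin.cons_zero, _root_.sub_apply,
        iteratedFDeriv_succ_apply_left, iteratedFDeriv_succ_apply_left] at h1
      simp only [Fin.cons_succ, Fin.cons_zero, Fin.tail_cons, ← mul_assoc] at h1
      rw [_root_.sub_apply]
      refine h1.trans ?_
      gcongr
      exact hlip x y
    obtain ⟨C, hC⟩ := exists_bound_fderiv (hdiff n) hlip' ih k
    refine ⟨C, fun x => ?_⟩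
    rw [← norm_fderiv_iteratedFDeriv]
    exact hC x

/-- A rapidly decreasing function with bounded derivatives, as a Schwartz function. -/
def HasBoundedDerivs.toSchwartz {f : E → F} (hf : HasBoundedDerivs f)
    (hdec : ∀ k : ℕ, ∃ C, ∀ x, (1 + ‖x‖) ^ k * ‖f x‖ ≤ C) : 𝓢(E, F) where
  toFun := f
  smooth' := hf.contDiff
  decay' k n := by
    obtain ⟨C, hC⟩ := hf.exists_bound hdec n k
    refine ⟨C, fun x => le_trans ?_ (hC x)⟩
    gcongr
    linarith

end Landau

end

noncomputable section

/-! ### The Laplace–Beltrami operator on plane waves -/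

variable {n : ℕ}

/-- The function `z ↦ h(⟨x, z/|z|⟩)`. -/
def planeWave (h : ℝ → ℂ) (x z : Rn n) : ℂ := h (inner ℝ x z * ‖z‖⁻¹)

lemma hasFDerivAt_inv_norm {z : Rn n} (hz : z ≠ 0) :
    HasFDerivAt (fun z : Rn n => ‖z‖⁻¹) ((-(‖z‖⁻¹) ^ 3) • innerSL ℝ z) z := by
  have h0 : ‖z‖ ≠ 0 := norm_ne_zero_iff.2 hz
  have h1 : HasFDerivAt (fun z : Rn n => ‖z‖ ^ 2) (2 • innerSL ℝ z) z :=
    (hasStrictFDerivAt_norm_sq z).hasFDerivAt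
  have h2 : HasDerivAt (fun t : ℝ => (√t)⁻¹) (-(1 / (2 * √(‖z‖ ^ 2))) / (√(‖z‖ ^ 2)) ^ 2) (‖z‖ ^ 2) :=
    (Real.hasDerivAt_sqrt (pow_ne_zero 2 h0)).inv (by simpa using h0)
  have h3 := h2.comp_hasFDerivAt z h1
  have e : (fun t : ℝ => (√t)⁻¹) ∘ (fun z : Rn n => ‖z‖ ^ 2) = fun z : Rn n => ‖z‖⁻¹ := by
    ext z
    simp
  rw [e] at h3
  refine h3.congr_fderiv ?_
  ext v
  simp only [_root_.smul_apply, innerSL_apply_apply, smul_eq_mul, nsmul_eq_mul,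
    Real.sqrt_sq (norm_nonneg z), Nat.cast_ofNat]
  field_simp

lemma isConic_planeWave {h : ℝ → ℂ} (hh : ContDiff ℝ ∞ h) (x : Rn n) : IsConic (planeWave h x) := by
  refine ⟨hh.comp_contDiffOn ?_, fun r hr z => ?_⟩
  · refine (contDiff_const.inner ℝ contDiff_id).contDiffOn.mul (ContDiffOn.inv ?_ ?_)
    · exact contDiff_id.contDiffOn.norm ℝ fun z hz => hz
    · exact fun z hz => norm_ne_zero_iff.2 hz
  · rw [planeWave, planeWave, norm_smul, inner_smul_right, Real.norm_of_nonneg hr.le, mul_inv]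
    congr 1
    field_simp

lemma hasFDerivAt_phase (x : Rn n) {z : Rn n} (hz : z ≠ 0) :
    HasFDerivAt (fun z : Rn n => inner ℝ x z * ‖z‖⁻¹)
      (inner ℝ x z • ((-(‖z‖⁻¹) ^ 3) • innerSL ℝ z) + ‖z‖⁻¹ • innerSL ℝ x) z :=
  (innerSL ℝ x).hasFDerivAt.mul (hasFDerivAt_inv_norm hz)

lemma hasFDerivAt_comp_phase {h : ℝ → ℂ} (hh : ContDiff ℝ ∞ h) (x : Rn n) {z : Rn n} (hz : z ≠ 0) :
    HasFDerivAt (planeWave h x) ((fderiv ℝ h (inner ℝ x z * ‖z‖⁻¹)).comp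
      (inner ℝ x z • ((-(‖z‖⁻¹) ^ 3) • innerSL ℝ z) + ‖z‖⁻¹ • innerSL ℝ x)) z :=
  (hh.differentiable (by simp) _).hasFDerivAt.comp z (hasFDerivAt_phase x hz)

lemma pderiv_planeWave {h : ℝ → ℂ} (hh : ContDiff ℝ ∞ h) (x : Rn n) {z : Rn n} (hz : z ≠ 0)
    (i : Fin n) : pderiv i (planeWave h x) z =
      ((x i * ‖z‖⁻¹ - inner ℝ x z * z i * (‖z‖⁻¹) ^ 3 : ℝ) : ℂ) * planeWave (deriv h) x z := by
  rw [pderiv, (hasFDerivAt_comp_phase hh x hz).fderiv]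
  simp only [ContinuousLinearMap.comp_apply, _root_.add_apply, _root_.smul_apply,
    innerSL_apply_apply, inner_stdVec, smul_eq_mul, planeWave]
  rw [fderiv_eq_smul_deriv, Complex.real_smul]
  congr 2
  ring

/-- The tangential gradient of `u ↦ x·u` has squared length `|x|² - (x·u)²`, and this function is a
spherical harmonic of eigenvalue `-(n - 1)`. The coefficient `|x|²` of the second derivative is the
source of the decay of syntheses. -/
lemma laplacian_planeWave {h : ℝ → ℂ} (hh : ContDiff ℝ ∞ h) (x : Rn n) {u : Rn n} (hu : ‖u‖ = 1) :
    Laplacian.laplacian (planeWave h x) u =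
      ((‖x‖ ^ 2 - inner ℝ x u ^ 2 : ℝ) : ℂ) * deriv (deriv h) (inner ℝ x u)
        - (((n : ℝ) - 1) * inner ℝ x u : ℝ) * deriv h (inner ℝ x u) := by
  have hu0 : u ≠ 0 := by
    rintro rfl
    simp at hu
  have hh' : ContDiff ℝ ∞ (deriv h) := (contDiff_infty_iff_deriv.1 hh).2
  rw [laplacian_eq_sum_pderiv ((isConic_planeWave hh x).contDiffAt hu0)]
  set P := inner ℝ x u with hP
  have key : ∀ i, pderiv i (pderiv i (planeWave h x)) u =
      ((x i ^ 2 - 2 * P * (x i * u i) + P ^ 2 * (u i) ^ 2 : ℝ) : ℂ) * deriv (deriv h) P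
      + ((-2 * (x i * u i) - P + 3 * P * (u i) ^ 2 : ℝ) : ℂ) * deriv h P := by
    intro i
    have hev : pderiv i (planeWave h x) =ᶠ[𝓝 u] fun z =>
        ((x i * ‖z‖⁻¹ - inner ℝ x z * z i * (‖z‖⁻¹) ^ 3 : ℝ) : ℂ) * planeWave (deriv h) x z := by
      filter_upwards [isOpen_compl_singleton.mem_nhds hu0] with z hz
      exact pderiv_planeWave hh x hz i
    rw [pderiv, hev.fderiv_eq]
    have hN := hasFDerivAt_inv_norm hu0
    have hzi : HasFDerivAt (fun z : Rn n => z i) (innerSL ℝ (stdVec i)) u := by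
      have := (innerSL ℝ (stdVec i : Rn n)).hasFDerivAt (x := u)
      refine this.congr_of_eventuallyEq (Eventually.of_forall fun z => ?_)
      rw [innerSL_apply_apply, real_inner_comm, inner_stdVec]
    have hL : HasFDerivAt (fun z : Rn n => inner ℝ x z) (innerSL ℝ x) u := (innerSL ℝ x).hasFDerivAt
    have h1 := (hN.const_mul (x i)).sub ((hL.mul hzi).mul (hN.pow 3))
    have h2 := (Complex.ofRealCLM.hasFDerivAt.comp u h1).mul (hasFDerivAt_comp_phase hh' x hu0)
    have e := h2.fderiv
    have e2 : (fun z : Rn n => ((x i * ‖z‖⁻¹ - inner ℝ x z * z i * (‖z‖⁻¹) ^ 3 : ℝ) : ℂ) *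
        planeWave (deriv h) x z) = ((Complex.ofRealCLM ∘ ((fun z : Rn n => x i * ‖z‖⁻¹) -
          (((fun z : Rn n => inner ℝ x z) * fun z => z i) * fun z : Rn n => ‖z‖⁻¹ ^ 3))) *
          planeWave (deriv h) x) := rfl
    rw [e2, e]
    simp only [ContinuousLinearMap.comp_apply, _root_.add_apply, _root_.smul_apply,
      _root_.sub_apply, innerSL_apply_apply, inner_stdVec, smul_eq_mul, planeWave, hu, inv_one,
      one_pow, mul_one, one_mul, Pi.mul_apply, Pi.sub_apply, Function.comp,
      Complex.ofRealCLM_apply, ← hP]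
    have hii : (stdVec i : Rn n) i = 1 := by simp [stdVec]
    rw [fderiv_eq_smul_deriv, Complex.real_smul, hii, nsmul_eq_mul]
    push_cast
    ring
  have s1 : ∑ i, x i ^ 2 = ‖x‖ ^ 2 := by
    rw [EuclideanSpace.norm_sq_eq]
    simp
  have s2 : ∑ i, u i ^ 2 = 1 := by
    have := EuclideanSpace.norm_sq_eq u
    rw [hu] at this
    simpa using this.symm
  have s3 : ∑ i, x i * u i = P := by
    rw [hP, PiLp.inner_apply]
    simp [mul_comm]
  rw [Finset.sum_congr rfl fun i _ => key i, Finset.sum_add_distrib, ← Finset.sum_mul,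
    ← Finset.sum_mul, ← Complex.ofReal_sum, ← Complex.ofReal_sum]
  have e1 : ∑ i, (x i ^ 2 - 2 * P * (x i * u i) + P ^ 2 * (u i) ^ 2) = ‖x‖ ^ 2 - P ^ 2 := by
    rw [Finset.sum_add_distrib, Finset.sum_sub_distrib, ← Finset.mul_sum, ← Finset.mul_sum,
      s1, s2, s3]
    ring
  have e2 : ∑ i, (-2 * (x i * u i) - P + 3 * P * (u i) ^ 2) = -(((n : ℝ) - 1) * P) := by
    rw [Finset.sum_add_distrib, Finset.sum_sub_distrib, ← Finset.mul_sum, ← Finset.mul_sum,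
      s2, s3]
    simp
    ring
  rw [e1, e2]
  push_cast
  ring

/-! ### The recursion for `|x|²` times a synthesis -/

lemma isConic_slice {Φ : Y n → ℂ} (h : IsSmooth Φ) (b : ℝ) (a : Ioi (0 : ℝ)) :
    IsConic fun z : Rn n => extend Φ (z, b, (a : ℝ)) := by
  refine ⟨?_, fun r hr z => ?_⟩
  · have h1 : ContDiff ℝ ∞ fun z : Rn n => (z, b, (a : ℝ)) := by fun_prop
    exact ContDiffOn.comp h h1.contDiffOn fun z hz => ⟨hz, a.2⟩
  · by_cases hz : z = 0
    · simp [hz]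
    · have h1 : ((z, b, (a : ℝ)) : Rn n × ℝ × ℝ) ∈ coneSet n := ⟨hz, a.2⟩
      have h2 : ((r • z, b, (a : ℝ)) : Rn n × ℝ × ℝ) ∈ coneSet n := ⟨smul_ne_zero hr.ne' hz, a.2⟩
      rw [extend, extend, dif_pos h1, dif_pos h2]
      congr 2
      ext1
      simp only [norm_smul, Real.norm_of_nonneg hr.le, smul_smul, mul_inv]
      congr 1
      field_simp

lemma deriv_profile {ψ θ : 𝓢(ℝ, ℂ)} (h : ∀ t, HasDerivAt θ (ψ t) t) (b a c : ℝ) :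
    deriv (fun t => (c : ℂ) * θ ((t - b) / a)) =
      fun t => ((c * a⁻¹ : ℝ) : ℂ) * ψ ((t - b) / a) := by
  ext t
  have h1 : HasDerivAt (fun t : ℝ => (t - b) / a) (1 / a) t :=
    ((hasDerivAt_id t).sub_const b).div_const a
  have h2 := ((h ((t - b) / a)).scomp t h1).const_mul (c : ℂ)
  refine h2.deriv.trans ?_
  rw [Complex.real_smul]
  push_cast
  ring

lemma ridgelet_eq_profile (ψ : ℝ → ℂ) (y : Y n) (x : Rn n) :
    ridgelet ψ y x = (((y.2.2 : ℝ)⁻¹ : ℝ) : ℂ) * ψ ((inner ℝ x (y.1 : Rn n) - y.2.1) / y.2.2) := rfl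

instance sFinite_scaleMeasure : SFinite
    (((volume : Measure ℝ).comap ((↑) : Ioi (0 : ℝ) → ℝ)).withDensity
      fun a => ENNReal.ofReal (((a : ℝ) ^ n)⁻¹)) := by
  have : SigmaFinite ((volume : Measure ℝ).comap ((↑) : Ioi (0 : ℝ) → ℝ)) := by
    refine SigmaFinite.of_map _ measurable_subtype_coe.aemeasurable ?_
    rw [map_comap_subtype_coe measurableSet_Ioi]
    infer_instance
  infer_instance

instance sFinite_stdMeasure : SFinite (stdMeasure n) := by
  rw [stdMeasure]
  infer_instance

/-- Green's identity, applied to a ridgelet. -/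
lemma integral_sphere_ridgelet [Nontrivial (Rn n)] {Φ : Y n → ℂ} (hΦ : IsSmooth Φ)
    {ψ θ χ : 𝓢(ℝ, ℂ)} (hθ : ∀ t, HasDerivAt θ (ψ t) t) (hχ : ∀ t, HasDerivAt χ (θ t) t) (x : Rn n)
    (b : ℝ) (a : Ioi (0 : ℝ)) :
    ∫ u : Sph n, (mulA (mulA (lapU Φ)) (u, b, a) * ridgelet χ (u, b, a) x
      - Φ (u, b, a) * (((‖x‖ ^ 2 - inner ℝ x (u : Rn n) ^ 2 : ℝ) : ℂ) * ridgelet ψ (u, b, a) x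
        - ((((n : ℝ) - 1) * inner ℝ x (u : Rn n) * a : ℝ) : ℂ) * ridgelet θ (u, b, a) x))
      ∂(volume : Measure (Rn n)).toSphere = 0 := by
  have ha : (a : ℝ) ≠ 0 := ne_of_gt a.2
  -- The factor `a` makes `H''` the profile of `ψ_{u,b,a}`. Then `H` itself is `a²` times the
  -- profile of the ridgelet of `χ`, whence the two factors `mulA`.
  set H : ℝ → ℂ := fun t => ((a : ℝ) : ℂ) * χ ((t - b) / a) with hH
  have hHs : ContDiff ℝ ∞ H :=
    contDiff_const.mul ((χ.smooth ⊤).comp ((contDiff_id.sub contDiff_const).div_const _))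
  have hH1 : deriv H = fun t => ((1 : ℝ) : ℂ) * θ ((t - b) / a) := by
    rw [hH, deriv_profile hχ, mul_inv_cancel₀ ha]
  have hH2 : deriv (deriv H) = fun t => ((((a : ℝ)⁻¹ : ℝ)) : ℂ) * ψ ((t - b) / a) := by
    rw [hH1, deriv_profile hθ, one_mul]
  have hg := integral_sphere_laplacian (isConic_slice hΦ b a) (isConic_planeWave hHs x)
  rw [← hg]
  refine integral_congr_ae (Eventually.of_forall fun u => ?_)
  have hu := norm_sph u
  beta_reduce
  rw [laplacian_planeWave hHs x hu, hH2, hH1]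
  have e : extend Φ ((u : Rn n), b, (a : ℝ)) = Φ (u, b, a) := extend_coe Φ (u, b, a)
  rw [e]
  change _ = _ * lapU Φ (u, b, a) - _
  have ha' : ((a : ℝ) : ℂ) ≠ 0 := by exact_mod_cast ha
  simp only [planeWave, mulA_apply, ridgelet_eq_profile, hu, inv_one, mul_one, hH]
  push_cast
  field_simp

lemma IsAdmissible.integrable_mul_ridgelet {Φ : Y n → ℂ} (h : IsAdmissible Φ) (ψ : 𝓢(ℝ, ℂ))
    (x : Rn n) : Integrable (fun y => Φ y * ridgelet ψ y x) (stdMeasure n) := by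
  have h1 := (h.isDominatedFamily ψ).integrable 0 x
  refine ((ContinuousMultilinearMap.apply ℝ (fun _ : Fin 0 => Rn n) ℂ 0).integrable_comp h1).congr
    (Eventually.of_forall fun y => ?_)
  simp

/-- The key recursion: multiplication by `|x|²` preserves the class of syntheses, when the ridgelet
has a second antiderivative. -/
lemma IsAdmissible.norm_sq_mul_synthesis [Nontrivial (Rn n)] {Φ : Y n → ℂ} (h : IsAdmissible Φ)
    {ψ θ χ : 𝓢(ℝ, ℂ)} (hθ : ∀ t, HasDerivAt θ (ψ t) t) (hχ : ∀ t, HasDerivAt χ (θ t) t) (x : Rn n) :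
    (‖x‖ ^ 2 : ℝ) * synthesis ψ Φ x =
      synthesis χ (Ridgelet.mulA (Ridgelet.mulA (Ridgelet.lapU Φ))) x
      + (synthesis (mulVar (mulVar ψ)) (Ridgelet.mulA (Ridgelet.mulA Φ)) x
      + (2 * synthesis (mulVar ψ) (Ridgelet.mulA (Ridgelet.mulB Φ)) x
      + (synthesis ψ (Ridgelet.mulB (Ridgelet.mulB Φ)) x
      + ((n : ℂ) - 1) * (synthesis (mulVar θ) (Ridgelet.mulA (Ridgelet.mulA Φ)) x
      + synthesis θ (Ridgelet.mulA (Ridgelet.mulB Φ)) x)))) := by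
  set D : Y n → ℂ := fun y => Ridgelet.mulA (Ridgelet.mulA (Ridgelet.lapU Φ)) y * ridgelet χ y x
      - Φ y * (((‖x‖ ^ 2 - inner ℝ x (y.1 : Rn n) ^ 2 : ℝ) : ℂ) * ridgelet ψ y x
        - ((((n : ℝ) - 1) * inner ℝ x (y.1 : Rn n) * y.2.2 : ℝ) : ℂ) * ridgelet θ y x) with hD
  have i0 := (h.integrable_mul_ridgelet ψ x).const_mul ((‖x‖ ^ 2 : ℝ) : ℂ)
  have i1 := h.lapU.mulA.mulA.integrable_mul_ridgelet χ x
  have i2 := h.mulA.mulA.integrable_mul_ridgelet (mulVar (mulVar ψ)) x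
  have i3 := (h.mulB.mulA.integrable_mul_ridgelet (mulVar ψ) x).const_mul 2
  have i4 := h.mulB.mulB.integrable_mul_ridgelet ψ x
  have i5 := h.mulA.mulA.integrable_mul_ridgelet (mulVar θ) x
  have i6 := h.mulB.mulA.integrable_mul_ridgelet θ x
  -- Here `x·u = a t + b`, with `t` the argument of the profiles. Powers of `t` are absorbed by
  -- `mulVar`, those of `a` and `b` by `mulA` and `mulB`, so that `x` survives only in `|x|²`.
  have hDeq : ∀ y, D y = (Ridgelet.mulA (Ridgelet.mulA (Ridgelet.lapU Φ)) y * ridgelet χ y x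
      + (Ridgelet.mulA (Ridgelet.mulA Φ) y * ridgelet (mulVar (mulVar ψ)) y x
      + (2 * (Ridgelet.mulA (Ridgelet.mulB Φ) y * ridgelet (mulVar ψ) y x)
      + (Ridgelet.mulB (Ridgelet.mulB Φ) y * ridgelet ψ y x
      + ((n : ℂ) - 1) * (Ridgelet.mulA (Ridgelet.mulA Φ) y * ridgelet (mulVar θ) y x
      + Ridgelet.mulA (Ridgelet.mulB Φ) y * ridgelet θ y x)))))
      - ((‖x‖ ^ 2 : ℝ) : ℂ) * (Φ y * ridgelet ψ y x) := fun y => by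
    have ha : ((y.2.2 : ℝ) : ℂ) ≠ 0 := by exact_mod_cast y.pos.ne'
    simp only [hD, ridgelet_eq_profile, mulVar_apply, mulA_apply, mulB_apply]
    push_cast
    field_simp
    ring
  have i56 : Integrable (fun y => ((n : ℂ) - 1) *
      (Ridgelet.mulA (Ridgelet.mulA Φ) y * ridgelet (mulVar θ) y x
      + Ridgelet.mulA (Ridgelet.mulB Φ) y * ridgelet θ y x)) (stdMeasure n) :=
    (i5.add i6).const_mul _
  have hsum := i1.add (i2.add (i3.add (i4.add i56)))
  have hDi : Integrable D (stdMeasure n) := (hsum.sub i0).congr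
    (Eventually.of_forall fun y => (hDeq y).symm)
  have hD0 : ∫ y, D y ∂stdMeasure n = 0 := by
    rw [stdMeasure, integral_prod_symm _ hDi]
    refine integral_eq_zero_of_ae (Eventually.of_forall fun p => ?_)
    exact integral_sphere_ridgelet h.smooth hθ hχ x p.1 p.2
  have e := integral_congr_ae (μ := stdMeasure n) (Eventually.of_forall hDeq)
  rw [hD0] at e
  have e2 := ((integral_sub hsum i0).symm.trans e.symm)
  rw [integral_add' i1 (i2.add (i3.add (i4.add i56))), integral_add' i2 (i3.add (i4.add i56)),
    integral_add' i3 (i4.add i56), integral_add' i4 i56, integral_const_mul, integral_const_mul,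
    integral_const_mul, integral_add i5 i6] at e2
  exact (sub_eq_zero.1 e2).symm

/-- Induction through the recursion, for all `Φ` and `ψ` at once because the recursion changes both.
The profiles it produces are again in `𝒮₀(ℝ)`, and the case `k = 0` is boundedness. -/
lemma IsAdmissible.exists_bound_synthesis [Nontrivial (Rn n)] (k : ℕ) : ∀ {Φ : Y n → ℂ},
    IsAdmissible Φ → ∀ {ψ : 𝓢(ℝ, ℂ)}, ψ ∈ lizorkinReal →
      ∃ C, ∀ x, (‖x‖ ^ 2) ^ k * ‖synthesis ψ Φ x‖ ≤ C := by
  induction k with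
  | zero =>
    intro Φ h ψ _
    obtain ⟨C, hC⟩ := (h.hasBoundedDerivs ψ).bounded 0
    exact ⟨C, fun x => by simpa using hC x⟩
  | succ k ih =>
    intro Φ h ψ hψ
    obtain ⟨θ, hθ, hθd⟩ := exists_antideriv hψ
    obtain ⟨χ, hχ, hχd⟩ := exists_antideriv hθ
    obtain ⟨C1, h1⟩ := ih h.lapU.mulA.mulA hχ
    obtain ⟨C2, h2⟩ := ih h.mulA.mulA (mulVar_mem (mulVar_mem hψ))
    obtain ⟨C3, h3⟩ := ih h.mulB.mulA (mulVar_mem hψ)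
    obtain ⟨C4, h4⟩ := ih h.mulB.mulB hψ
    obtain ⟨C5, h5⟩ := ih h.mulA.mulA (mulVar_mem hθ)
    obtain ⟨C6, h6⟩ := ih h.mulB.mulA hθ
    refine ⟨C1 + (C2 + (2 * C3 + (C4 + ‖(n : ℂ) - 1‖ * (C5 + C6)))), fun x => ?_⟩
    have e := congrArg norm (h.norm_sq_mul_synthesis hθd hχd x)
    rw [norm_mul, Complex.norm_real, Real.norm_of_nonneg (by positivity)] at e
    rw [pow_succ, mul_assoc, e]
    refine (mul_le_mul_of_nonneg_left (norm_add_le_of_le le_rfl (norm_add_le_of_le le_rfl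
      (norm_add_le_of_le (norm_mul _ _).le (norm_add_le_of_le le_rfl
        ((norm_mul _ _).le.trans (mul_le_mul_of_nonneg_left (norm_add_le _ _) (norm_nonneg _)))))))
      (by positivity)).trans ?_
    have h56 := mul_le_mul_of_nonneg_left (add_le_add (h5 x) (h6 x)) (norm_nonneg ((n : ℂ) - 1))
    have h2' : ‖(2 : ℂ)‖ = 2 := by simp
    rw [h2']
    linear_combination h1 x + h2 x + 2 * h3 x + h4 x + h56

lemma IsAdmissible.exists_decay_synthesis [Nontrivial (Rn n)] {Φ : Y n → ℂ} (h : IsAdmissible Φ)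
    {ψ : 𝓢(ℝ, ℂ)} (hψ : ψ ∈ lizorkinReal) (k : ℕ) :
    ∃ C, ∀ x, (1 + ‖x‖) ^ k * ‖synthesis ψ Φ x‖ ≤ C := by
  obtain ⟨C0, h0⟩ := h.exists_bound_synthesis 0 hψ
  obtain ⟨C, hC⟩ := h.exists_bound_synthesis k hψ
  refine ⟨4 ^ k * (C0 + C), fun x => ?_⟩
  have h1 : (1 + ‖x‖) ^ k ≤ 4 ^ k * (1 + (‖x‖ ^ 2) ^ k) := by
    rcases le_total ‖x‖ 1 with hx | hx
    · calc (1 + ‖x‖) ^ k ≤ 4 ^ k := by gcongr; linarith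
        _ ≤ 4 ^ k * (1 + (‖x‖ ^ 2) ^ k) := le_mul_of_one_le_right (by positivity)
            (le_add_of_nonneg_right (by positivity))
    · calc (1 + ‖x‖) ^ k ≤ (4 * ‖x‖ ^ 2) ^ k := by gcongr; nlinarith
        _ = 4 ^ k * (‖x‖ ^ 2) ^ k := mul_pow _ _ _
        _ ≤ _ := by gcongr; linarith
  calc _ ≤ 4 ^ k * (1 + (‖x‖ ^ 2) ^ k) * ‖synthesis ψ Φ x‖ := by gcongr
    _ = 4 ^ k * ((‖x‖ ^ 2) ^ 0 * ‖synthesis ψ Φ x‖ + (‖x‖ ^ 2) ^ k * ‖synthesis ψ Φ x‖) := by ring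
    _ ≤ _ := by gcongr; exacts [h0 x, hC x]

/-- The synthesis as a Schwartz function. -/
def IsAdmissible.synthesisSchwartz [Nontrivial (Rn n)] {Φ : Y n → ℂ} (h : IsAdmissible Φ)
    {ψ : 𝓢(ℝ, ℂ)} (hψ : ψ ∈ lizorkinReal) : 𝓢(Rn n, ℂ) :=
  (h.hasBoundedDerivs ψ).toSchwartz fun k => h.exists_decay_synthesis hψ k

end

noncomputable section

/-! ### Vanishing moments of syntheses -/

open LineDeriv in
lemma laplacian_schwartz {n : ℕ} (g : 𝓢(Rn n, ℂ)) (x : Rn n) :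
    Laplacian.laplacian (g : Rn n → ℂ) x = ∑ i, (∂_{(stdVec i : Rn n)} (∂_{(stdVec i : Rn n)} g)) x := by
  rw [laplacian_eq_sum_pderiv ((g.smooth ⊤).contDiffAt)]
  refine Finset.sum_congr rfl fun i _ => ?_
  rw [SchwartzMap.lineDerivOp_apply_eq_fderiv, pderiv]
  congr 2

variable {n : ℕ}

/-- The monomial `xᵐ`. -/
def monom (m : Fin n → ℕ) (x : Rn n) : ℂ := ((∏ i, x i ^ m i : ℝ) : ℂ)

lemma hasFDerivAt_coord (i : Fin n) (x : Rn n) :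
    HasFDerivAt (fun z : Rn n => z i) (innerSL ℝ (stdVec i)) x := by
  have := (innerSL ℝ (stdVec i : Rn n)).hasFDerivAt (x := x)
  refine this.congr_of_eventuallyEq (Eventually.of_forall fun z => ?_)
  rw [innerSL_apply_apply, real_inner_comm, inner_stdVec]

lemma differentiable_monom (m : Fin n → ℕ) : Differentiable ℝ (monom m) := by
  have h : Differentiable ℝ fun x : Rn n => ∏ i, x i ^ m i := by
    intro x
    exact (HasFDerivAt.finsetProd (u := Finset.univ)
      fun j _ => (hasFDerivAt_coord j x).pow (m j)).differentiableAt
  exact Complex.ofRealCLM.differentiable.comp h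

/-- When `m i = 0` the truncated exponent is harmless, since the coefficient `m i` vanishes. -/
lemma fderiv_monom (m : Fin n → ℕ) (i : Fin n) (x : Rn n) :
    fderiv ℝ (monom m) x (stdVec i) = m i * monom (Function.update m i (m i - 1)) x := by
  have h1 := HasFDerivAt.finsetProd (u := Finset.univ) (x := x)
    fun j _ => (hasFDerivAt_coord j x).pow (m j)
  have h2 := Complex.ofRealCLM.hasFDerivAt.comp x h1
  have e : monom m = ⇑Complex.ofRealCLM ∘ fun x : Rn n => ∏ j, x j ^ m j := rfl
  have hs : ∀ j, (stdVec j : Rn n) i = if j = i then 1 else 0 := fun j => by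
    simp [stdVec, eq_comm]
  have hp : ∏ j ∈ Finset.univ.erase i, x j ^ Function.update m i (m i - 1) j =
      ∏ j ∈ Finset.univ.erase i, x j ^ m j :=
    Finset.prod_congr rfl fun j hj => by rw [Function.update_of_ne (Finset.ne_of_mem_erase hj)]
  rw [e, h2.fderiv]
  simp only [ContinuousLinearMap.comp_apply, sum_apply, _root_.smul_apply,
    innerSL_apply_apply, inner_stdVec, smul_eq_mul, Complex.ofRealCLM_apply, hs]
  rw [Finset.sum_eq_single i (fun j _ hj => by simp [hj]) (fun h => absurd (Finset.mem_univ i) h),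
    monom, ← Finset.mul_prod_erase Finset.univ _ (Finset.mem_univ i), Function.update_self, hp]
  push_cast
  simp
  ring

lemma integrable_monom_mul (m : Fin n → ℕ) (φ : 𝓢(Rn n, ℂ)) :
    Integrable fun x : Rn n => monom m x * φ x := integrable_monomial_mul m φ

open LineDeriv in
lemma integral_monom_lineDeriv (m : Fin n → ℕ) (i : Fin n) (g : 𝓢(Rn n, ℂ)) :
    ∫ x, monom m x * (∂_{(stdVec i : Rn n)} g) x =
      -(m i * ∫ x, monom (Function.update m i (m i - 1)) x * g x) := by
  have h1 := integrable_monom_mul m (∂_{(stdVec i : Rn n)} g)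
  have h2 := (integrable_monom_mul (Function.update m i (m i - 1)) g).const_mul (m i : ℂ)
  simp only [SchwartzMap.lineDerivOp_apply_eq_fderiv] at h1 ⊢
  simp only [← mul_assoc, ← fderiv_monom] at h2
  rw [integral_mul_fderiv_eq_neg_fderiv_mul_of_integrable h2 h1 (integrable_monom_mul m g)
    (fun x _ => differentiable_monom m x) (fun x _ => g.differentiableAt)]
  simp only [fderiv_monom, mul_assoc]
  rw [integral_const_mul]

/-- As `|u| = 1`, the Laplacian takes the ridgelet of `χ` to `a⁻²` times that of `χ'' = ψ`; the
factor `a²` is supplied by `mulA` twice. -/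
lemma IsAdmissible.laplacian_synthesis {Φ : Y n → ℂ} (h : IsAdmissible Φ)
    {ψ θ χ : 𝓢(ℝ, ℂ)} (hθ : ∀ t, HasDerivAt θ (ψ t) t) (hχ : ∀ t, HasDerivAt χ (θ t) t) (x : Rn n) :
    Laplacian.laplacian (synthesis χ (Ridgelet.mulA (Ridgelet.mulA Φ))) x = synthesis ψ Φ x := by
  have h2 := h.mulA.mulA
  have hχ2 : iteratedDeriv 2 χ = ψ := by
    rw [iteratedDeriv_succ, iteratedDeriv_one, funext fun t => (hχ t).deriv]
    exact funext fun t => (hθ t).deriv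
  have hi : Integrable (fun y => Ridgelet.mulA (Ridgelet.mulA Φ) y •
      iteratedFDeriv ℝ 2 (ridgelet χ y) x) (stdMeasure n) :=
    ((h2.isDominatedFamily χ).integrable 2 x).congr (Eventually.of_forall fun y =>
      iteratedFDeriv_mul_ridgelet _ χ y 2 x)
  have hj : ∀ v : Fin 2 → Rn n, Integrable (fun y => (Ridgelet.mulA (Ridgelet.mulA Φ) y •
      iteratedFDeriv ℝ 2 (ridgelet χ y) x) v) (stdMeasure n) := fun v =>
    (ContinuousMultilinearMap.apply ℝ (fun _ : Fin 2 => Rn n) ℂ v).integrable_comp hi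
  rw [InnerProductSpace.laplacian_eq_iteratedFDeriv_orthonormalBasis _
    (EuclideanSpace.basisFun (Fin n) ℝ)]
  simp only [h2.iteratedFDeriv_synthesis, ContinuousMultilinearMap.integral_apply hi]
  rw [← integral_finsetSum _ fun i _ => hj _, synthesis]
  refine integral_congr_ae (Eventually.of_forall fun y => ?_)
  have hs : ∑ i, (((y.1 : Rn n) i : ℝ) : ℂ) ^ 2 = 1 := by
    have := EuclideanSpace.norm_sq_eq (y.1 : Rn n)
    rw [norm_sph] at this
    have h3 : ∑ i, ((y.1 : Rn n) i) ^ 2 = 1 := by simpa using this.symm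
    exact_mod_cast h3
  have ha : ((y.2.2 : ℝ) : ℂ) ≠ 0 := by exact_mod_cast y.pos.ne'
  simp only [iteratedFDeriv_ridgelet (χ.smooth ⊤), hχ2, _root_.smul_apply, dirForm_apply,
    Fin.prod_univ_two, Matrix.cons_val_zero, Matrix.cons_val_one, smul_eq_mul]
  have e : ∀ i, inner ℝ (y.1 : Rn n) ((EuclideanSpace.basisFun (Fin n) ℝ) i) = (y.1 : Rn n) i :=
    inner_stdVec _
  simp only [e, ← pow_two]
  rw [← Finset.mul_sum, ← Finset.mul_sum, hs, mulA_apply, mulA_apply, ridgelet_eq_profile]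
  push_cast
  field_simp

lemma IsAdmissible.integral_monom_mul_synthesis [Nontrivial (Rn n)] (d : ℕ) : ∀ {Φ : Y n → ℂ},
    IsAdmissible Φ → ∀ {ψ : 𝓢(ℝ, ℂ)}, ψ ∈ lizorkinReal → ∀ m : Fin n → ℕ, ∑ i, m i = d →
      ∫ x, monom m x * synthesis ψ Φ x = 0 := by
  induction d using Nat.strong_induction_on with
  | _ d ih =>
    intro Φ h ψ hψ m hm
    obtain ⟨θ, hθ, hθd⟩ := exists_antideriv hψ
    obtain ⟨χ, hχ, hχd⟩ := exists_antideriv hθ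
    set g := h.mulA.mulA.synthesisSchwartz hχ with hg
    have e : ∀ x, synthesis ψ Φ x = Laplacian.laplacian (g : Rn n → ℂ) x := fun x =>
      (h.laplacian_synthesis hθd hχd x).symm
    simp only [e, laplacian_schwartz, Finset.mul_sum]
    rw [integral_finsetSum _ fun i _ => integrable_monom_mul _ _]
    refine Finset.sum_eq_zero fun i _ => ?_
    rw [integral_monom_lineDeriv, integral_monom_lineDeriv]
    by_cases hi : m i = 0
    · simp [hi]
    -- For `m i = 1` the second subtraction is truncated at `0`, but the degree has already dropped,
    -- so the induction hypothesis still applies.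
    · have hlt : ∑ j, Function.update (Function.update m i (m i - 1)) i
          (Function.update m i (m i - 1) i - 1) j < d := by
        rw [← hm]
        refine Finset.sum_lt_sum (fun j _ => ?_) ⟨i, Finset.mem_univ i, ?_⟩
        · by_cases hj : j = i
          · subst hj
            simp only [Function.update_self]
            omega
          · simp [hj]
        · simp only [Function.update_self]
          omega
      have h0 := ih _ hlt h.mulA.mulA hχ _ rfl
      change -(_ * -(_ * ∫ x, _ * synthesis χ _ x)) = 0
      rw [h0]
      simp

lemma IsAdmissible.synthesisSchwartz_mem [Nontrivial (Rn n)] {Φ : Y n → ℂ} (h : IsAdmissible Φ)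
    {ψ : 𝓢(ℝ, ℂ)} (hψ : ψ ∈ lizorkinReal) : h.synthesisSchwartz hψ ∈ lizorkin n := fun m =>
  IsAdmissible.integral_monom_mul_synthesis _ h hψ m rfl

end

noncomputable section

/-! ### Complex conjugation of Schwartz functions -/

/-- The complex conjugate of a Schwartz function. -/
def conjSchwartz (ψ : 𝓢(ℝ, ℂ)) : 𝓢(ℝ, ℂ) :=
  SchwartzMap.postcompCLM (𝕜 := ℝ) (Complex.conjCLE : ℂ →L[ℝ] ℂ) ψ

lemma conjSchwartz_apply (ψ : 𝓢(ℝ, ℂ)) (t : ℝ) : conjSchwartz ψ t = conj (ψ t) := rfl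

lemma conjSchwartz_mem {ψ : 𝓢(ℝ, ℂ)} (hψ : ψ ∈ lizorkinReal) : conjSchwartz ψ ∈ lizorkinReal := by
  intro m
  have h := congrArg conj (hψ m)
  rw [← integral_conj, map_zero] at h
  rw [← h]
  simp only [map_mul, Complex.conj_ofReal, conjSchwartz_apply]

variable {n : ℕ}

lemma conj_ridgelet (ψ : 𝓢(ℝ, ℂ)) (y : Y n) :
    (fun x => conj (ridgelet ψ y x)) = ridgelet (conjSchwartz ψ) y := by
  ext x
  simp only [ridgelet, map_mul, Complex.conj_ofReal, conjSchwartz_apply]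

/-! ### Jets of ridgelets -/

variable {N : ℕ}

lemma continuous_jet_ridgelet (ψ : 𝓢(ℝ, ℂ)) :
    Continuous fun p : Y n × JetSpace n N => jet N (ridgelet ψ p.1) p.2 := by
  -- The discrete order variable is moved to the front, so that continuity can be checked for each
  -- fixed order, where the type of the derivative is constant.
  have h : Continuous fun q : Fin (N + 1) × Y n × Rn n × (Fin N → Metric.closedBall (0 : Rn n) 1) =>
      jet N (ridgelet ψ q.2.1) (q.1, q.2.2) := by
    refine continuous_prod_of_discrete_left.2 fun k => ?_
    have h1 : Continuous fun p : Y n × Rn n × (Fin N → Metric.closedBall (0 : Rn n) 1) =>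
        iteratedFDeriv ℝ k (ridgelet ψ p.1) p.2.1 :=
      (continuous_iteratedFDeriv_ridgelet (ψ.smooth ⊤) k).comp
        (continuous_fst.prodMk (continuous_fst.comp continuous_snd))
    have h2 : Continuous fun p : Y n × Rn n × (Fin N → Metric.closedBall (0 : Rn n) 1) =>
        fun i : Fin k => JetSpace.dirs (k, p.2) i := by
      refine continuous_pi fun i => ?_
      exact continuous_subtype_val.comp
        ((continuous_apply (i.castLE (Nat.lt_succ_iff.1 k.2))).comp
          (continuous_snd.comp continuous_snd))
    exact h1.eval h2
  exact h.comp ((continuous_fst.comp continuous_snd).prodMk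
    (continuous_fst.prodMk (continuous_snd.comp continuous_snd)))

lemma weight_zero_right (s : ℕ) (y : Y n) :
    weight s 0 y = (y.2.2 : ℝ) ^ s + 1 / (y.2.2 : ℝ) ^ s := by
  simp [weight]

lemma inv_pow_le_weight {k : ℕ} (hk : k ≤ N) (y : Y n) :
    (y.2.2 : ℝ)⁻¹ ^ k ≤ weight N 0 y := by
  have ha := y.pos
  rw [weight_zero_right, one_div, ← inv_pow]
  rcases le_total (y.2.2 : ℝ) 1 with h | h
  · have h1 := pow_le_pow_right₀ ((one_le_inv₀ ha).2 h) hk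
    have : 0 ≤ (y.2.2 : ℝ) ^ N := by positivity
    linarith
  · have h1 : (y.2.2 : ℝ)⁻¹ ^ k ≤ 1 := pow_le_one₀ (by positivity) (inv_le_one_of_one_le₀ h)
    have h2 : 1 ≤ (y.2.2 : ℝ) ^ N := one_le_pow₀ h
    have : 0 ≤ (y.2.2 : ℝ)⁻¹ ^ N := by positivity
    linarith

/-- This bound, uniform in the jet variable, yields the slow growth and continuity of `F` and the
integrability behind Fubini. The exponent is `N + 1` because order `k ≤ N` costs `a^{-(k+1)}`. -/
lemma exists_norm_jet_ridgelet_le (ψ : 𝓢(ℝ, ℂ)) :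
    ∃ C, 0 ≤ C ∧ ∀ (y : Y n) (ξ : JetSpace n N),
      ‖jet N (ridgelet ψ y) ξ‖ ≤ weight (N + 1) 0 y * C := by
  refine ⟨∑ k ∈ Finset.range (N + 1), SchwartzMap.seminorm ℝ 0 k ψ,
    Finset.sum_nonneg fun _ _ => apply_nonneg _ _, fun y ξ => ?_⟩
  refine ((norm_jet_le _ ξ).trans (norm_iteratedFDeriv_ridgelet_le ψ y ξ.1 ξ.2.1)).trans ?_
  refine mul_le_mul (inv_pow_le_weight (Nat.succ_le_of_lt ξ.1.2) y) ?_ (apply_nonneg _ _)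
    (weight_nonneg _ _ y)
  exact Finset.single_le_sum (f := fun k => SchwartzMap.seminorm ℝ 0 k ψ)
    (fun k _ => apply_nonneg _ _) (Finset.mem_range.2 ξ.1.2)

lemma IsAdmissible.jet_synthesis {Φ : Y n → ℂ} (h : IsAdmissible Φ) (ψ : 𝓢(ℝ, ℂ))
    (ξ : JetSpace n N) :
    jet N (synthesis ψ Φ) ξ = ∫ y, Φ y * jet N (ridgelet ψ y) ξ ∂stdMeasure n := by
  have hi : Integrable (fun y => Φ y • iteratedFDeriv ℝ ξ.1 (ridgelet ψ y) ξ.2.1) (stdMeasure n) :=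
    ((h.isDominatedFamily ψ).integrable ξ.1 ξ.2.1).congr (Eventually.of_forall fun y =>
      iteratedFDeriv_mul_ridgelet _ ψ y ξ.1 ξ.2.1)
  rw [jet, h.iteratedFDeriv_synthesis, ContinuousMultilinearMap.integral_apply hi]
  rfl

/-! ### The regular distribution -/

variable {f : 𝓢'(Rn n, ℂ)} {μ : Measure (JetSpace n N)} {κ : JetSpace n N → ℂ}

/-- The function `y ↦ ⟨f, ψ_y⟩`, for a distribution `f` with density `κ` with respect to `μ`. -/
def densityTransform (μ : Measure (JetSpace n N)) (κ : JetSpace n N → ℂ) (ψ : 𝓢(ℝ, ℂ))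
    (y : Y n) : ℂ := ∫ ξ, jet N (ridgelet ψ y) ξ * κ ξ ∂μ

lemma IsJetDensity.ridgeletFunction_eq (h : IsJetDensity f μ κ) (ψ : 𝓢(ℝ, ℂ)) :
    ridgeletFunction ψ f = densityTransform μ κ (conjSchwartz ψ) := by
  ext y
  rw [ridgeletFunction, conj_ridgelet]
  exact (h.hasPairing (hasBoundedDerivs_ridgelet _ y)).pairing_eq

lemma exists_norm_densityTransform_le (hκ : Integrable κ μ) (ψ : 𝓢(ℝ, ℂ)) :
    ∃ C, 0 ≤ C ∧ ∀ y : Y n, ‖densityTransform μ κ ψ y‖ ≤ C * weight (N + 1) 0 y := by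
  obtain ⟨C, hC0, hC⟩ := exists_norm_jet_ridgelet_le (n := n) (N := N) ψ
  refine ⟨C * ∫ ξ, ‖κ ξ‖ ∂μ, by positivity, fun y => ?_⟩
  have h1 := norm_integral_le_of_norm_le (hκ.norm.const_mul (weight (N + 1) 0 y * C))
    (f := fun ξ => jet N (ridgelet ψ y) ξ * κ ξ) (Eventually.of_forall fun ξ => by
      rw [norm_mul]
      exact mul_le_mul_of_nonneg_right (hC y ξ) (norm_nonneg _))
  rw [integral_const_mul] at h1
  refine h1.trans_eq ?_
  ring

lemma continuous_densityTransform (hκ : Integrable κ μ) (ψ : 𝓢(ℝ, ℂ)) :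
    Continuous (densityTransform μ κ ψ) := by
  obtain ⟨C, hC0, hC⟩ := exists_norm_jet_ridgelet_le (n := n) (N := N) ψ
  refine continuous_iff_continuousAt.2 fun y₀ => ?_
  refine continuousAt_of_dominated
    -- Near `y₀` the continuous weight stays below its value at `y₀` plus one, which gives a
    -- dominating function independent of `y`.
    (bound := fun ξ => (weight (N + 1) 0 y₀ + 1) * C * ‖κ ξ‖) ?_ ?_ (hκ.norm.const_mul _) ?_
  · refine Eventually.of_forall fun y => ?_
    exact ((continuous_jet_ridgelet ψ).comp (Continuous.prodMk_right y)).aestronglyMeasurable.mul hκ.1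
  · filter_upwards [(continuous_weight (N + 1) 0).continuousAt.eventually_lt
      (continuousAt_const (x := y₀) (y := weight (N + 1) 0 y₀ + 1)) (lt_add_one _)] with y hy
    refine Eventually.of_forall fun ξ => ?_
    rw [norm_mul]
    gcongr
    exact (hC y ξ).trans (by gcongr)
  · refine Eventually.of_forall fun ξ => ?_
    exact (((continuous_jet_ridgelet ψ).comp (Continuous.prodMk_left ξ)).mul
      continuous_const).continuousAt

/-- Near each point both `F` and the weight are bounded, so the truncation of `F` to such a
neighbourhood meets the criterion `integrable_of_weight`. -/
lemma locallyIntegrable_of_continuous {F : Y n → ℂ} (hF : Continuous F) :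
    LocallyIntegrable F (stdMeasure n) := by
  intro y₀
  have h1 := (continuous_weight (n := n) (n + 2) 2).isOpen_preimage _
    (isOpen_Iio (a := weight (n + 2) 2 y₀ + 1))
  have h2 := hF.norm.isOpen_preimage _ (isOpen_Iio (a := ‖F y₀‖ + 1))
  have hU := h1.inter h2
  refine ⟨_, hU.mem_nhds ⟨lt_add_one (weight (n + 2) 2 y₀), lt_add_one ‖F y₀‖⟩, ?_⟩
  rw [← integrable_indicator_iff hU.measurableSet]
  refine integrable_of_weight (C := (weight (n + 2) 2 y₀ + 1) * (‖F y₀‖ + 1))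
    (hF.aestronglyMeasurable.indicator hU.measurableSet) fun y => ?_
  have hw := weight_nonneg (n + 2) 2 y₀
  by_cases hy : y ∈ weight (n + 2) 2 ⁻¹' Iio (weight (n + 2) 2 y₀ + 1) ∩
      (fun y => ‖F y‖) ⁻¹' Iio (‖F y₀‖ + 1)
  · rw [indicator_of_mem hy]
    exact mul_le_mul hy.1.le hy.2.le (norm_nonneg _) (by positivity)
  · rw [indicator_of_notMem hy]
    simp only [norm_zero, mul_zero]
    positivity

lemma isSlowGrowth_of_le_weight {F : Y n → ℂ} {s : ℕ} (hs : 0 < s) {C : ℝ} (hC : 0 ≤ C)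
    (h : ∀ y, ‖F y‖ ≤ C * weight s 0 y) : IsSlowGrowth F := by
  refine ⟨s, C + 1, by exact_mod_cast hs, by linarith, fun y => (h y).trans ?_⟩
  have ha := y.pos
  rw [weight_zero_right, Real.rpow_natCast, Real.rpow_natCast]
  refine mul_le_mul_of_nonneg_right ?_ (by positivity)
  have h1 : 1 ≤ (1 + |y.2.1|) ^ s := one_le_pow₀ (by linarith [abs_nonneg y.2.1])
  nlinarith

lemma weighted_le_seminormY (i : Idx) (Φ : SchwartzY n) (y : Y n) :
    weighted i Φ y ≤ seminormY n i Φ := le_ciSup (Φ.2.2 i) y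

lemma weight_mul_norm_mul_le {F : Y n → ℂ} {s : ℕ} {C : ℝ} (hC : 0 ≤ C)
    (h : ∀ y, ‖F y‖ ≤ C * weight s 0 y) (Φ : SchwartzY n) (y : Y n) :
    weight (n + 2) 2 y * ‖F y * Φ y‖ ≤ 2 * C * seminormY n (n + 2 + s, 2, 0, 0, 0) Φ := by
  have h1 := weighted_le_seminormY (n + 2 + s, 2, 0, 0, 0) Φ y
  change weight (n + 2 + s) (2 + 0) y * ‖Φ y‖ ≤ _ at h1
  rw [norm_mul]
  calc _ ≤ weight (n + 2) 2 y * (C * weight s 0 y * ‖Φ y‖) :=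
        mul_le_mul_of_nonneg_left (mul_le_mul_of_nonneg_right (h y) (norm_nonneg _))
          (weight_nonneg _ _ _)
    _ = C * (weight (n + 2) 2 y * weight s 0 y * ‖Φ y‖) := by ring
    _ ≤ C * (2 * weight (n + 2 + s) (2 + 0) y * ‖Φ y‖) :=
        mul_le_mul_of_nonneg_left (mul_le_mul_of_nonneg_right (weight_mul_le _ _ _ _ _)
          (norm_nonneg _)) hC
    _ ≤ C * (2 * seminormY n (n + 2 + s, 2, 0, 0, 0) Φ) := by
        rw [mul_assoc 2]
        gcongr
    _ = _ := by ring

lemma integrable_mul_schwartzY {F : Y n → ℂ} (hF : Continuous F) {s : ℕ} {C : ℝ} (hC : 0 ≤ C)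
    (h : ∀ y, ‖F y‖ ≤ C * weight s 0 y) (Φ : SchwartzY n) :
    Integrable (fun y => F y * Φ y) (stdMeasure n) :=
  integrable_of_weight (hF.mul Φ.2.1.continuous).aestronglyMeasurable
    (weight_mul_norm_mul_le hC h Φ)

lemma withSeminorms_schwartzY (n : ℕ) : WithSeminorms (seminormY n) := ⟨rfl⟩

lemma exists_isRegularDistribution {F : Y n → ℂ} (hF : Continuous F) {s : ℕ} (hs : 0 < s) {C : ℝ}
    (hC : 0 ≤ C) (h : ∀ y, ‖F y‖ ≤ C * weight s 0 y) :
    ∃ T : SchwartzYDual n, IsRegularDistribution T F := by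
  have hi := integrable_mul_schwartzY hF hC h
  let L : SchwartzY n →ₗ[ℂ] ℂ :=
    { toFun := fun Φ => ∫ y, F y * Φ y ∂stdMeasure n
      map_add' := fun Φ Ψ => by
        rw [← integral_add (hi Φ) (hi Ψ)]
        exact integral_congr_ae (Eventually.of_forall fun y => mul_add _ _ _)
      map_smul' := fun c Φ => by
        rw [RingHom.id_apply, smul_eq_mul, ← integral_const_mul]
        exact integral_congr_ae (Eventually.of_forall fun y => mul_left_comm _ _ _) }
  have hI : 0 ≤ ∫ y : Y n, (weight (n + 2) 2 y)⁻¹ ∂stdMeasure n :=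
    integral_nonneg fun y => inv_nonneg.2 (weight_nonneg _ _ y)
  have hL : Continuous L := by
    refine WithSeminorms.continuous_normedSpace_rng ℂ (withSeminorms_schwartzY n) L
      -- One seminorm without derivatives suffices: the exponent `s` absorbs the growth of `F`, and
      -- `n + 2` together with `2` leaves an integrable inverse weight.
      ⟨{(n + 2 + s, 2, 0, 0, 0)}, ⟨2 * C * ∫ y : Y n, (weight (n + 2) 2 y)⁻¹ ∂stdMeasure n,
        by positivity⟩, fun Φ => ?_⟩
    have h1 := norm_integral_le_of_norm_le (f := fun y => F y * Φ y)
      (integrable_inv_weight.const_mul (2 * C * seminormY n (n + 2 + s, 2, 0, 0, 0) Φ))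
      (Eventually.of_forall fun y => by
        rw [← div_eq_mul_inv, le_div_iff₀ (weight_pos _ _ y), mul_comm]
        exact weight_mul_norm_mul_le hC h Φ y)
    rw [integral_const_mul] at h1
    rw [Finset.sup_singleton]
    refine h1.trans_eq ?_
    change _ = 2 * C * (∫ y : Y n, (weight (n + 2) 2 y)⁻¹ ∂stdMeasure n) *
      seminormY n (n + 2 + s, 2, 0, 0, 0) Φ
    ring
  exact ⟨⟨L, hL⟩, locallyIntegrable_of_continuous hF, isSlowGrowth_of_le_weight hs hC h, hi,
    fun Φ => rfl⟩

lemma IsAdmissible.integrable_weight_mul {Φ : Y n → ℂ} (h : IsAdmissible Φ) (s : ℕ) :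
    Integrable (fun y => weight s 0 y * ‖Φ y‖) (stdMeasure n) := by
  obtain ⟨C, hC⟩ := h.bound (n + 2 + s) (2 + 0) 0
  refine integrable_of_weight (C := 2 * C)
    ((continuous_weight s 0).mul h.smooth.continuous.norm).aestronglyMeasurable fun y => ?_
  rw [Real.norm_of_nonneg (mul_nonneg (weight_nonneg _ _ _) (norm_nonneg _)), ← mul_assoc]
  refine (mul_le_mul_of_nonneg_right (weight_mul_le _ _ _ _ _) (norm_nonneg _)).trans ?_
  rw [mul_assoc]
  exact mul_le_mul_of_nonneg_left (hC y) zero_le_two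

/-- Fubini on the product of the jet space and `𝕐ⁿ⁺¹`. The integrand is dominated by `|κ|` times
`weight · |Φ|`, a product of integrable functions of separate variables. -/
lemma IsJetDensity.apply_synthesis [Nontrivial (Rn n)] [SFinite μ] (hf : IsJetDensity f μ κ)
    {Φ : Y n → ℂ} (h : IsAdmissible Φ) {ψ : 𝓢(ℝ, ℂ)} (hψ : ψ ∈ lizorkinReal) :
    f (h.synthesisSchwartz hψ) = ∫ y, densityTransform μ κ ψ y * Φ y ∂stdMeasure n := by
  obtain ⟨C, hC0, hC⟩ := exists_norm_jet_ridgelet_le (n := n) (N := N) ψ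
  have hi : Integrable (Function.uncurry fun (ξ : JetSpace n N) (y : Y n) =>
      jet N (ridgelet ψ y) ξ * κ ξ * Φ y) (μ.prod (stdMeasure n)) := by
    refine (hf.integrable.norm.mul_prod ((h.integrable_weight_mul (N + 1)).const_mul C)).mono' ?_
      (Eventually.of_forall fun p => ?_)
    · exact ((((continuous_jet_ridgelet ψ).comp continuous_swap).aestronglyMeasurable).mul
        hf.integrable.1.comp_fst).mul (h.smooth.continuous.comp continuous_snd).aestronglyMeasurable
    · simp only [Function.uncurry, norm_mul]
      calc _ ≤ weight (N + 1) 0 p.2 * C * ‖κ p.1‖ * ‖Φ p.2‖ := by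
            gcongr
            exact hC _ _
        _ = _ := by ring
  rw [hf.apply_eq]
  calc _ = ∫ ξ, ∫ y, jet N (ridgelet ψ y) ξ * κ ξ * Φ y ∂stdMeasure n ∂μ := by
        refine integral_congr_ae (Eventually.of_forall fun ξ => ?_)
        change jet N (synthesis ψ Φ) ξ * κ ξ = _
        rw [h.jet_synthesis, ← integral_mul_const]
        refine integral_congr_ae (Eventually.of_forall fun y => ?_)
        ring
    _ = ∫ y, ∫ ξ, jet N (ridgelet ψ y) ξ * κ ξ * Φ y ∂μ ∂stdMeasure n := integral_integral_swap hi
    _ = _ := by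
        simp only [integral_mul_const]
        rfl

end

end Ridgelet


/-! ### The ridgelet transform of an integrable distribution -/

open Ridgelet
theorem theorem5p5 (n : ℕ) (hn : 2 ≤ n) (ψ : 𝓢(ℝ, ℂ)) (hψ : ψ ∈ lizorkinReal)
    (f : 𝓢'(Rn n, ℂ)) (hf : IsIntegrableDistribution f) :
    (∀ y : Y n, HasPairing f (fun x => conj (ridgelet ψ y x)) (ridgeletFunction ψ f y)) ∧
    ∃ T : SchwartzYDual n,
      IsRidgeletTransform ψ (toLizorkinDual f) T ∧
      IsRegularDistribution T (ridgeletFunction ψ f) := by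
  have : Nonempty (Fin n) := ⟨⟨0, by omega⟩⟩
  have : Nontrivial (Rn n) := inferInstance
  obtain ⟨N, μ, κ, _, h⟩ := hf.exists_jetDensity
  have e := h.ridgeletFunction_eq ψ
  refine ⟨fun y => ?_, ?_⟩
  · rw [e, conj_ridgelet]
    exact h.hasPairing (hasBoundedDerivs_ridgelet _ y)
  · have hψ' := conjSchwartz_mem hψ
    obtain ⟨C, hC0, hC⟩ := exists_norm_densityTransform_le h.integrable (conjSchwartz ψ)
    -- The functional is built from `F`, so its continuity follows from the growth of `F` and not
    -- from continuity of the synthesis operator into `𝒮₀(ℝⁿ)`. Duality is verified afterwards for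
    -- each `Φ`.
    obtain ⟨T, hT⟩ := exists_isRegularDistribution
      (continuous_densityTransform h.integrable (conjSchwartz ψ)) N.succ_pos hC0 hC
    refine ⟨T, fun Φ => ?_, e ▸ hT⟩
    exact ⟨⟨Φ.isAdmissible.synthesisSchwartz hψ', Φ.isAdmissible.synthesisSchwartz_mem hψ'⟩,
      fun x => rfl, (hT.apply_eq Φ).trans (h.apply_synthesis Φ.isAdmissible hψ').symm⟩
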